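/- Let $\mathcal E$ be a locally presentable, locally cartesian closed category with a functorial cylinder: an endofunctor $I\otimes(-)$ with natural transformations $\delta^0,\delta^1\colon \mathrm{Id}\to I\otimes(-)$ (endpoint inclusions), $\varepsilon\colon I\otimes(-)\to\mathrm{Id}$ (contraction) and $c^0,c^1\colon I\otimes I\otimes(-)\to I\otimes(-)$ (connections) such that, for $k\in\{0,1\}$ and every object $X$, $$\varepsilon_X\circ\delta^k_X=1,\quad c^k_X\circ\delta^k_{I\otimes X}=c^k_X\circ(I\otimes\delta^k_X)=\delta^k_X\circ\varepsilon_X,\quad c^k_X\circ\delta^{1-k}_{I\otimes X}=c^k_X\circ(I\otimes\delta^{1-k}_X)=1 .$$ Assume that $I\otimes(-)$ has a right adjoint. For $i\colon A\to B$ let $\delta^k\mathbin{\hat\otimes} i\colon (I\otimes A)+_A B\to I\otimes B$ be the Leibniz product; this defines a functor $\mathcal E^\to\to\mathcal E^\to$. Let $P\colon \mathcal E^\to\times_{\mathcal E}\mathcal E^\to\to\mathcal E^\to$ be the pullback functor on cospans, $P(g,h)=h^*g$, where fibre products over $\mathcal E$ are taken along codomain functors. For a functor $u\colon\mathcal J\to\mathcal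 E^\to$, a right $\mathcal J$-map is an arrow $f$ with a chosen diagonal filler for every commutative square $u_j\to f$, $j\in\mathcal J$, natural in $j$; the right $\mathcal J$-maps and the squares compatible with the chosen fillers form a category $\mathcal J^{\pitchfork}$ over $\mathcal E^\to$. For an algebraic weak factorization system (awfs) $(\mathsf L,\mathsf R)$, write $\mathsf L\text{-coalg}$ for the category of coalgebras of the copointed endofunctor $\mathsf L$, $\mathsf R\text{-alg}$ for the category of algebras of the pointed endofunctor $\mathsf R$, and $\mathsf R\text{-Alg}$ for the category of algebras of the monad $\mathsf R$. The awfs is algebraically-free on $u$ if $\mathsf R\text{-Alg}\cong\mathcal J^{\pitchfork}$ over $\mathcal E^\to$, and cofibrantly generated if it is algebraically-free on some $u$ with $\mathcal J$ small. It satisfies the functorial Frobenius condition if there is a functor $\tilde P\colon \mathsf L\text{-coalg}\times_{\mathcal E}\mathsf R\text{-alg}\to\mathsf L\text{-coalg}$ lying strictly over $P$. An awfs $(\mathsf C,\mathsf F_t)$ on $\mathcal E$, with $\mathsf{Cof}=\mathsf C\text{-coalg}$, is suitable if (S1) it is cofibrantly generated; (S2) the functor $\mathcal E\to\mathcal E^\to$,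 $X\mapsto(0\to X)$, factors through $\mathsf{Cof}$; (S3) $P$ lifts to a functor $\mathsf{Cof}\times_{\mathcal E}\mathcal E^\to\to\mathsf{Cof}$; (S4) for $k\in\{0,1\}$, $\delta^k\mathbin{\hat\otimes}(-)$ lifts to a functor $\mathsf{Cof}\to\mathsf{Cof}$. Theorem. Let $(\mathsf C,\mathsf F_t)$ be a suitable awfs on $\mathcal E$, algebraically-free on $u\colon\mathcal I\to\mathcal E^\to$ with $\mathcal I$ small. Let $u_\otimes\colon\mathcal I_\otimes=\mathcal I+\mathcal I\to\mathcal E^\to$ be given by $\delta^0\mathbin{\hat\otimes}u$ and $\delta^1\mathbin{\hat\otimes}u$ on the two summands; a uniform fibration is a right $\mathcal I_\otimes$-map. Let $(\mathsf C_t,\mathsf F)$ be an awfs on $\mathcal E$ whose category of monad algebras $\mathsf F\text{-Alg}$ is isomorphic, over $\mathcal E^\to$, to the category of uniform fibrations. Then $(\mathsf C_t,\mathsf F)$ satisfies the functorial Frobenius condition. -/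

import Mathlib

open CategoryTheory CategoryTheory.Limits

universe w v u v₁ u₁ v₂ u₂ v₃ u₃ v₄ u₄ v₅ u₅

namespace UniformFib

/-! ### Ambient assumptions -/

/-- A category with pullbacks is locally cartesian closed if every pullback functor between
slices has a right adjoint (pushforward). -/
class IsLocallyCartesianClosed (E : Type u) [Category.{v} E] [HasPullbacks E] : Prop where
  isLeftAdjoint_pullback : ∀ {X Y : E} (f : X ⟶ Y), (Over.pullback f).IsLeftAdjoint

/-- A locally presentable category is cocomplete. -/
instance hasColimits_of_isLocallyPresentable (E : Type u) [Category.{v} E]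
    [IsLocallyPresentable.{v} E] : HasColimits E := by
  obtain ⟨κ, _, _⟩ := IsLocallyPresentable.exists_cardinal.{v} E
  exact (inferInstance : HasColimitsOfSize.{v, v} E)

/-- A functorial cylinder `I ⊗ (-)` with contractions and connections. The endpoint inclusions
and the connections are indexed by `k : Fin 2`, and `1 - k` is the other endpoint. -/
structure FunctorialCylinder (E : Type u) [Category.{v} E] where
  /-- The endofunctor `I ⊗ (-)`. -/
  cyl : E ⥤ E
  /-- The endpoint inclusions. -/
  endpoint : Fin 2 → (𝟭 E ⟶ cyl)
  /-- The contraction. -/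
  contr : cyl ⟶ 𝟭 E
  endpoint_contr : ∀ (k : Fin 2) (X : E), (endpoint k).app X ≫ contr.app X = 𝟙 X
  /-- The connections `I ⊗ I ⊗ (-) ⟶ I ⊗ (-)`. -/
  conn : Fin 2 → (cyl ⋙ cyl ⟶ cyl)
  endpoint_conn : ∀ (k : Fin 2) (X : E),
    (endpoint k).app (cyl.obj X) ≫ (conn k).app X = contr.app X ≫ (endpoint k).app X
  map_endpoint_conn : ∀ (k : Fin 2) (X : E),
    cyl.map ((endpoint k).app X) ≫ (conn k).app X = contr.app X ≫ (endpoint k).app X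
  other_endpoint_conn : ∀ (k : Fin 2) (X : E),
    (endpoint (1 - k)).app (cyl.obj X) ≫ (conn k).app X = 𝟙 (cyl.obj X)
  map_other_endpoint_conn : ∀ (k : Fin 2) (X : E),
    cyl.map ((endpoint (1 - k)).app X) ≫ (conn k).app X = 𝟙 (cyl.obj X)

namespace FunctorialCylinder

variable {E : Type u} [Category.{v} E] (c : FunctorialCylinder E)

/-- The component `δᵏ ⊗ X : X ⟶ I ⊗ X` of an endpoint inclusion. -/
def δ (k : Fin 2) (X : E) : X ⟶ c.cyl.obj X := (c.endpoint k).app X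

lemma δ_naturality (k : Fin 2) {X Y : E} (f : X ⟶ Y) :
    c.δ k X ≫ c.cyl.map f = f ≫ c.δ k Y :=
  ((c.endpoint k).naturality f).symm

variable [HasPushouts E]

/-- The Leibniz product `δᵏ ⊗̂ i : (I ⊗ A) +_A B ⟶ I ⊗ B` of an endpoint inclusion and a map
`i : A ⟶ B`. -/
noncomputable def leibnizObj (k : Fin 2) (i : Arrow E) :
    pushout (c.δ k i.left) i.hom ⟶ c.cyl.obj i.right :=
  pushout.desc (c.cyl.map i.hom) (c.δ k i.right) (c.δ_naturality k i.hom)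

/-- The map of pushouts induced by a square. -/
noncomputable def leibnizLeft (k : Fin 2) {i j : Arrow E} (α : i ⟶ j) :
    pushout (c.δ k i.left) i.hom ⟶ pushout (c.δ k j.left) j.hom :=
  pushout.desc (c.cyl.map α.left ≫ pushout.inl (c.δ k j.left) j.hom)
    (α.right ≫ pushout.inr (c.δ k j.left) j.hom)
    (by
      rw [← Category.assoc, c.δ_naturality, Category.assoc, pushout.condition, ← Category.assoc,
        ← Category.assoc, Arrow.w])

lemma leibniz_w (k : Fin 2) {i j : Arrow E} (α : i ⟶ j) :
    c.leibnizLeft k α ≫ c.leibnizObj k j = c.leibnizObj k i ≫ c.cyl.map α.right := by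
  unfold leibnizLeft leibnizObj
  apply pushout.hom_ext
  · rw [pushout.inl_desc_assoc, pushout.inl_desc_assoc, Category.assoc, pushout.inl_desc,
      ← Functor.map_comp, ← Functor.map_comp, Arrow.w]
  · rw [pushout.inr_desc_assoc, pushout.inr_desc_assoc, Category.assoc, pushout.inr_desc,
      c.δ_naturality]

lemma leibnizLeft_id (k : Fin 2) (i : Arrow E) : c.leibnizLeft k (𝟙 i) = 𝟙 _ := by
  unfold leibnizLeft
  apply pushout.hom_ext
  · rw [pushout.inl_desc]; simp
  · rw [pushout.inr_desc]; simp

lemma leibnizLeft_comp (k : Fin 2) {i j l : Arrow E} (α : i ⟶ j) (β : j ⟶ l) :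
    c.leibnizLeft k (α ≫ β) = c.leibnizLeft k α ≫ c.leibnizLeft k β := by
  unfold leibnizLeft
  apply pushout.hom_ext
  · rw [pushout.inl_desc, pushout.inl_desc_assoc, Category.assoc, pushout.inl_desc]; simp
  · rw [pushout.inr_desc, pushout.inr_desc_assoc, Category.assoc, pushout.inr_desc]; simp

/-- The Leibniz product functor `δᵏ ⊗̂ (-)`. -/
noncomputable def leibniz (k : Fin 2) : Arrow E ⥤ Arrow E where
  obj i := Arrow.mk (c.leibnizObj k i)
  map α := Arrow.homMk' (c.leibnizLeft k α) (c.cyl.map α.right) (c.leibniz_w k α)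
  map_id i := Arrow.hom_ext _ _ (c.leibnizLeft_id k i) (c.cyl.map_id i.right)
  map_comp α β := Arrow.hom_ext _ _ (c.leibnizLeft_comp k α β)
    (c.cyl.map_comp α.right β.right)

end FunctorialCylinder

/-- The functor sending `X` to the map `⊥_X : 0 ⟶ X`. -/
noncomputable def botArrow (E : Type u) [Category.{v} E] [HasInitial E] : E ⥤ Arrow E where
  obj X := Arrow.mk (initial.to X)
  map f := Arrow.homMk (𝟙 _) f (by simp)

/-! ### Categories over another category -/

/-- The strict pullback of categories. -/
structure StrictPullback {A : Type u₁} [Category.{v₁} A] {B : Type u₂} [Category.{v₂} B]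
    {C : Type u₃} [Category.{v₃} C] (F : A ⥤ C) (G : B ⥤ C) where
  fst : A
  snd : B
  eq : F.obj fst = G.obj snd

namespace StrictPullback

section

variable {A : Type u₁} [Category.{v₁} A] {B : Type u₂} [Category.{v₂} B]
  {C : Type u₃} [Category.{v₃} C] {F : A ⥤ C} {G : B ⥤ C}

/-- A morphism in the strict pullback: a pair of morphisms with the same image in `C`. -/
@[ext]
structure Hom (x y : StrictPullback F G) where
  fst : x.fst ⟶ y.fst
  snd : x.snd ⟶ y.snd
  w : F.map fst ≫ eqToHom y.eq = eqToHom x.eq ≫ G.map snd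

instance : Category (StrictPullback F G) where
  Hom x y := Hom x y
  id _ := ⟨𝟙 _, 𝟙 _, by simp⟩
  comp f g := ⟨f.fst ≫ g.fst, f.snd ≫ g.snd, by
    rw [F.map_comp, Category.assoc, g.w, ← Category.assoc, f.w, Category.assoc, G.map_comp]⟩

@[simp]
lemma id_fst (x : StrictPullback F G) : Hom.fst (𝟙 x) = 𝟙 x.fst := rfl

@[simp]
lemma id_snd (x : StrictPullback F G) : Hom.snd (𝟙 x) = 𝟙 x.snd := rfl

@[simp]
lemma comp_fst {x y z : StrictPullback F G} (f : x ⟶ y) (g : y ⟶ z) :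
    Hom.fst (f ≫ g) = Hom.fst f ≫ Hom.fst g := rfl

@[simp]
lemma comp_snd {x y z : StrictPullback F G} (f : x ⟶ y) (g : y ⟶ z) :
    Hom.snd (f ≫ g) = Hom.snd f ≫ Hom.snd g := rfl

end

/-- The functor `A ×_C B ⥤ A' ×_C B'` induced by `U : A ⥤ A'` and `V : B ⥤ B'` over `C`. -/
def map {A : Type u₁} [Category.{v₁} A] {B : Type u₂} [Category.{v₂} B]
    {C : Type u₃} [Category.{v₃} C] {A' : Type u₄} [Category.{v₄} A']
    {B' : Type u₅} [Category.{v₅} B'] (U : A ⥤ A') (V : B ⥤ B') (F : A' ⥤ C) (G : B' ⥤ C) :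
    StrictPullback (U ⋙ F) (V ⋙ G) ⥤ StrictPullback F G where
  obj x := ⟨U.obj x.fst, V.obj x.snd, x.eq⟩
  map f := ⟨U.map f.fst, V.map f.snd, f.w⟩
  map_id _ := Hom.ext (U.map_id _) (V.map_id _)
  map_comp _ _ := Hom.ext (U.map_comp _ _) (V.map_comp _ _)

end StrictPullback

/-- `F : C ⥤ D` lifts to a functor `A ⥤ B` along `U : A ⥤ C` and `V : B ⥤ D`, i.e. there is a
strictly commutative square of functors. -/
def HasLift {A : Type u₁} [Category.{v₁} A] {B : Type u₂} [Category.{v₂} B]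
    {C : Type u₃} [Category.{v₃} C] {D : Type u₄} [Category.{v₄} D]
    (U : A ⥤ C) (V : B ⥤ D) (F : C ⥤ D) : Prop :=
  ∃ F' : A ⥤ B, F' ⋙ V = U ⋙ F

/-- The categories `A` and `B` over `C` are isomorphic as categories over `C`. -/
def IsoOver {A : Type u₁} [Category.{v₁} A] {B : Type u₂} [Category.{v₂} B]
    {C : Type u₃} [Category.{v₃} C] (U : A ⥤ C) (V : B ⥤ C) : Prop :=
  ∃ (Φ : A ⥤ B) (Ψ : B ⥤ A), Φ ⋙ Ψ = 𝟭 A ∧ Ψ ⋙ Φ = 𝟭 B ∧ Φ ⋙ V = U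

/-- The category of cospans `g : A ⟶ B`, `h : X ⟶ B`: the pullback of the codomain functor
`Arrow E ⥤ E` with itself. -/
abbrev Cospans (E : Type u) [Category.{v} E] : Type (max u v) :=
  StrictPullback (Arrow.rightFunc : Arrow E ⥤ E) (Arrow.rightFunc : Arrow E ⥤ E)

lemma Cospans.right_eq {E : Type u} [Category.{v} E] (x : Cospans E) :
    x.fst.right = x.snd.right :=
  x.eq

lemma Cospans.right_w {E : Type u} [Category.{v} E] {x y : Cospans E} (φ : x ⟶ y) :
    φ.fst.right ≫ eqToHom y.right_eq = eqToHom x.right_eq ≫ φ.snd.right :=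
  φ.w

/-- The base change `h^* g` of a cospan `(g, h)`. -/
noncomputable def Cospans.baseChange {E : Type u} [Category.{v} E] [HasPullbacks E]
    (x : Cospans E) : pullback (x.fst.hom ≫ eqToHom x.right_eq) x.snd.hom ⟶ x.snd.left :=
  pullback.snd (x.fst.hom ≫ eqToHom x.right_eq) x.snd.hom

/-- The map of pullbacks induced by a morphism of cospans. -/
noncomputable def Cospans.baseChangeLeft {E : Type u} [Category.{v} E] [HasPullbacks E]
    {x y : Cospans E} (φ : x ⟶ y) :
    pullback (x.fst.hom ≫ eqToHom x.right_eq) x.snd.hom ⟶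
      pullback (y.fst.hom ≫ eqToHom y.right_eq) y.snd.hom :=
  pullback.lift
    (pullback.fst (x.fst.hom ≫ eqToHom x.right_eq) x.snd.hom ≫ φ.fst.left)
    (pullback.snd (x.fst.hom ≫ eqToHom x.right_eq) x.snd.hom ≫ φ.snd.left)
    (by
      rw [Category.assoc, Category.assoc, Arrow.w, ← pullback.condition_assoc,
        ← Category.assoc φ.fst.left, Arrow.w, Category.assoc, Category.assoc, Cospans.right_w])

lemma Cospans.baseChange_w {E : Type u} [Category.{v} E] [HasPullbacks E]
    {x y : Cospans E} (φ : x ⟶ y) :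
    Cospans.baseChangeLeft φ ≫ y.baseChange = x.baseChange ≫ φ.snd.left :=
  pullback.lift_snd _ _ _

lemma Cospans.baseChangeLeft_id {E : Type u} [Category.{v} E] [HasPullbacks E]
    (x : Cospans E) : Cospans.baseChangeLeft (𝟙 x) = 𝟙 _ := by
  unfold Cospans.baseChangeLeft
  apply pullback.hom_ext
  · rw [pullback.lift_fst]; simp
  · rw [pullback.lift_snd]; simp

lemma Cospans.baseChangeLeft_comp {E : Type u} [Category.{v} E] [HasPullbacks E]
    {x y z : Cospans E} (φ : x ⟶ y) (ψ : y ⟶ z) :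
    Cospans.baseChangeLeft (φ ≫ ψ) =
      Cospans.baseChangeLeft φ ≫ Cospans.baseChangeLeft ψ := by
  unfold Cospans.baseChangeLeft
  apply pullback.hom_ext
  · rw [pullback.lift_fst, Category.assoc, pullback.lift_fst, pullback.lift_fst_assoc]; simp
  · rw [pullback.lift_snd, Category.assoc, pullback.lift_snd, pullback.lift_snd_assoc]; simp

/-- The pullback functor, sending a cospan `(g, h)` to `h^* g`, the base change of `g`
along `h`. -/
noncomputable def pullbackFunctor (E : Type u) [Category.{v} E] [HasPullbacks E] :
    Cospans E ⥤ Arrow E where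
  obj x := Arrow.mk x.baseChange
  map φ := Arrow.homMk' (Cospans.baseChangeLeft φ) φ.snd.left (Cospans.baseChange_w φ)
  map_id x := Arrow.hom_ext _ _ (Cospans.baseChangeLeft_id x) rfl
  map_comp φ ψ := Arrow.hom_ext _ _ (Cospans.baseChangeLeft_comp φ ψ) rfl

/-! ### Categories of right maps -/

/-- A right `J`-map, for `j : J ⥤ Arrow E`: an arrow with a choice of diagonal fillers against
all the arrows `j.obj i`, natural in `i`. A commutative square is a morphism of `Arrow E`. -/
structure RightMap {E : Type u} [Category.{v} E] {J : Type u₁} [Category.{v₁} J]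
    (j : J ⥤ Arrow E) where
  arrow : Arrow E
  fill : ∀ (i : J) (_ : j.obj i ⟶ arrow), ((j.obj i).right ⟶ arrow.left)
  hom_fill : ∀ (i : J) (sq : j.obj i ⟶ arrow), (j.obj i).hom ≫ fill i sq = sq.left
  fill_hom : ∀ (i : J) (sq : j.obj i ⟶ arrow), fill i sq ≫ arrow.hom = sq.right
  fill_natural : ∀ {i i' : J} (σ : i ⟶ i') (sq : j.obj i' ⟶ arrow),
    fill i (j.map σ ≫ sq) = (j.map σ).right ≫ fill i' sq

namespace RightMap

variable {E : Type u} [Category.{v} E] {J : Type u₁} [Category.{v₁} J] {j : J ⥤ Arrow E}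

/-- A morphism of right maps: a square compatible with the chosen fillers. -/
@[ext]
structure Hom (f g : RightMap j) where
  hom : f.arrow ⟶ g.arrow
  fill_comp : ∀ (i : J) (sq : j.obj i ⟶ f.arrow),
    f.fill i sq ≫ hom.left = g.fill i (sq ≫ hom)

instance : Category (RightMap j) where
  Hom f g := Hom f g
  id f := ⟨𝟙 _, fun i sq => by simp⟩
  comp a b := ⟨a.hom ≫ b.hom, fun i sq => by
    rw [Arrow.comp_left, ← Category.assoc, a.fill_comp, b.fill_comp, Category.assoc]⟩

end RightMap

/-- The forgetful functor from right `J`-maps to arrows. -/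
def RightMap.forget {E : Type u} [Category.{v} E] {J : Type u₁} [Category.{v₁} J]
    (j : J ⥤ Arrow E) : RightMap j ⥤ Arrow E where
  obj f := f.arrow
  map a := a.hom

/-! ### Coalgebras and algebras for (co)pointed endofunctors -/

/-- A coalgebra for a copointed endofunctor `(F, ε)`. -/
structure CopointedCoalgebra {C : Type u} [Category.{v} C] {F : C ⥤ C} (ε : F ⟶ 𝟭 C) where
  obj : C
  str : obj ⟶ F.obj obj
  counit : str ≫ ε.app obj = 𝟙 obj

namespace CopointedCoalgebra

variable {C : Type u} [Category.{v} C] {F : C ⥤ C} {ε : F ⟶ 𝟭 C}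

/-- A morphism of coalgebras. -/
@[ext]
structure Hom (x y : CopointedCoalgebra ε) where
  hom : x.obj ⟶ y.obj
  w : x.str ≫ F.map hom = hom ≫ y.str

instance : Category (CopointedCoalgebra ε) where
  Hom x y := Hom x y
  id x := ⟨𝟙 _, by simp⟩
  comp a b := ⟨a.hom ≫ b.hom, by
    rw [F.map_comp, ← Category.assoc, a.w, Category.assoc, b.w, Category.assoc]⟩

end CopointedCoalgebra

/-- The forgetful functor from coalgebras for a copointed endofunctor. -/
def CopointedCoalgebra.forget {C : Type u} [Category.{v} C] {F : C ⥤ C} (ε : F ⟶ 𝟭 C) :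
    CopointedCoalgebra ε ⥤ C where
  obj x := x.obj
  map a := a.hom

/-- An algebra for a pointed endofunctor `(F, η)`. -/
structure PointedAlgebra {C : Type u} [Category.{v} C] {F : C ⥤ C} (η : 𝟭 C ⟶ F) where
  obj : C
  str : F.obj obj ⟶ obj
  unit : η.app obj ≫ str = 𝟙 obj

namespace PointedAlgebra

variable {C : Type u} [Category.{v} C] {F : C ⥤ C} {η : 𝟭 C ⟶ F}

/-- A morphism of algebras. -/
@[ext]
structure Hom (x y : PointedAlgebra η) where
  hom : x.obj ⟶ y.obj
  w : F.map hom ≫ y.str = x.str ≫ hom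

instance : Category (PointedAlgebra η) where
  Hom x y := Hom x y
  id x := ⟨𝟙 _, by simp⟩
  comp a b := ⟨a.hom ≫ b.hom, by
    rw [F.map_comp, Category.assoc, b.w, ← Category.assoc, a.w, Category.assoc]⟩

end PointedAlgebra

/-- The forgetful functor from algebras for a pointed endofunctor. -/
def PointedAlgebra.forget {C : Type u} [Category.{v} C] {F : C ⥤ C} (η : 𝟭 C ⟶ F) :
    PointedAlgebra η ⥤ C where
  obj x := x.obj
  map a := a.hom

/-! ### Algebraic weak factorization systems -/

/-- A functorial factorization `X ⟶ M f ⟶ Y` of the arrows `f : X ⟶ Y` of `E`. -/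
structure FunctorialFactorization (E : Type u) [Category.{v} E] where
  mid : Arrow E ⥤ E
  left : ∀ f : Arrow E, f.left ⟶ mid.obj f
  right : ∀ f : Arrow E, mid.obj f ⟶ f.right
  left_naturality : ∀ {f g : Arrow E} (α : f ⟶ g), α.left ≫ left g = left f ≫ mid.map α
  right_naturality : ∀ {f g : Arrow E} (α : f ⟶ g), mid.map α ≫ right g = right f ≫ α.right
  fac : ∀ f : Arrow E, left f ≫ right f = f.hom

namespace FunctorialFactorization

variable {E : Type u} [Category.{v} E] (T : FunctorialFactorization E)

/-- The endofunctor of arrows sending `f` to its left factor. -/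
@[simps]
def L : Arrow E ⥤ Arrow E where
  obj f := Arrow.mk (T.left f)
  map α := Arrow.homMk α.left (T.mid.map α) (T.left_naturality α)

/-- The endofunctor of arrows sending `f` to its right factor. -/
@[simps]
def R : Arrow E ⥤ Arrow E where
  obj f := Arrow.mk (T.right f)
  map α := Arrow.homMk (T.mid.map α) α.right (T.right_naturality α)

/-- The canonical copointing `(𝟙, R) : L ⟶ 𝟭`. -/
@[simps]
def copoint : T.L ⟶ 𝟭 (Arrow E) where
  app f := Arrow.homMk (f := Arrow.mk (T.left f)) (g := f) (𝟙 f.left) (T.right f)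
    ((Category.id_comp f.hom).trans (T.fac f).symm)
  naturality f g α := by
    ext
    · exact (Category.comp_id α.left).trans (Category.id_comp α.left).symm
    · exact T.right_naturality α

/-- The canonical pointing `(L, 𝟙) : 𝟭 ⟶ R`. -/
@[simps]
def point : 𝟭 (Arrow E) ⟶ T.R where
  app f := Arrow.homMk (f := f) (g := Arrow.mk (T.right f)) (T.left f) (𝟙 f.right)
    ((T.fac f).trans (Category.comp_id f.hom).symm)
  naturality f g α := by
    ext
    · exact T.left_naturality α
    · exact (Category.comp_id α.right).trans (Category.id_comp α.right).symm

end FunctorialFactorization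

/-- A functorial factorization with a comonad structure on `L` and a monad structure on `R`
extending the canonical copointing and pointing. -/
structure MonadicFactorization (E : Type u) [Category.{v} E] extends
    FunctorialFactorization E where
  comult : toFunctorialFactorization.L ⟶
    toFunctorialFactorization.L ⋙ toFunctorialFactorization.L
  comult_coassoc : ∀ f : Arrow E,
    comult.app f ≫ toFunctorialFactorization.L.map (comult.app f) =
      comult.app f ≫ comult.app (toFunctorialFactorization.L.obj f)
  comult_left_counit : ∀ f : Arrow E,
    comult.app f ≫
      toFunctorialFactorization.copoint.app (toFunctorialFactorization.L.obj f) = 𝟙 _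
  comult_right_counit : ∀ f : Arrow E,
    comult.app f ≫
      toFunctorialFactorization.L.map (toFunctorialFactorization.copoint.app f) = 𝟙 _
  mult : toFunctorialFactorization.R ⋙ toFunctorialFactorization.R ⟶
    toFunctorialFactorization.R
  mult_assoc : ∀ f : Arrow E,
    toFunctorialFactorization.R.map (mult.app f) ≫ mult.app f =
      mult.app (toFunctorialFactorization.R.obj f) ≫ mult.app f
  mult_left_unit : ∀ f : Arrow E,
    toFunctorialFactorization.point.app (toFunctorialFactorization.R.obj f) ≫
      mult.app f = 𝟙 _
  mult_right_unit : ∀ f : Arrow E,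
    toFunctorialFactorization.R.map (toFunctorialFactorization.point.app f) ≫
      mult.app f = 𝟙 _

namespace MonadicFactorization

variable {E : Type u} [Category.{v} E] (T : MonadicFactorization E)

/-- The comonad `L`. -/
def comonad : Comonad (Arrow E) where
  toFunctor := T.L
  ε := T.copoint
  δ := T.comult
  coassoc := T.comult_coassoc
  left_counit := T.comult_left_counit
  right_counit := T.comult_right_counit

/-- The monad `R`. -/
def monad : Monad (Arrow E) where
  toFunctor := T.R
  η := T.point
  μ := T.mult
  assoc := T.mult_assoc
  left_unit := T.mult_left_unit
  right_unit := T.mult_right_unit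

/-- The component `M f ⟶ M (L f)` of the comultiplication. -/
def σ (f : Arrow E) : T.mid.obj f ⟶ T.mid.obj (T.L.obj f) := (T.comult.app f).right

/-- The component `M (R f) ⟶ M f` of the multiplication. -/
def π (f : Arrow E) : T.mid.obj (T.R.obj f) ⟶ T.mid.obj f := (T.mult.app f).left

lemma σ_right (f : Arrow E) : T.σ f ≫ T.right (T.L.obj f) = 𝟙 _ :=
  congrArg CommaMorphism.right (T.comult_left_counit f)

lemma left_π (f : Arrow E) : T.left (T.R.obj f) ≫ T.π f = 𝟙 _ :=
  congrArg CommaMorphism.left (T.mult_left_unit f)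

/-- The canonical natural transformation `LR ⟶ RL`. Its component at `f` is the square from
`L (R f) : M f ⟶ M (R f)` to `R (L f) : M (L f) ⟶ M f` given by the comultiplication and the
multiplication. (In `Functor.comp` order, `LR` is `T.R ⋙ T.L`.) -/
def canonical : T.R ⋙ T.L ⟶ T.L ⋙ T.R where
  app f := Arrow.homMk (f := (T.R ⋙ T.L).obj f) (g := (T.L ⋙ T.R).obj f) (T.σ f) (T.π f)
    ((T.σ_right f).trans (T.left_π f).symm)
  naturality f g α := by
    ext
    · exact congrArg CommaMorphism.right (T.comult.naturality α)
    · exact congrArg CommaMorphism.left (T.mult.naturality α)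

end MonadicFactorization

/-- A natural transformation `Δ : G T ⟶ T G` is a distributive law of the comonad `G` over the
monad `T`. -/
structure IsDistributiveLaw {C : Type u} [Category.{v} C] (G : Comonad C) (T : Monad C)
    (Δ : T.toFunctor ⋙ G.toFunctor ⟶ G.toFunctor ⋙ T.toFunctor) : Prop where
  unit : ∀ X : C, G.map (T.η.app X) ≫ Δ.app X = T.η.app (G.obj X)
  mult : ∀ X : C, G.map (T.μ.app X) ≫ Δ.app X =
    Δ.app (T.obj X) ≫ T.map (Δ.app X) ≫ T.μ.app (G.obj X)
  counit : ∀ X : C, Δ.app X ≫ T.map (G.ε.app X) = G.ε.app (T.obj X)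
  comult : ∀ X : C, Δ.app X ≫ T.map (G.δ.app X) =
    G.δ.app (T.obj X) ≫ G.map (Δ.app X) ≫ Δ.app (G.obj X)

/-- An algebraic weak factorization system `(L, R)` on `E`. -/
structure AWFS (E : Type u) [Category.{v} E] extends MonadicFactorization E where
  distributive : IsDistributiveLaw toMonadicFactorization.comonad toMonadicFactorization.monad
    toMonadicFactorization.canonical

namespace AWFS

variable {E : Type u} [Category.{v} E] (S : AWFS E)

/-- The category of coalgebras for the copointed endofunctor `L`. -/
abbrev LCoalg := CopointedCoalgebra S.copoint

/-- The forgetful functor from `L`-coalgebras to arrows. -/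
abbrev LCoalg.forget : S.LCoalg ⥤ Arrow E := CopointedCoalgebra.forget S.copoint

/-- The category of algebras for the pointed endofunctor `R`. -/
abbrev RAlg := PointedAlgebra S.point

/-- The forgetful functor from pointed endofunctor algebras for `R` to arrows. -/
abbrev RAlg.forget : S.RAlg ⥤ Arrow E := PointedAlgebra.forget S.point

/-- `(L, R)` is algebraically-free on `j : J ⥤ Arrow E`: the category of monad algebras for `R`
is isomorphic, over arrows, to the category of right `J`-maps. -/
def IsAlgebraicallyFree {J : Type u₁} [Category.{v₁} J] (j : J ⥤ Arrow E) : Prop :=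
  IsoOver S.monad.forget (RightMap.forget j)

/-- `(L, R)` is cofibrantly generated: it is algebraically-free on a small category of arrows. -/
def IsCofibrantlyGenerated : Prop :=
  ∃ (J : Type v) (_ : SmallCategory J) (j : J ⥤ Arrow E), S.IsAlgebraicallyFree j

/-- The functorial Frobenius condition: the pullback functor on cospans, sending `(g, h)` to
`h^* g`, lifts to a functor which sends an `L`-coalgebra `g` and an `R`-algebra `h` with the
same codomain to an `L`-coalgebra. -/
def FunctorialFrobenius [HasPullbacks E] : Prop :=
  HasLift
    (StrictPullback.map (LCoalg.forget S) (RAlg.forget S) Arrow.rightFunc Arrow.rightFunc)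
    (LCoalg.forget S) (pullbackFunctor E)

/-- A suitable awfs, with respect to a functorial cylinder. -/
structure IsSuitable [HasPullbacks E] [HasPushouts E] [HasInitial E]
    (c : FunctorialCylinder E) : Prop where
  cofibrantlyGenerated : S.IsCofibrantlyGenerated
  bot : ∃ B : E ⥤ S.LCoalg, B ⋙ LCoalg.forget S = botArrow E
  pullback : HasLift
    (StrictPullback.map (LCoalg.forget S) (𝟭 (Arrow E)) Arrow.rightFunc Arrow.rightFunc)
    (LCoalg.forget S) (pullbackFunctor E)
  leibniz : ∀ k : Fin 2, HasLift (LCoalg.forget S) (LCoalg.forget S) (c.leibniz k)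

end AWFS

/-! ### Uniform fibrations -/

/-- The generating uniform trivial cofibrations `u_⊗ : J + J ⥤ Arrow E` associated with
`j : J ⥤ Arrow E`, given by `δ⁰ ⊗̂ j` and `δ¹ ⊗̂ j` on the two summands. The uniform fibrations
are the right maps for this functor. -/
noncomputable def FunctorialCylinder.tensorGen {E : Type u} [Category.{v} E] [HasPushouts E]
    (c : FunctorialCylinder E) {J : Type u₁} [Category.{v₁} J] (j : J ⥤ Arrow E) :
    J ⊕ J ⥤ Arrow E :=
  (j ⋙ c.leibniz 0).sum' (j ⋙ c.leibniz 1)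

/-- The category of uniform fibrations, for the generating uniform cofibrations `j`. -/
abbrev UniformFibration {E : Type u} [Category.{v} E] [HasPushouts E]
    (c : FunctorialCylinder E) {J : Type u₁} [Category.{v₁} J] (j : J ⥤ Arrow E) :=
  RightMap (c.tensorGen j)

/-- The forgetful functor from uniform fibrations to arrows. -/
noncomputable abbrev UniformFibration.forget {E : Type u} [Category.{v} E] [HasPushouts E]
    (c : FunctorialCylinder E) {J : Type u₁} [Category.{v₁} J] (j : J ⥤ Arrow E) :
    UniformFibration c j ⥤ Arrow E :=
  RightMap.forget (c.tensorGen j)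

end UniformFib

namespace UniformFib

/-! ### Natural lifting operations -/

/-! A functor to `Arrow E` lifts to coalgebras of an awfs exactly when its values have natural
fillers against the monad algebras: a coalgebra structure on `f` is a filler against the free
algebra on `f` (`toLCoalg`), and conversely coalgebras lift against algebras. For an awfs
algebraically-free on generators, monad algebras may be replaced by right maps for the generators.
The theorem thus becomes: the base change of a `Ct`-coalgebra along an algebra has natural fillers
against uniform fibrations.

For the generators `δᵏ ⊗̂ i` this rests on strong homotopy equivalences, that is, arrows `g` for
which the square `g ⟶ δᵏ ⊗̂ g` given by the opposite endpoint has a retraction. (a) Every `δᵏ ⊗̂ i`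
is one, the retraction being built from the connection (`leibnizUnit_connRetraction`). (b) They are
stable under base change along a map `h` that lifts against `δ¹⁻ᵏ`: the homotopy on the codomain is
lifted through `h` (`leibnizUnit_baseChangeRetraction`). Algebras `h` do lift against `δ¹⁻ᵏ`,
because `δ¹⁻ᵏ` at `X` is a retract of its Leibniz product with the cofibration `0 ⟶ X`. (c) By (S4)
and (S3) the base change of `δᵏ ⊗̂ i` is again a `C`-coalgebra `g`. By (a) and (b) it is a retract
of `δᵏ ⊗̂ g`, and Leibniz products of `C`-coalgebras lift against uniform fibrations by
transposition to the pullback exponential (`nonempty_natLift_leibniz`).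

For arbitrary `Ct`-coalgebras one uses pushforward along `h`, right adjoint to pullback. By (c) and
transposition, pushforwards of uniform fibrations along `h` are uniform fibrations
(`Pushforward.rightMap`). A coalgebra therefore lifts against them, and transposing back gives
fillers for its base change (`transferFill`). Everything is carried out with chosen fillers, so each
step must also be natural; the delicate case is a change of `h`, where a comparison map of
pushforwards has to preserve fillers (`transferFill_natural_base`). -/

/-- A choice of diagonal fillers for all squares from the arrows `U.obj a` to the arrows
`V.obj b`, natural in `a` and in `b`. -/
structure NatLift {E : Type u} [Category.{v} E] {A : Type u₁} [Category.{v₁} A]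
    {B : Type u₂} [Category.{v₂} B] (U : A ⥤ Arrow E) (V : B ⥤ Arrow E) where
  fill : ∀ {a : A} {b : B} (_ : U.obj a ⟶ V.obj b), ((U.obj a).right ⟶ (V.obj b).left)
  hom_fill : ∀ {a : A} {b : B} (sq : U.obj a ⟶ V.obj b), (U.obj a).hom ≫ fill sq = sq.left
  fill_hom : ∀ {a : A} {b : B} (sq : U.obj a ⟶ V.obj b), fill sq ≫ (V.obj b).hom = sq.right
  natural_left : ∀ {a a' : A} {b : B} (φ : a ⟶ a') (sq : U.obj a' ⟶ V.obj b),
    fill (U.map φ ≫ sq) = (U.map φ).right ≫ fill sq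
  natural_right : ∀ {a : A} {b b' : B} (ψ : b ⟶ b') (sq : U.obj a ⟶ V.obj b),
    fill (sq ≫ V.map ψ) = fill sq ≫ (V.map ψ).left

namespace NatLift

variable {E : Type u} [Category.{v} E] {A : Type u₁} [Category.{v₁} A]
  {B : Type u₂} [Category.{v₂} B] {U : A ⥤ Arrow E} {V : B ⥤ Arrow E}
  {A' : Type u₃} [Category.{v₃} A'] {B' : Type u₄} [Category.{v₄} B']

/-- Restriction of a natural lifting operation along a functor on the left. -/
def compLeft (l : NatLift U V) (F : A' ⥤ A) : NatLift (F ⋙ U) V where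
  fill sq := l.fill sq
  hom_fill sq := l.hom_fill sq
  fill_hom sq := l.fill_hom sq
  natural_left φ sq := l.natural_left (F.map φ) sq
  natural_right ψ sq := l.natural_right ψ sq

/-- Restriction of a natural lifting operation along a functor on the right. -/
def compRight (l : NatLift U V) (F : B' ⥤ B) : NatLift U (F ⋙ V) where
  fill sq := l.fill sq
  hom_fill sq := l.hom_fill sq
  fill_hom sq := l.fill_hom sq
  natural_left φ sq := l.natural_left φ sq
  natural_right ψ sq := l.natural_right (F.map ψ) sq

/-- Natural lifting operations are inherited by natural retracts on the left. -/
def retract (l : NatLift U V) {U' : A ⥤ Arrow E} (ι : U' ⟶ U) (r : U ⟶ U')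
    (h : ι ≫ r = 𝟙 U') : NatLift U' V where
  fill {a _} sq := (ι.app a).right ≫ l.fill (r.app a ≫ sq)
  hom_fill {a _} sq := by
    rw [← Arrow.w_assoc, l.hom_fill, Arrow.comp_left, ← Category.assoc, ← Arrow.comp_left,
      ← NatTrans.comp_app, h]
    exact Category.id_comp _
  fill_hom {a _} sq := by
    rw [Category.assoc, l.fill_hom, Arrow.comp_right, ← Category.assoc, ← Arrow.comp_right,
      ← NatTrans.comp_app, h]
    exact Category.id_comp _
  natural_left {a a' b} φ sq := by
    rw [← Category.assoc (r.app a), ← r.naturality, Category.assoc, l.natural_left,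
      ← Category.assoc, ← Category.assoc, ← Arrow.comp_right, ← Arrow.comp_right, ι.naturality]
  natural_right ψ sq := by
    rw [← Category.assoc, l.natural_right, Category.assoc]

/-- The tautological lifting operation of right maps. -/
def ofRightMap (j : A ⥤ Arrow E) : NatLift j (RightMap.forget j) where
  fill {a f} sq := f.fill a sq
  hom_fill {a f} sq := f.hom_fill a sq
  fill_hom {a f} sq := f.fill_hom a sq
  natural_left {_ _ f} φ sq := f.fill_natural φ sq
  natural_right {a _ _} ψ sq := (ψ.fill_comp a sq).symm

/-- A natural lifting operation of `U` against `V` exhibits the arrows `V.obj b` as right maps. -/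
def toRightMap (l : NatLift U V) : B ⥤ RightMap U where
  obj b :=
    { arrow := V.obj b
      fill := fun _ sq => l.fill sq
      hom_fill := fun _ sq => l.hom_fill sq
      fill_hom := fun _ sq => l.fill_hom sq
      fill_natural := fun σ sq => l.natural_left σ sq }
  map ψ := ⟨V.map ψ, fun _ sq => (l.natural_right ψ sq).symm⟩
  map_id b := RightMap.Hom.ext (V.map_id b)
  map_comp ψ ψ' := RightMap.Hom.ext (V.map_comp ψ ψ')

end NatLift

/-! ### Lifting coalgebras against algebras in a functorial factorization -/

namespace FunctorialFactorization

variable {E : Type u} [Category.{v} E] {T : FunctorialFactorization E}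

/-- The section of the right factor underlying a coalgebra. -/
def coalgebraSection (a : CopointedCoalgebra T.copoint) : a.obj.right ⟶ T.mid.obj a.obj :=
  a.str.right

/-- The retraction of the left factor underlying an algebra. -/
def algebraRetraction (b : PointedAlgebra T.point) : T.mid.obj b.obj ⟶ b.obj.left :=
  b.str.left

/-- The copointing is an identity on domains, so the counit law fixes this component. All the data
of a coalgebra is thus a section of the right factor that extends the left factor; dually, an
algebra is a retraction of the left factor. -/
lemma coalgebra_str_left (a : CopointedCoalgebra T.copoint) : a.str.left = 𝟙 a.obj.left :=
  (Category.comp_id _).symm.trans (congrArg CommaMorphism.left a.counit)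

lemma hom_coalgebraSection (a : CopointedCoalgebra T.copoint) :
    a.obj.hom ≫ coalgebraSection a = T.left a.obj :=
  (Arrow.w a.str).symm.trans
    ((congrArg (· ≫ T.left a.obj) (coalgebra_str_left a)).trans (Category.id_comp _))

lemma coalgebraSection_right (a : CopointedCoalgebra T.copoint) :
    coalgebraSection a ≫ T.right a.obj = 𝟙 a.obj.right :=
  congrArg CommaMorphism.right a.counit

lemma coalgebraSection_natural {a a' : CopointedCoalgebra T.copoint} (φ : a ⟶ a') :
    coalgebraSection a ≫ T.mid.map φ.hom = φ.hom.right ≫ coalgebraSection a' :=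
  congrArg CommaMorphism.right φ.w

lemma algebra_str_right (b : PointedAlgebra T.point) : b.str.right = 𝟙 b.obj.right :=
  (Category.id_comp _).symm.trans (congrArg CommaMorphism.right b.unit)

lemma algebraRetraction_hom (b : PointedAlgebra T.point) :
    algebraRetraction b ≫ b.obj.hom = T.right b.obj :=
  (Arrow.w b.str).trans
    ((congrArg (T.right b.obj ≫ ·) (algebra_str_right b)).trans (Category.comp_id _))

lemma left_algebraRetraction (b : PointedAlgebra T.point) :
    T.left b.obj ≫ algebraRetraction b = 𝟙 b.obj.left :=
  congrArg CommaMorphism.left b.unit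

lemma algebraRetraction_natural {b b' : PointedAlgebra T.point} (ψ : b ⟶ b') :
    T.mid.map ψ.hom ≫ algebraRetraction b' = algebraRetraction b ≫ ψ.hom.left :=
  congrArg CommaMorphism.left ψ.w

/-- The filler of a square from a coalgebra to an algebra. -/
def filler (a : CopointedCoalgebra T.copoint) (b : PointedAlgebra T.point) (sq : a.obj ⟶ b.obj) :
    a.obj.right ⟶ b.obj.left :=
  coalgebraSection a ≫ T.mid.map sq ≫ algebraRetraction b

lemma hom_filler (a : CopointedCoalgebra T.copoint) (b : PointedAlgebra T.point)
    (sq : a.obj ⟶ b.obj) : a.obj.hom ≫ filler a b sq = sq.left := by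
  rw [filler, ← Category.assoc, hom_coalgebraSection, ← Category.assoc, ← T.left_naturality,
    Category.assoc, left_algebraRetraction, Category.comp_id]

lemma filler_hom (a : CopointedCoalgebra T.copoint) (b : PointedAlgebra T.point)
    (sq : a.obj ⟶ b.obj) : filler a b sq ≫ b.obj.hom = sq.right := by
  rw [filler, Category.assoc, Category.assoc, algebraRetraction_hom, T.right_naturality,
    ← Category.assoc, coalgebraSection_right, Category.id_comp]

lemma filler_natural_left {a a' : CopointedCoalgebra T.copoint} (b : PointedAlgebra T.point)
    (φ : a ⟶ a') (sq : a'.obj ⟶ b.obj) :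
    filler a b (φ.hom ≫ sq) = φ.hom.right ≫ filler a' b sq := by
  rw [filler, filler, T.mid.map_comp, Category.assoc, ← Category.assoc,
    coalgebraSection_natural, Category.assoc]

lemma filler_natural_right (a : CopointedCoalgebra T.copoint) {b b' : PointedAlgebra T.point}
    (ψ : b ⟶ b') (sq : a.obj ⟶ b.obj) :
    filler a b' (sq ≫ ψ.hom) = filler a b sq ≫ ψ.hom.left := by
  rw [filler, filler, T.mid.map_comp, Category.assoc, algebraRetraction_natural,
    Category.assoc, Category.assoc]

/-- The lifting operation of coalgebras against algebras in a functorial factorization. -/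
def natLift (T : FunctorialFactorization E) :
    NatLift (CopointedCoalgebra.forget T.copoint) (PointedAlgebra.forget T.point) where
  fill {a b} sq := filler a b sq
  hom_fill {a b} sq := hom_filler a b sq
  fill_hom {a b} sq := filler_hom a b sq
  natural_left {_ _ b} φ sq := filler_natural_left b φ sq
  natural_right {a _ _} ψ sq := filler_natural_right a ψ sq

end FunctorialFactorization

/-! ### Coalgebra structures as natural lifting operations against algebras -/

namespace AWFS

variable {E : Type u} [Category.{v} E] (S : AWFS E) {A : Type u₁} [Category.{v₁} A]
  {U : A ⥤ Arrow E}

/-- Monad algebras are in particular algebras for the pointed endofunctor. -/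
def algebraToRAlg : S.monad.Algebra ⥤ S.RAlg where
  obj b := ⟨b.A, b.a, b.unit⟩
  map ψ := ⟨ψ.f, ψ.h⟩

variable {S}

/-- The filler, against the free algebra on an arrow, exhibiting it as a coalgebra. -/
def coalgStr (l : NatLift U S.monad.forget) (a : A) :
    (U.obj a).right ⟶ S.mid.obj (U.obj a) :=
  l.fill (b := S.monad.free.obj (U.obj a)) (S.point.app (U.obj a))

lemma hom_coalgStr (l : NatLift U S.monad.forget) (a : A) :
    (U.obj a).hom ≫ coalgStr l a = S.left (U.obj a) :=
  l.hom_fill (b := S.monad.free.obj (U.obj a)) (S.point.app (U.obj a))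

lemma coalgStr_right (l : NatLift U S.monad.forget) (a : A) :
    coalgStr l a ≫ S.right (U.obj a) = 𝟙 _ :=
  l.fill_hom (b := S.monad.free.obj (U.obj a)) (S.point.app (U.obj a))

/-- Both sides fill one and the same square, from `U.obj a` to the free algebra on `U.obj a'`: the
left side by naturality along the map of free algebras, the right side by naturality along `φ`.
Naturality of the unit identifies the squares. -/
lemma coalgStr_natural (l : NatLift U S.monad.forget) {a a' : A} (φ : a ⟶ a') :
    coalgStr l a ≫ S.mid.map (U.map φ) = (U.map φ).right ≫ coalgStr l a' :=
  ((l.natural_right (S.monad.free.map (U.map φ)) (S.point.app (U.obj a))).symm.trans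
    (congrArg (fun t => l.fill (b := S.monad.free.obj (U.obj a')) t)
      (S.point.naturality (U.map φ)).symm)).trans
    (l.natural_left (b := S.monad.free.obj (U.obj a')) φ (S.point.app (U.obj a')))

/-- Arrows lifting naturally against the monad algebras are coalgebras. -/
def toLCoalg (l : NatLift U S.monad.forget) : A ⥤ S.LCoalg where
  obj a :=
    { obj := U.obj a
      str := Arrow.homMk' (𝟙 _) (coalgStr l a)
        ((Category.id_comp _).trans (hom_coalgStr l a).symm)
      counit := Arrow.hom_ext _ _ (Category.id_comp _) (coalgStr_right l a) }
  map φ := ⟨U.map φ, Arrow.hom_ext _ _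
    ((Category.id_comp _).trans (Category.comp_id _).symm) (coalgStr_natural l φ)⟩
  map_id a := CopointedCoalgebra.Hom.ext (U.map_id a)
  map_comp φ φ' := CopointedCoalgebra.Hom.ext (U.map_comp φ φ')

variable (S) in
/-- The lifting operation of coalgebras against algebras. -/
def natLift : NatLift (LCoalg.forget S) (RAlg.forget S) :=
  S.toFunctorialFactorization.natLift

variable (S) in
/-- The lifting operation of coalgebras against monad algebras. -/
def natLiftMonad : NatLift (LCoalg.forget S) S.monad.forget :=
  S.natLift.compRight S.algebraToRAlg

section Generated

variable {J : Type u₂} [Category.{v₂} J] {j : J ⥤ Arrow E}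

/-- Arrows lifting naturally against the right maps for generators lift naturally against the
monad algebras. -/
lemma nonempty_natLift_monad (h : S.IsAlgebraicallyFree j)
    (l : NatLift U (RightMap.forget j)) : Nonempty (NatLift U S.monad.forget) := by
  obtain ⟨Φ, Ψ, -, -, h⟩ := h
  rw [← h]
  exact ⟨l.compRight Φ⟩

/-- Coalgebras lift naturally against the right maps for generators. -/
lemma nonempty_natLift_rightMap (h : S.IsAlgebraicallyFree j) :
    Nonempty (NatLift (LCoalg.forget S) (RightMap.forget j)) := by
  obtain ⟨Φ, Ψ, -, h₁, h₂⟩ := h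
  -- `IsoOver` records compatibility with the forgetful functors for `Φ` only; that of the inverse
  -- is deduced.
  have h : Ψ ⋙ S.monad.forget = RightMap.forget j := by
    rw [← h₂, ← Functor.assoc, h₁, Functor.id_comp]
  rw [← h]
  exact ⟨S.natLiftMonad.compRight Ψ⟩

/-- A lift of a functor to coalgebras gives a natural lifting operation. -/
lemma nonempty_natLift_of_hasLift {D : Type u₃} [Category.{v₃} D] {W : A ⥤ D} {F : D ⥤ Arrow E}
    (h : HasLift W (LCoalg.forget S) F) : Nonempty (NatLift (W ⋙ F) S.monad.forget) := by
  obtain ⟨F', h⟩ := h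
  rw [← h]
  exact ⟨S.natLiftMonad.compLeft F'⟩

/-- A natural lifting operation against right maps for generators lifts a functor to
coalgebras. -/
lemma hasLift_of_natLift {D : Type u₃} [Category.{v₃} D] {W : A ⥤ D} {F : D ⥤ Arrow E}
    (h : S.IsAlgebraicallyFree j) (l : NatLift (W ⋙ F) (RightMap.forget j)) :
    HasLift W (LCoalg.forget S) F :=
  let ⟨l'⟩ := nonempty_natLift_monad h l
  -- Strict commutativity is definitional, because `toLCoalg` leaves the underlying arrows
  -- untouched.
  ⟨toLCoalg l', rfl⟩

end Generated

end AWFS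

/-! ### The right adjoint of the Leibniz product -/

namespace FunctorialCylinder

section Leibniz

variable {E : Type u} [Category.{v} E] (c : FunctorialCylinder E) [HasPushouts E]

lemma inl_leibnizObj (k : Fin 2) (i : Arrow E) :
    pushout.inl (c.δ k i.left) i.hom ≫ c.leibnizObj k i = c.cyl.map i.hom :=
  pushout.inl_desc _ _ _

lemma inr_leibnizObj (k : Fin 2) (i : Arrow E) :
    pushout.inr (c.δ k i.left) i.hom ≫ c.leibnizObj k i = c.δ k i.right :=
  pushout.inr_desc _ _ _

lemma inl_leibnizLeft (k : Fin 2) {i j : Arrow E} (α : i ⟶ j) :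
    pushout.inl (c.δ k i.left) i.hom ≫ c.leibnizLeft k α =
      c.cyl.map α.left ≫ pushout.inl (c.δ k j.left) j.hom :=
  pushout.inl_desc _ _ _

lemma inr_leibnizLeft (k : Fin 2) {i j : Arrow E} (α : i ⟶ j) :
    pushout.inr (c.δ k i.left) i.hom ≫ c.leibnizLeft k α =
      α.right ≫ pushout.inr (c.δ k j.left) j.hom :=
  pushout.inr_desc _ _ _

end Leibniz

section Exponential

variable {E : Type u} [Category.{v} E] (c : FunctorialCylinder E) {G : E ⥤ E} (adj : c.cyl ⊣ G)

/-- Evaluation of paths at an endpoint. -/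
def evalEndpoint (k : Fin 2) (X : E) : G.obj X ⟶ X :=
  c.δ k (G.obj X) ≫ adj.counit.app X

lemma evalEndpoint_naturality (k : Fin 2) {X Y : E} (f : X ⟶ Y) :
    G.map f ≫ c.evalEndpoint adj k Y = c.evalEndpoint adj k X ≫ f := by
  have h := adj.counit.naturality f
  dsimp at h
  rw [evalEndpoint, evalEndpoint, ← Category.assoc, ← c.δ_naturality, Category.assoc, h,
    Category.assoc]

/-- This identity exchanges restriction to an endpoint of the cylinder with evaluation at an
endpoint of a path. It turns the pushout condition for Leibniz products into the pullback condition
for exponentials, and back. -/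
lemma homEquiv_evalEndpoint (k : Fin 2) {B X : E} (t : c.cyl.obj B ⟶ X) :
    adj.homEquiv B X t ≫ c.evalEndpoint adj k X = c.δ k B ≫ t := by
  rw [evalEndpoint, ← Category.assoc, ← c.δ_naturality, Category.assoc,
    ← adj.homEquiv_counit, Equiv.symm_apply_apply]

lemma evalEndpoint_homEquiv_symm (k : Fin 2) {B X : E} (t : B ⟶ G.obj X) :
    c.δ k B ≫ (adj.homEquiv B X).symm t = t ≫ c.evalEndpoint adj k X := by
  rw [← c.homEquiv_evalEndpoint adj, Equiv.apply_symm_apply]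

/-- The transpose of the domain component of a square from a Leibniz product. -/
noncomputable def transposeLeft [HasPushouts E] (k : Fin 2) {i f : Arrow E}
    (a : pushout (c.δ k i.left) i.hom ⟶ f.left) :
    i.left ⟶ G.obj f.left :=
  adj.homEquiv i.left f.left (pushout.inl (c.δ k i.left) i.hom ≫ a)

lemma transposeLeft_comp [HasPushouts E] (k : Fin 2) {i f g : Arrow E}
    (a : pushout (c.δ k i.left) i.hom ⟶ f.left) (β : f ⟶ g) :
    c.transposeLeft adj k (a ≫ β.left) = c.transposeLeft adj k a ≫ G.map β.left := by
  rw [transposeLeft, transposeLeft, ← adj.homEquiv_naturality_right, Category.assoc]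

lemma map_comp_transposeLeft [HasPushouts E] (k : Fin 2) {i i' f : Arrow E} (α : i ⟶ i')
    (a : pushout (c.δ k i'.left) i'.hom ⟶ f.left) :
    c.transposeLeft adj k (c.leibnizLeft k α ≫ a) = α.left ≫ c.transposeLeft adj k a := by
  rw [transposeLeft, transposeLeft, ← adj.homEquiv_naturality_left, reassoc_of% c.inl_leibnizLeft]

variable [HasPullbacks E]

/-- The pullback exponential of an arrow by an endpoint inclusion. -/
noncomputable def expObj (k : Fin 2) (f : Arrow E) :
    G.obj f.left ⟶ pullback (c.evalEndpoint adj k f.right) f.hom :=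
  pullback.lift (G.map f.hom) (c.evalEndpoint adj k f.left) (c.evalEndpoint_naturality adj k f.hom)

/-- The functoriality of the codomain of the pullback exponential. -/
noncomputable def expRight (k : Fin 2) {f g : Arrow E} (α : f ⟶ g) :
    pullback (c.evalEndpoint adj k f.right) f.hom ⟶
      pullback (c.evalEndpoint adj k g.right) g.hom :=
  pullback.lift (pullback.fst _ _ ≫ G.map α.right) (pullback.snd _ _ ≫ α.left) (by
    rw [Category.assoc, c.evalEndpoint_naturality, pullback.condition_assoc, Category.assoc,
      Arrow.w])

/-- The pullback exponential by an endpoint inclusion. -/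
noncomputable def exponential (k : Fin 2) : Arrow E ⥤ Arrow E where
  obj f := Arrow.mk (c.expObj adj k f)
  map α := Arrow.homMk' (G.map α.left) (c.expRight adj k α) (by
    unfold expObj expRight
    apply pullback.hom_ext
    · simp only [Category.assoc, pullback.lift_fst, pullback.lift_fst_assoc, ← G.map_comp, Arrow.w]
    · simp only [Category.assoc, pullback.lift_snd, pullback.lift_snd_assoc,
        c.evalEndpoint_naturality])
  map_id f := Arrow.hom_ext _ _ (G.map_id _) (by
    change c.expRight adj k (𝟙 f) = 𝟙 _
    unfold expRight
    apply pullback.hom_ext <;> simp)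
  map_comp α β := Arrow.hom_ext _ _ (G.map_comp _ _) (by
    change c.expRight adj k (α ≫ β) = c.expRight adj k α ≫ c.expRight adj k β
    unfold expRight
    apply pullback.hom_ext
    · rw [pullback.lift_fst, Category.assoc, pullback.lift_fst, pullback.lift_fst_assoc]; simp
    · rw [pullback.lift_snd, Category.assoc, pullback.lift_snd, pullback.lift_snd_assoc]; simp)

lemma expObj_fst (k : Fin 2) (f : Arrow E) :
    c.expObj adj k f ≫ pullback.fst (c.evalEndpoint adj k f.right) f.hom = G.map f.hom :=
  pullback.lift_fst _ _ _

lemma expObj_snd (k : Fin 2) (f : Arrow E) :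
    c.expObj adj k f ≫ pullback.snd (c.evalEndpoint adj k f.right) f.hom =
      c.evalEndpoint adj k f.left :=
  pullback.lift_snd _ _ _

lemma expRight_fst (k : Fin 2) {f g : Arrow E} (α : f ⟶ g) :
    c.expRight adj k α ≫ pullback.fst (c.evalEndpoint adj k g.right) g.hom =
      pullback.fst (c.evalEndpoint adj k f.right) f.hom ≫ G.map α.right :=
  pullback.lift_fst _ _ _

lemma expRight_snd (k : Fin 2) {f g : Arrow E} (α : f ⟶ g) :
    c.expRight adj k α ≫ pullback.snd (c.evalEndpoint adj k g.right) g.hom =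
      pullback.snd (c.evalEndpoint adj k f.right) f.hom ≫ α.left :=
  pullback.lift_snd _ _ _

/-- The transpose of the codomain component of a square to a pullback exponential. -/
noncomputable def untransposeRight (k : Fin 2) {i f : Arrow E}
    (b : i.right ⟶ pullback (c.evalEndpoint adj k f.right) f.hom) :
    c.cyl.obj i.right ⟶ f.right :=
  (adj.homEquiv i.right f.right).symm (b ≫ pullback.fst (c.evalEndpoint adj k f.right) f.hom)

lemma untransposeRight_comp (k : Fin 2) {i f g : Arrow E}
    (b : i.right ⟶ pullback (c.evalEndpoint adj k f.right) f.hom) (β : f ⟶ g) :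
    c.untransposeRight adj k (b ≫ c.expRight adj k β) =
      c.untransposeRight adj k b ≫ β.right := by
  rw [untransposeRight, untransposeRight, ← adj.homEquiv_naturality_right_symm, Category.assoc,
    Category.assoc, expRight_fst]

lemma map_comp_untransposeRight (k : Fin 2) {i i' f : Arrow E} (α : i ⟶ i')
    (b : i'.right ⟶ pullback (c.evalEndpoint adj k f.right) f.hom) :
    c.untransposeRight adj k (α.right ≫ b) =
      c.cyl.map α.right ≫ c.untransposeRight adj k b := by
  rw [untransposeRight, untransposeRight, ← adj.homEquiv_naturality_left_symm, Category.assoc]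

variable [HasPushouts E] (k : Fin 2) {i f : Arrow E}

/-- The transpose of the codomain component of a square from a Leibniz product. -/
noncomputable def transposeRight (a : pushout (c.δ k i.left) i.hom ⟶ f.left)
    (b : c.cyl.obj i.right ⟶ f.right) (h : a ≫ f.hom = c.leibnizObj k i ≫ b) :
    i.right ⟶ pullback (c.evalEndpoint adj k f.right) f.hom :=
  pullback.lift (adj.homEquiv i.right f.right b) (pushout.inr (c.δ k i.left) i.hom ≫ a) (by
    rw [c.homEquiv_evalEndpoint, Category.assoc, h, reassoc_of% c.inr_leibnizObj])

lemma transposeRight_fst (a : pushout (c.δ k i.left) i.hom ⟶ f.left)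
    (b : c.cyl.obj i.right ⟶ f.right) (h : a ≫ f.hom = c.leibnizObj k i ≫ b) :
    c.transposeRight adj k a b h ≫ pullback.fst (c.evalEndpoint adj k f.right) f.hom =
      adj.homEquiv i.right f.right b :=
  pullback.lift_fst _ _ _

lemma transposeRight_snd (a : pushout (c.δ k i.left) i.hom ⟶ f.left)
    (b : c.cyl.obj i.right ⟶ f.right) (h : a ≫ f.hom = c.leibnizObj k i ≫ b) :
    c.transposeRight adj k a b h ≫ pullback.snd (c.evalEndpoint adj k f.right) f.hom =
      pushout.inr (c.δ k i.left) i.hom ≫ a :=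
  pullback.lift_snd _ _ _

/-- The first projection is the transpose of the given square restricted to `I ⊗ A`; the second
expresses that the two parts of `a` agree on `A`, which is the gluing condition of the pushout. -/
lemma transpose_w (a : pushout (c.δ k i.left) i.hom ⟶ f.left)
    (b : c.cyl.obj i.right ⟶ f.right) (h : a ≫ f.hom = c.leibnizObj k i ≫ b) :
    c.transposeLeft adj k a ≫ c.expObj adj k f = i.hom ≫ c.transposeRight adj k a b h := by
  unfold transposeLeft
  apply pullback.hom_ext
  · rw [Category.assoc, Category.assoc, expObj_fst, transposeRight_fst,
      ← adj.homEquiv_naturality_right, ← adj.homEquiv_naturality_left, Category.assoc, h,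
      reassoc_of% c.inl_leibnizObj]
  · rw [Category.assoc, Category.assoc, expObj_snd, transposeRight_snd, c.homEquiv_evalEndpoint,
      pushout.condition_assoc]

/-- The transpose of the domain component of a square to a pullback exponential. -/
noncomputable def untransposeLeft (a : i.left ⟶ G.obj f.left)
    (b : i.right ⟶ pullback (c.evalEndpoint adj k f.right) f.hom)
    (h : a ≫ c.expObj adj k f = i.hom ≫ b) : pushout (c.δ k i.left) i.hom ⟶ f.left :=
  pushout.desc ((adj.homEquiv i.left f.left).symm a)
    (b ≫ pullback.snd (c.evalEndpoint adj k f.right) f.hom) (by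
      rw [c.evalEndpoint_homEquiv_symm, ← Category.assoc, ← h, Category.assoc, expObj_snd])

lemma inl_untransposeLeft (a : i.left ⟶ G.obj f.left)
    (b : i.right ⟶ pullback (c.evalEndpoint adj k f.right) f.hom)
    (h : a ≫ c.expObj adj k f = i.hom ≫ b) :
    pushout.inl (c.δ k i.left) i.hom ≫ c.untransposeLeft adj k a b h =
      (adj.homEquiv i.left f.left).symm a :=
  pushout.inl_desc _ _ _

lemma inr_untransposeLeft (a : i.left ⟶ G.obj f.left)
    (b : i.right ⟶ pullback (c.evalEndpoint adj k f.right) f.hom)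
    (h : a ≫ c.expObj adj k f = i.hom ≫ b) :
    pushout.inr (c.δ k i.left) i.hom ≫ c.untransposeLeft adj k a b h =
      b ≫ pullback.snd (c.evalEndpoint adj k f.right) f.hom :=
  pushout.inr_desc _ _ _

lemma untranspose_w (a : i.left ⟶ G.obj f.left)
    (b : i.right ⟶ pullback (c.evalEndpoint adj k f.right) f.hom)
    (h : a ≫ c.expObj adj k f = i.hom ≫ b) :
    c.untransposeLeft adj k a b h ≫ f.hom = c.leibnizObj k i ≫ c.untransposeRight adj k b := by
  unfold untransposeRight
  apply pushout.hom_ext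
  · rw [reassoc_of% c.inl_untransposeLeft, reassoc_of% c.inl_leibnizObj,
      ← adj.homEquiv_naturality_left_symm, ← adj.homEquiv_naturality_right_symm,
      ← Category.assoc, ← h, Category.assoc, expObj_fst]
  · rw [reassoc_of% c.inr_untransposeLeft, reassoc_of% c.inr_leibnizObj,
      c.evalEndpoint_homEquiv_symm, Category.assoc, pullback.condition]

/-- Transposition of squares from a Leibniz product. -/
noncomputable def transpose (sq : (c.leibniz k).obj i ⟶ f) : i ⟶ (c.exponential adj k).obj f :=
  Arrow.homMk (g := Arrow.mk (c.expObj adj k f)) (c.transposeLeft adj k sq.left)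
    (c.transposeRight adj k sq.left sq.right (Arrow.w sq)) (c.transpose_w adj k _ _ _)

/-- Transposition of squares to a pullback exponential. -/
noncomputable def untranspose (sq : i ⟶ (c.exponential adj k).obj f) : (c.leibniz k).obj i ⟶ f :=
  Arrow.homMk (f := Arrow.mk (c.leibnizObj k i))
    (c.untransposeLeft adj k sq.left sq.right (Arrow.w sq))
    (c.untransposeRight adj k sq.right) (c.untranspose_w adj k _ _ _)

lemma transposeRight_comp {g : Arrow E} (a : pushout (c.δ k i.left) i.hom ⟶ f.left)
    (b : c.cyl.obj i.right ⟶ f.right) (h : a ≫ f.hom = c.leibnizObj k i ≫ b) (β : f ⟶ g)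
    (h' : (a ≫ β.left) ≫ g.hom = c.leibnizObj k i ≫ b ≫ β.right) :
    c.transposeRight adj k (a ≫ β.left) (b ≫ β.right) h' =
      c.transposeRight adj k a b h ≫ c.expRight adj k β := by
  apply pullback.hom_ext
  · rw [transposeRight_fst, Category.assoc, expRight_fst, reassoc_of% c.transposeRight_fst,
      adj.homEquiv_naturality_right]
  · rw [transposeRight_snd, Category.assoc, expRight_snd, reassoc_of% c.transposeRight_snd]

lemma transpose_comp {g : Arrow E} (sq : (c.leibniz k).obj i ⟶ f) (β : f ⟶ g) :
    c.transpose adj k (sq ≫ β) = c.transpose adj k sq ≫ (c.exponential adj k).map β :=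
  Arrow.hom_ext _ _ (c.transposeLeft_comp adj k sq.left β)
    (c.transposeRight_comp adj k sq.left sq.right (Arrow.w sq) β (Arrow.w (sq ≫ β)))

lemma map_comp_transposeRight {i' : Arrow E} (α : i ⟶ i')
    (a : pushout (c.δ k i'.left) i'.hom ⟶ f.left) (b : c.cyl.obj i'.right ⟶ f.right)
    (h : a ≫ f.hom = c.leibnizObj k i' ≫ b)
    (h' : (c.leibnizLeft k α ≫ a) ≫ f.hom = c.leibnizObj k i ≫ c.cyl.map α.right ≫ b) :
    c.transposeRight adj k (c.leibnizLeft k α ≫ a) (c.cyl.map α.right ≫ b) h' =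
      α.right ≫ c.transposeRight adj k a b h := by
  apply pullback.hom_ext
  · rw [transposeRight_fst, Category.assoc, transposeRight_fst, adj.homEquiv_naturality_left]
  · rw [transposeRight_snd, Category.assoc, transposeRight_snd, reassoc_of% c.inr_leibnizLeft]

lemma map_comp_transpose {i' : Arrow E} (α : i ⟶ i') (sq : (c.leibniz k).obj i' ⟶ f) :
    c.transpose adj k ((c.leibniz k).map α ≫ sq) = α ≫ c.transpose adj k sq :=
  Arrow.hom_ext _ _ (c.map_comp_transposeLeft adj k α sq.left)
    (c.map_comp_transposeRight adj k α sq.left sq.right (Arrow.w sq)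
      (Arrow.w ((c.leibniz k).map α ≫ sq)))

lemma untransposeLeft_comp {g : Arrow E} (a : i.left ⟶ G.obj f.left)
    (b : i.right ⟶ pullback (c.evalEndpoint adj k f.right) f.hom)
    (h : a ≫ c.expObj adj k f = i.hom ≫ b) (β : f ⟶ g)
    (h' : (a ≫ G.map β.left) ≫ c.expObj adj k g = i.hom ≫ b ≫ c.expRight adj k β) :
    c.untransposeLeft adj k (a ≫ G.map β.left) (b ≫ c.expRight adj k β) h' =
      c.untransposeLeft adj k a b h ≫ β.left := by
  apply pushout.hom_ext
  · rw [inl_untransposeLeft, reassoc_of% c.inl_untransposeLeft, adj.homEquiv_naturality_right_symm]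
  · rw [inr_untransposeLeft, reassoc_of% c.inr_untransposeLeft, Category.assoc, expRight_snd]

lemma untranspose_comp {g : Arrow E} (sq : i ⟶ (c.exponential adj k).obj f) (β : f ⟶ g) :
    c.untranspose adj k (sq ≫ (c.exponential adj k).map β) = c.untranspose adj k sq ≫ β :=
  Arrow.hom_ext _ _ (c.untransposeLeft_comp adj k sq.left sq.right (Arrow.w sq) β
    (Arrow.w (sq ≫ (c.exponential adj k).map β)))
    (c.untransposeRight_comp adj k sq.right β)

lemma map_comp_untransposeLeft {i' : Arrow E} (α : i ⟶ i') (a : i'.left ⟶ G.obj f.left)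
    (b : i'.right ⟶ pullback (c.evalEndpoint adj k f.right) f.hom)
    (h : a ≫ c.expObj adj k f = i'.hom ≫ b)
    (h' : (α.left ≫ a) ≫ c.expObj adj k f = i.hom ≫ α.right ≫ b) :
    c.untransposeLeft adj k (α.left ≫ a) (α.right ≫ b) h' =
      c.leibnizLeft k α ≫ c.untransposeLeft adj k a b h := by
  apply pushout.hom_ext
  · rw [inl_untransposeLeft, reassoc_of% c.inl_leibnizLeft, inl_untransposeLeft,
      adj.homEquiv_naturality_left_symm]
  · rw [inr_untransposeLeft, reassoc_of% c.inr_leibnizLeft, inr_untransposeLeft, Category.assoc]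

lemma map_comp_untranspose {i' : Arrow E} (α : i ⟶ i') (sq : i' ⟶ (c.exponential adj k).obj f) :
    c.untranspose adj k (α ≫ sq) = (c.leibniz k).map α ≫ c.untranspose adj k sq :=
  Arrow.hom_ext _ _ (c.map_comp_untransposeLeft adj k α sq.left sq.right (Arrow.w sq)
    (Arrow.w (α ≫ sq)))
    (c.map_comp_untransposeRight adj k α sq.right)

/-! Transposition of fillers. -/

lemma hom_homEquiv_filler (a : i.left ⟶ G.obj f.left)
    (b : i.right ⟶ pullback (c.evalEndpoint adj k f.right) f.hom)
    (h : a ≫ c.expObj adj k f = i.hom ≫ b) (t : c.cyl.obj i.right ⟶ f.left)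
    (ht : c.leibnizObj k i ≫ t = c.untransposeLeft adj k a b h) :
    i.hom ≫ adj.homEquiv i.right f.left t = a := by
  rw [← adj.homEquiv_naturality_left, ← reassoc_of% c.inl_leibnizObj, ht, inl_untransposeLeft,
    Equiv.apply_symm_apply]

/-- Transposition redistributes the two triangles of a filler. The lower triangle gives the first
projection here. The upper triangle splits in two: its restriction to `B` gives the second
projection, and its restriction to `I ⊗ A` is the transposed upper triangle of
`hom_homEquiv_filler`. The next two lemmas reverse this. -/
lemma homEquiv_filler_expObj (a : i.left ⟶ G.obj f.left)
    (b : i.right ⟶ pullback (c.evalEndpoint adj k f.right) f.hom)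
    (h : a ≫ c.expObj adj k f = i.hom ≫ b) (t : c.cyl.obj i.right ⟶ f.left)
    (ht : c.leibnizObj k i ≫ t = c.untransposeLeft adj k a b h)
    (ht' : t ≫ f.hom = c.untransposeRight adj k b) :
    adj.homEquiv i.right f.left t ≫ c.expObj adj k f = b := by
  apply pullback.hom_ext
  · rw [Category.assoc, expObj_fst, ← adj.homEquiv_naturality_right, ht', untransposeRight,
      Equiv.apply_symm_apply]
  · rw [Category.assoc, expObj_snd, c.homEquiv_evalEndpoint, ← reassoc_of% c.inr_leibnizObj, ht,
      inr_untransposeLeft]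

lemma leibnizObj_homEquiv_symm_filler (a : pushout (c.δ k i.left) i.hom ⟶ f.left)
    (b : c.cyl.obj i.right ⟶ f.right) (h : a ≫ f.hom = c.leibnizObj k i ≫ b)
    (t : i.right ⟶ G.obj f.left) (ht : i.hom ≫ t = c.transposeLeft adj k a)
    (ht' : t ≫ c.expObj adj k f = c.transposeRight adj k a b h) :
    c.leibnizObj k i ≫ (adj.homEquiv i.right f.left).symm t = a := by
  apply pushout.hom_ext
  · rw [reassoc_of% c.inl_leibnizObj, ← adj.homEquiv_naturality_left_symm, ht, transposeLeft,
      Equiv.symm_apply_apply]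
  · rw [reassoc_of% c.inr_leibnizObj, evalEndpoint_homEquiv_symm, ← c.expObj_snd, ← Category.assoc,
      ht', transposeRight_snd]

lemma homEquiv_symm_filler_hom (a : pushout (c.δ k i.left) i.hom ⟶ f.left)
    (b : c.cyl.obj i.right ⟶ f.right) (h : a ≫ f.hom = c.leibnizObj k i ≫ b)
    (t : i.right ⟶ G.obj f.left) (ht' : t ≫ c.expObj adj k f = c.transposeRight adj k a b h) :
    (adj.homEquiv i.right f.left).symm t ≫ f.hom = b := by
  rw [← adj.homEquiv_naturality_right_symm, ← c.expObj_fst adj k, ← Category.assoc, ht',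
    transposeRight_fst, Equiv.symm_apply_apply]

end Exponential

end FunctorialCylinder

/-! ### Lifting operations under the adjunction of Leibniz product and pullback exponential -/

namespace NatLift

variable {E : Type u} [Category.{v} E] [HasPullbacks E] [HasPushouts E]
  {c : FunctorialCylinder E} {G : E ⥤ E} (adj : c.cyl ⊣ G)
  {A : Type u₁} [Category.{v₁} A] {B : Type u₂} [Category.{v₂} B]
  {U : A ⥤ Arrow E} {V : B ⥤ Arrow E} (k : Fin 2)

/-- Transposition of lifting operations from Leibniz products to pullback exponentials. -/
noncomputable def toExponential (l : NatLift (U ⋙ c.leibniz k) V) :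
    NatLift U (V ⋙ c.exponential adj k) where
  fill {a b} sq := adj.homEquiv (U.obj a).right (V.obj b).left
    (l.fill (a := a) (b := b) (c.untranspose adj k sq))
  hom_fill {a b} sq := c.hom_homEquiv_filler adj k sq.left sq.right (Arrow.w sq) _
    (l.hom_fill (a := a) (b := b) (c.untranspose adj k sq))
  fill_hom {a b} sq := c.homEquiv_filler_expObj adj k sq.left sq.right (Arrow.w sq) _
    (l.hom_fill (a := a) (b := b) (c.untranspose adj k sq))
    (l.fill_hom (a := a) (b := b) (c.untranspose adj k sq))
  natural_left {a a' b} φ sq := by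
    refine Eq.trans ?_ (adj.homEquiv_naturality_left (U.map φ).right
      (l.fill (a := a') (b := b) (c.untranspose adj k sq)))
    refine congrArg _ (Eq.trans ?_ (l.natural_left φ (c.untranspose adj k sq)))
    exact congrArg (fun t => l.fill (a := a) (b := b) t)
      (c.map_comp_untranspose adj k (U.map φ) sq)
  natural_right {a b b'} ψ sq := by
    refine Eq.trans ?_ (adj.homEquiv_naturality_right
      (l.fill (a := a) (b := b) (c.untranspose adj k sq)) (V.map ψ).left)
    refine congrArg _ (Eq.trans ?_ (l.natural_right ψ (c.untranspose adj k sq)))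
    exact congrArg (fun t => l.fill (a := a) (b := b') t)
      (c.untranspose_comp adj k sq (V.map ψ))

/-- Transposition of lifting operations from pullback exponentials to Leibniz products. -/
noncomputable def ofExponential (l : NatLift U (V ⋙ c.exponential adj k)) :
    NatLift (U ⋙ c.leibniz k) V where
  fill {a b} sq := (adj.homEquiv (U.obj a).right (V.obj b).left).symm
    (l.fill (a := a) (b := b) (c.transpose adj k sq))
  hom_fill {a b} sq := c.leibnizObj_homEquiv_symm_filler adj k sq.left sq.right (Arrow.w sq) _
    (l.hom_fill (a := a) (b := b) (c.transpose adj k sq))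
    (l.fill_hom (a := a) (b := b) (c.transpose adj k sq))
  fill_hom {a b} sq := c.homEquiv_symm_filler_hom adj k sq.left sq.right (Arrow.w sq) _
    (l.fill_hom (a := a) (b := b) (c.transpose adj k sq))
  natural_left {a a' b} φ sq := by
    refine Eq.trans ?_ (adj.homEquiv_naturality_left_symm (U.map φ).right
      (l.fill (a := a') (b := b) (c.transpose adj k sq)))
    refine congrArg _ (Eq.trans ?_ (l.natural_left φ (c.transpose adj k sq)))
    exact congrArg (fun t => l.fill (a := a) (b := b) t)
      (c.map_comp_transpose adj k (U.map φ) sq)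
  natural_right {a b b'} ψ sq := by
    refine Eq.trans ?_ (adj.homEquiv_naturality_right_symm
      (l.fill (a := a) (b := b) (c.transpose adj k sq)) (V.map ψ).left)
    refine congrArg _ (Eq.trans ?_ (l.natural_right ψ (c.transpose adj k sq)))
    exact congrArg (fun t => l.fill (a := a) (b := b') t)
      (c.transpose_comp adj k sq (V.map ψ))

end NatLift

namespace FunctorialCylinder

variable {E : Type u} [Category.{v} E] (c : FunctorialCylinder E)

/-! ### Endpoint inclusions and connections -/

lemma δ_contr (k : Fin 2) (X : E) : c.δ k X ≫ c.contr.app X = 𝟙 X :=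
  c.endpoint_contr k X

lemma δ_conn (k : Fin 2) (X : E) :
    c.δ k (c.cyl.obj X) ≫ (c.conn k).app X = c.contr.app X ≫ c.δ k X :=
  c.endpoint_conn k X

lemma map_δ_conn (k : Fin 2) (X : E) :
    c.cyl.map (c.δ k X) ≫ (c.conn k).app X = c.contr.app X ≫ c.δ k X :=
  c.map_endpoint_conn k X

lemma other_δ_conn (k : Fin 2) (X : E) :
    c.δ (1 - k) (c.cyl.obj X) ≫ (c.conn k).app X = 𝟙 (c.cyl.obj X) :=
  c.other_endpoint_conn k X

lemma conn_naturality (k : Fin 2) {X Y : E} (f : X ⟶ Y) :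
    c.cyl.map (c.cyl.map f) ≫ (c.conn k).app Y = (c.conn k).app X ≫ c.cyl.map f :=
  (c.conn k).naturality f

lemma contr_naturality_assoc {X Y Z : E} (f : X ⟶ Y) (g : Y ⟶ Z) :
    c.cyl.map f ≫ c.contr.app Y ≫ g = c.contr.app X ≫ f ≫ g :=
  (Category.assoc _ _ _).symm.trans
    ((congrArg (· ≫ g) (c.contr.naturality f)).trans (Category.assoc _ _ _))

/-- The functor sending an object to its endpoint inclusion. -/
def endpointArrow (k : Fin 2) : E ⥤ Arrow E where
  obj X := Arrow.mk (c.δ k X)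
  map f := Arrow.homMk' f (c.cyl.map f) (c.δ_naturality k f).symm
  map_id X := Arrow.hom_ext _ _ rfl (c.cyl.map_id X)
  map_comp f g := Arrow.hom_ext _ _ rfl (c.cyl.map_comp f g)

section Bot

variable [HasPushouts E] [HasInitial E]

/-- The endpoint inclusion of `X` maps to the Leibniz product with `0 ⟶ X`. -/
noncomputable def endpointToLeibniz (k : Fin 2) :
    c.endpointArrow k ⟶ botArrow E ⋙ c.leibniz k where
  app X := Arrow.homMk' (f := c.δ k X) (g := c.leibnizObj k ((botArrow E).obj X))
    (pushout.inr (c.δ k (⊥_ E)) (initial.to X)) (𝟙 (c.cyl.obj X))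
    ((c.inr_leibnizObj k ((botArrow E).obj X)).trans (Category.comp_id _).symm)
  naturality _ _ f := Arrow.hom_ext _ _ (c.inr_leibnizLeft k ((botArrow E).map f)).symm
    ((Category.comp_id (c.cyl.map f)).trans (Category.id_comp (c.cyl.map f)).symm)

variable [c.cyl.IsLeftAdjoint]

/-- The cylinder preserves the initial object. -/
noncomputable def isInitialCyl : IsInitial (c.cyl.obj (⊥_ E)) :=
  haveI := (Adjunction.ofIsLeftAdjoint c.cyl).leftAdjoint_preservesColimits
  IsInitial.isInitialObj c.cyl (⊥_ E) initialIsInitial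

/-- The domain of the Leibniz product of an endpoint inclusion with `0 ⟶ X` maps to `X`. -/
noncomputable def leibnizBotLeft (k : Fin 2) (X : E) :
    pushout (c.δ k (⊥_ E)) (initial.to X) ⟶ X :=
  pushout.desc (c.isInitialCyl.to X) (𝟙 X) (initialIsInitial.hom_ext _ _)

lemma leibnizBotLeft_w (k : Fin 2) (X : E) :
    c.leibnizBotLeft k X ≫ c.δ k X = c.leibnizObj k ((botArrow E).obj X) ≫ 𝟙 (c.cyl.obj X) := by
  apply pushout.hom_ext
  · exact c.isInitialCyl.hom_ext _ _
  · refine (pushout.inr_desc_assoc _ _ _ _).trans ?_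
    refine Eq.trans ?_ (congrArg (_ ≫ ·) (Category.comp_id _).symm)
    exact (Category.id_comp _).trans (c.inr_leibnizObj k ((botArrow E).obj X)).symm

lemma leibnizBotLeft_naturality (k : Fin 2) {X Y : E} (f : X ⟶ Y) :
    c.leibnizLeft k ((botArrow E).map f) ≫ c.leibnizBotLeft k Y = c.leibnizBotLeft k X ≫ f := by
  apply pushout.hom_ext
  · exact c.isInitialCyl.hom_ext _ _
  · refine ((reassoc_of% c.inr_leibnizLeft) k ((botArrow E).map f) _).trans ?_
    refine (congrArg (f ≫ ·) (pushout.inr_desc _ _ _)).trans ?_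
    refine Eq.trans ?_ (pushout.inr_desc_assoc _ _ _ _).symm
    exact (Category.comp_id _).trans (Category.id_comp _).symm

/-- The Leibniz product with `0 ⟶ X` maps to the endpoint inclusion of `X`. -/
noncomputable def leibnizToEndpoint (k : Fin 2) :
    botArrow E ⋙ c.leibniz k ⟶ c.endpointArrow k where
  app X := Arrow.homMk' (f := c.leibnizObj k ((botArrow E).obj X)) (g := c.δ k X)
    (c.leibnizBotLeft k X) (𝟙 (c.cyl.obj X)) (c.leibnizBotLeft_w k X)
  naturality _ _ f := Arrow.hom_ext _ _ (c.leibnizBotLeft_naturality k f)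
    ((Category.comp_id (c.cyl.map f)).trans (Category.id_comp (c.cyl.map f)).symm)

/-- Since `I ⊗ 0` is initial, `(I ⊗ 0) +_0 X` is `X` up to isomorphism. Only one composite is
needed, as lifting operations pass to retracts. -/
lemma endpointToLeibniz_leibnizToEndpoint (k : Fin 2) :
    c.endpointToLeibniz k ≫ c.leibnizToEndpoint k = 𝟙 _ := by
  ext X
  · exact pushout.inr_desc _ _ _
  · exact Category.id_comp _

end Bot

/-! ### Strong homotopy equivalences -/

section HomotopyEquivalence

variable [HasPushouts E]

/-- The square from an arrow to its Leibniz product with an endpoint, given by the opposite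
endpoint. -/
noncomputable def leibnizUnit (k : Fin 2) : 𝟭 (Arrow E) ⟶ c.leibniz k where
  app i := Arrow.homMk (f := i) (g := Arrow.mk (c.leibnizObj k i))
    (c.δ (1 - k) i.left ≫ pushout.inl (c.δ k i.left) i.hom) (c.δ (1 - k) i.right) (by
      refine (Category.assoc _ _ _).trans ?_
      refine (congrArg (_ ≫ ·) (c.inl_leibnizObj k i)).trans ?_
      exact c.δ_naturality _ _)
  naturality i i' α := by
    apply Arrow.hom_ext
    · change α.left ≫ c.δ (1 - k) i'.left ≫ pushout.inl (c.δ k i'.left) i'.hom =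
        (c.δ (1 - k) i.left ≫ pushout.inl (c.δ k i.left) i.hom) ≫ c.leibnizLeft k α
      rw [Category.assoc, inl_leibnizLeft, reassoc_of% c.δ_naturality]
    · exact (c.δ_naturality _ _).symm

variable [c.cyl.IsLeftAdjoint]

lemma isPushout_cyl_leibniz (k : Fin 2) (i : Arrow E) :
    IsPushout (c.cyl.map (c.δ k i.left)) (c.cyl.map i.hom)
      (c.cyl.map (pushout.inl (c.δ k i.left) i.hom))
      (c.cyl.map (pushout.inr (c.δ k i.left) i.hom)) :=
  haveI := (Adjunction.ofIsLeftAdjoint c.cyl).leftAdjoint_preservesColimits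
  (IsPushout.of_hasPushout (c.δ k i.left) i.hom).map c.cyl

/-- The homotopy on the domain of a Leibniz product, given by a connection. -/
noncomputable def connHomotopy (k : Fin 2) (i : Arrow E) :
    c.cyl.obj (pushout (c.δ k i.left) i.hom) ⟶ pushout (c.δ k i.left) i.hom :=
  (c.isPushout_cyl_leibniz k i).desc
    ((c.conn k).app i.left ≫ pushout.inl (c.δ k i.left) i.hom)
    (c.contr.app i.right ≫ pushout.inr (c.δ k i.left) i.hom) (by
      -- On `I ⊗ A` the two parts agree because `cᵏ ∘ (I ⊗ δᵏ) = δᵏ ∘ ε`.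
      rw [reassoc_of% c.map_δ_conn, contr_naturality_assoc, pushout.condition])

lemma map_inl_connHomotopy (k : Fin 2) (i : Arrow E) :
    c.cyl.map (pushout.inl (c.δ k i.left) i.hom) ≫ c.connHomotopy k i =
      (c.conn k).app i.left ≫ pushout.inl (c.δ k i.left) i.hom :=
  (c.isPushout_cyl_leibniz k i).inl_desc _ _ _

lemma map_inr_connHomotopy (k : Fin 2) (i : Arrow E) :
    c.cyl.map (pushout.inr (c.δ k i.left) i.hom) ≫ c.connHomotopy k i =
      c.contr.app i.right ≫ pushout.inr (c.δ k i.left) i.hom :=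
  (c.isPushout_cyl_leibniz k i).inr_desc _ _ _

/-- The domain of the retraction of the iterated Leibniz product. -/
noncomputable def connLeft (k : Fin 2) (i : Arrow E) :
    pushout (c.δ k (pushout (c.δ k i.left) i.hom)) (c.leibnizObj k i) ⟶
      pushout (c.δ k i.left) i.hom :=
  pushout.desc (c.connHomotopy k i) (c.contr.app i.right ≫ pushout.inr (c.δ k i.left) i.hom) (by
    apply pushout.hom_ext
    -- The other connection law, `cᵏ ∘ δᵏ = δᵏ ∘ ε`, says that the homotopy ends, at the endpoint
    -- `k`, in a map factoring through `B`.
    · rw [← reassoc_of% c.δ_naturality, map_inl_connHomotopy, reassoc_of% c.inl_leibnizObj,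
        contr_naturality_assoc, reassoc_of% c.δ_conn, pushout.condition]
    · rw [← reassoc_of% c.δ_naturality, map_inr_connHomotopy, reassoc_of% c.inr_leibnizObj])

lemma connLeft_w (k : Fin 2) (i : Arrow E) :
    c.connLeft k i ≫ c.leibnizObj k i =
      c.leibnizObj k (Arrow.mk (c.leibnizObj k i)) ≫ (c.conn k).app i.right := by
  unfold connLeft
  apply pushout.hom_ext
  · rw [pushout.inl_desc_assoc]
    refine Eq.trans ?_ ((reassoc_of% c.inl_leibnizObj) k (Arrow.mk (c.leibnizObj k i)) _).symm
    change c.connHomotopy k i ≫ c.leibnizObj k i =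
      c.cyl.map (c.leibnizObj k i) ≫ (c.conn k).app i.right
    apply (c.isPushout_cyl_leibniz k i).hom_ext
    · rw [reassoc_of% c.map_inl_connHomotopy, inl_leibnizObj, ← c.cyl.map_comp_assoc,
        inl_leibnizObj, conn_naturality]
    · rw [reassoc_of% c.map_inr_connHomotopy, inr_leibnizObj, ← c.cyl.map_comp_assoc,
        inr_leibnizObj, map_δ_conn]
  · rw [pushout.inr_desc_assoc]
    refine Eq.trans ?_ ((reassoc_of% c.inr_leibnizObj) k (Arrow.mk (c.leibnizObj k i)) _).symm
    change _ = c.δ k (c.cyl.obj i.right) ≫ (c.conn k).app i.right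
    rw [δ_conn, Category.assoc, inr_leibnizObj]

lemma connHomotopy_naturality (k : Fin 2) {i i' : Arrow E} (α : i ⟶ i') :
    c.cyl.map (c.leibnizLeft k α) ≫ c.connHomotopy k i' =
      c.connHomotopy k i ≫ c.leibnizLeft k α := by
  apply (c.isPushout_cyl_leibniz k i).hom_ext
  · rw [reassoc_of% c.map_inl_connHomotopy, ← c.cyl.map_comp_assoc, inl_leibnizLeft,
      c.cyl.map_comp_assoc, map_inl_connHomotopy, reassoc_of% c.conn_naturality]
  · rw [reassoc_of% c.map_inr_connHomotopy, ← c.cyl.map_comp_assoc, inr_leibnizLeft,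
      c.cyl.map_comp_assoc, map_inr_connHomotopy, contr_naturality_assoc]

lemma connLeft_naturality (k : Fin 2) {i i' : Arrow E} (α : i ⟶ i') :
    c.leibnizLeft k ((c.leibniz k).map α) ≫ c.connLeft k i' =
      c.connLeft k i ≫ c.leibnizLeft k α := by
  apply pushout.hom_ext
  · refine ((reassoc_of% c.inl_leibnizLeft) k ((c.leibniz k).map α) _).trans ?_
    refine (congrArg (_ ≫ ·) (pushout.inl_desc _ _ _)).trans ?_
    refine Eq.trans ?_ (pushout.inl_desc_assoc _ _ _ _).symm
    exact c.connHomotopy_naturality k α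
  · refine ((reassoc_of% c.inr_leibnizLeft) k ((c.leibniz k).map α) _).trans ?_
    refine (congrArg (_ ≫ ·) (pushout.inr_desc _ _ _)).trans ?_
    refine Eq.trans ?_ (pushout.inr_desc_assoc _ _ _ _).symm
    refine (c.contr_naturality_assoc α.right _).trans ?_
    exact (congrArg (_ ≫ ·) (c.inr_leibnizLeft k α).symm).trans (Category.assoc _ _ _).symm

/-- The connection exhibits Leibniz products with an endpoint inclusion as strong homotopy
equivalences. -/
noncomputable def connRetraction (k : Fin 2) : c.leibniz k ⋙ c.leibniz k ⟶ c.leibniz k where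
  app i := Arrow.homMk' (f := c.leibnizObj k (Arrow.mk (c.leibnizObj k i)))
    (g := c.leibnizObj k i) (c.connLeft k i) ((c.conn k).app i.right) (c.connLeft_w k i)
  naturality _ _ α := Arrow.hom_ext _ _ (c.connLeft_naturality k α)
    (c.conn_naturality k α.right)

/-- At the opposite endpoint the homotopy is the identity: on `I ⊗ A` because `cᵏ ∘ δ¹⁻ᵏ = 1`, and
on `B`, where it is constant, because `ε ∘ δ¹⁻ᵏ = 1`. -/
lemma δ_connHomotopy (k : Fin 2) (i : Arrow E) :
    c.δ (1 - k) (pushout (c.δ k i.left) i.hom) ≫ c.connHomotopy k i = 𝟙 _ := by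
  apply pushout.hom_ext
  · rw [← reassoc_of% c.δ_naturality, map_inl_connHomotopy, reassoc_of% c.other_δ_conn,
      Category.comp_id]
  · rw [← reassoc_of% c.δ_naturality, map_inr_connHomotopy, reassoc_of% c.δ_contr,
      Category.comp_id]

/-- This makes `δᵏ ⊗̂ i` a strong homotopy equivalence for every arrow `i`, cofibration or not, and
naturally in `i`. -/
lemma leibnizUnit_connRetraction (k : Fin 2) (i : Arrow E) :
    (c.leibnizUnit k).app ((c.leibniz k).obj i) ≫ (c.connRetraction k).app i = 𝟙 _ :=
  Arrow.hom_ext _ _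
    ((Category.assoc _ _ _).trans ((congrArg (_ ≫ ·) (pushout.inl_desc _ _ _)).trans
      (c.δ_connHomotopy k i)))
    (c.other_δ_conn k i.right)

end HomotopyEquivalence

end FunctorialCylinder

/-! ### Base change along arrows -/

section BaseChange

variable {E : Type u} [Category.{v} E] [HasPullbacks E]

/-- The base change along `h` of `g`, as a map of objects over the codomain of `h` via `e`. -/
noncomputable def baseChangeHom (g h : Arrow E) (e : g.right ⟶ h.right) :
    pullback (g.hom ≫ e) h.hom ⟶ pullback e h.hom :=
  pullback.lift (pullback.fst _ _ ≫ g.hom) (pullback.snd _ _)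
    ((Category.assoc _ _ _).trans pullback.condition)

lemma baseChangeHom_fst (g h : Arrow E) (e : g.right ⟶ h.right) :
    baseChangeHom g h e ≫ pullback.fst e h.hom = pullback.fst (g.hom ≫ e) h.hom ≫ g.hom :=
  pullback.lift_fst _ _ _

lemma baseChangeHom_snd (g h : Arrow E) (e : g.right ⟶ h.right) :
    baseChangeHom g h e ≫ pullback.snd e h.hom = pullback.snd (g.hom ≫ e) h.hom :=
  pullback.lift_snd _ _ _

/-- The projection from the base change of `g`. -/
noncomputable def baseChangeProj (g h : Arrow E) (e : g.right ⟶ h.right) :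
    Arrow.mk (baseChangeHom g h e) ⟶ g :=
  Arrow.homMk (f := Arrow.mk (baseChangeHom g h e)) (pullback.fst (g.hom ≫ e) h.hom)
    (pullback.fst e h.hom) (baseChangeHom_fst g h e).symm

variable {g h g' h' : Arrow E} {e : g.right ⟶ h.right} {e' : g'.right ⟶ h'.right}

/-- The functoriality of the domain of a base change. -/
noncomputable def baseChangeMapLeft (α : g ⟶ g') (β : h ⟶ h') (w : α.right ≫ e' = e ≫ β.right) :
    pullback (g.hom ≫ e) h.hom ⟶ pullback (g'.hom ≫ e') h'.hom :=
  pullback.lift (pullback.fst _ _ ≫ α.left) (pullback.snd _ _ ≫ β.left) (by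
    rw [Category.assoc, Category.assoc, Arrow.w, Arrow.w_assoc, w, ← pullback.condition_assoc,
      Category.assoc])

/-- The functoriality of the codomain of a base change. -/
noncomputable def baseChangeMapRight (α : g ⟶ g') (β : h ⟶ h')
    (w : α.right ≫ e' = e ≫ β.right) : pullback e h.hom ⟶ pullback e' h'.hom :=
  pullback.lift (pullback.fst _ _ ≫ α.right) (pullback.snd _ _ ≫ β.left) (by
    rw [Category.assoc, Category.assoc, Arrow.w, w, ← pullback.condition_assoc])

section

variable (α : g ⟶ g') (β : h ⟶ h') (w : α.right ≫ e' = e ≫ β.right)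

lemma baseChangeMapLeft_fst : baseChangeMapLeft α β w ≫ pullback.fst (g'.hom ≫ e') h'.hom =
    pullback.fst (g.hom ≫ e) h.hom ≫ α.left :=
  pullback.lift_fst _ _ _

lemma baseChangeMapLeft_snd : baseChangeMapLeft α β w ≫ pullback.snd (g'.hom ≫ e') h'.hom =
    pullback.snd (g.hom ≫ e) h.hom ≫ β.left :=
  pullback.lift_snd _ _ _

lemma baseChangeMapRight_fst : baseChangeMapRight α β w ≫ pullback.fst e' h'.hom =
    pullback.fst e h.hom ≫ α.right :=
  pullback.lift_fst _ _ _

lemma baseChangeMapRight_snd : baseChangeMapRight α β w ≫ pullback.snd e' h'.hom =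
    pullback.snd e h.hom ≫ β.left :=
  pullback.lift_snd _ _ _

lemma baseChangeMap_w : baseChangeMapLeft α β w ≫ baseChangeHom g' h' e' =
    baseChangeHom g h e ≫ baseChangeMapRight α β w := by
  apply pullback.hom_ext
  · rw [Category.assoc, baseChangeHom_fst, reassoc_of% @baseChangeMapLeft_fst, Category.assoc,
      baseChangeMapRight_fst, reassoc_of% @baseChangeHom_fst, Arrow.w]
  · rw [Category.assoc, baseChangeHom_snd, baseChangeMapLeft_snd, Category.assoc,
      baseChangeMapRight_snd, reassoc_of% @baseChangeHom_snd]

/-- The functoriality of base changes. -/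
noncomputable def baseChangeMap :
    Arrow.mk (baseChangeHom g h e) ⟶ Arrow.mk (baseChangeHom g' h' e') :=
  Arrow.homMk' (baseChangeMapLeft α β w) (baseChangeMapRight α β w) (baseChangeMap_w α β w)

lemma baseChangeMap_proj : baseChangeMap α β w ≫ baseChangeProj g' h' e' =
    baseChangeProj g h e ≫ α :=
  Arrow.hom_ext _ _ (baseChangeMapLeft_fst α β w) (baseChangeMapRight_fst α β w)

end

lemma baseChangeMap_id (w : (𝟙 g : g ⟶ g).right ≫ e = e ≫ (𝟙 h : h ⟶ h).right) :
    baseChangeMap (𝟙 g) (𝟙 h) w = 𝟙 _ := by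
  apply Arrow.hom_ext
  · apply pullback.hom_ext
    · refine (baseChangeMapLeft_fst _ _ w).trans ?_
      exact (Category.comp_id _).trans (Category.id_comp _).symm
    · refine (baseChangeMapLeft_snd _ _ w).trans ?_
      exact (Category.comp_id _).trans (Category.id_comp _).symm
  · apply pullback.hom_ext
    · refine (baseChangeMapRight_fst _ _ w).trans ?_
      exact (Category.comp_id _).trans (Category.id_comp _).symm
    · refine (baseChangeMapRight_snd _ _ w).trans ?_
      exact (Category.comp_id _).trans (Category.id_comp _).symm

lemma baseChangeMapLeft_comp {g'' h'' : Arrow E} {e'' : g''.right ⟶ h''.right}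
    (α : g ⟶ g') (β : h ⟶ h') (w : α.right ≫ e' = e ≫ β.right)
    (α' : g' ⟶ g'') (β' : h' ⟶ h'') (w' : α'.right ≫ e'' = e' ≫ β'.right)
    (w'' : (α ≫ α').right ≫ e'' = e ≫ (β ≫ β').right) :
    baseChangeMapLeft (α ≫ α') (β ≫ β') w'' =
      baseChangeMapLeft α β w ≫ baseChangeMapLeft α' β' w' := by
  apply pullback.hom_ext
  · rw [Category.assoc, baseChangeMapLeft_fst, baseChangeMapLeft_fst,
      reassoc_of% @baseChangeMapLeft_fst, Arrow.comp_left]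
  · rw [Category.assoc, baseChangeMapLeft_snd, baseChangeMapLeft_snd,
      reassoc_of% @baseChangeMapLeft_snd, Arrow.comp_left]

lemma baseChangeMapRight_comp {g'' h'' : Arrow E} {e'' : g''.right ⟶ h''.right}
    (α : g ⟶ g') (β : h ⟶ h') (w : α.right ≫ e' = e ≫ β.right)
    (α' : g' ⟶ g'') (β' : h' ⟶ h'') (w' : α'.right ≫ e'' = e' ≫ β'.right)
    (w'' : (α ≫ α').right ≫ e'' = e ≫ (β ≫ β').right) :
    baseChangeMapRight (α ≫ α') (β ≫ β') w'' =
      baseChangeMapRight α β w ≫ baseChangeMapRight α' β' w' := by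
  apply pullback.hom_ext
  · rw [Category.assoc, baseChangeMapRight_fst, baseChangeMapRight_fst,
      reassoc_of% @baseChangeMapRight_fst, Arrow.comp_right]
  · rw [Category.assoc, baseChangeMapRight_snd, baseChangeMapRight_snd,
      reassoc_of% @baseChangeMapRight_snd, Arrow.comp_left]

end BaseChange

section BaseChangeFunctor

variable {E : Type u} [Category.{v} E] {A : Type u₁} [Category.{v₁} A]
  {B : Type u₂} [Category.{v₂} B] (U : A ⥤ Arrow E) (H : B ⥤ Arrow E)

/-- Triples of an arrow `U.obj a`, an arrow `H.obj b`, and a map between their codomains. -/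
abbrev Cospan : Type (max u₁ u₂ v) := Comma (U ⋙ Arrow.rightFunc) (H ⋙ Arrow.rightFunc)

variable {U H} in
/-- The map between the codomains. -/
def Cospan.bottom (x : Cospan U H) : (U.obj x.left).right ⟶ (H.obj x.right).right :=
  x.hom

variable {U H} in
lemma Cospan.bottom_w {x y : Cospan U H} (φ : x ⟶ y) :
    (U.map φ.left).right ≫ y.bottom = x.bottom ≫ (H.map φ.right).right :=
  φ.w

variable [HasPullbacks E]

/-- The base change functor on triples. -/
noncomputable def baseChangeFunctor : Cospan U H ⥤ Arrow E where
  obj x := Arrow.mk (baseChangeHom (U.obj x.left) (H.obj x.right) x.bottom)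
  map φ := baseChangeMap (U.map φ.left) (H.map φ.right) (Cospan.bottom_w φ)
  map_id x := by
    -- The compatibility proof `w` depends on the morphisms, so these are generalized before being
    -- replaced; likewise for composition.
    have : ∀ (α : U.obj x.left ⟶ U.obj x.left) (β : H.obj x.right ⟶ H.obj x.right)
        (w : α.right ≫ x.bottom = x.bottom ≫ β.right), α = 𝟙 _ → β = 𝟙 _ →
        baseChangeMap α β w = 𝟙 _ := by
      rintro _ _ w rfl rfl
      exact baseChangeMap_id w
    exact this _ _ _ (U.map_id _) (H.map_id _)
  map_comp {x y z} φ ψ := by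
    have : ∀ (α : U.obj x.left ⟶ U.obj z.left) (β : H.obj x.right ⟶ H.obj z.right)
        (w : α.right ≫ z.bottom = x.bottom ≫ β.right),
        α = U.map φ.left ≫ U.map ψ.left → β = H.map φ.right ≫ H.map ψ.right →
        baseChangeMap α β w =
          baseChangeMap (U.map φ.left) (H.map φ.right) (Cospan.bottom_w φ) ≫
            baseChangeMap (U.map ψ.left) (H.map ψ.right) (Cospan.bottom_w ψ) := by
      rintro _ _ w rfl rfl
      exact Arrow.hom_ext _ _
        (baseChangeMapLeft_comp _ _ (Cospan.bottom_w φ) _ _ (Cospan.bottom_w ψ) w)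
        (baseChangeMapRight_comp _ _ (Cospan.bottom_w φ) _ _ (Cospan.bottom_w ψ) w)
    exact this _ _ _ (U.map_comp _ _) (H.map_comp _ _)

end BaseChangeFunctor

/-! ### Base change of coalgebras -/

section Coalgebra

variable {E : Type u} [Category.{v} E] [HasPullbacks E] {S : AWFS E} {A : Type u₁} [Category.{v₁} A]
  {B : Type u₂} [Category.{v₂} B] (K : A ⥤ S.LCoalg) (H : B ⥤ Arrow E)

/-- The cospan of a coalgebra and a projection from a base change. -/
noncomputable def coalgebraCospan : Cospan (K ⋙ AWFS.LCoalg.forget S) H ⥤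
    StrictPullback (AWFS.LCoalg.forget S ⋙ Arrow.rightFunc) (𝟭 (Arrow E) ⋙ Arrow.rightFunc) where
  -- (S3) concerns cospans with equal codomains. The base change of `g` along `e` and `h` is brought
  -- to this form by pulling `g` back along the projection from the pullback of `h` along `e` to the
  -- codomain of `g`.
  obj x := ⟨K.obj x.left, Arrow.mk (pullback.fst x.bottom (H.obj x.right).hom), rfl⟩
  map φ := ⟨K.map φ.left,
    Arrow.homMk' (baseChangeMapRight _ _ (Cospan.bottom_w φ))
      ((K ⋙ AWFS.LCoalg.forget S).map φ.left).right (baseChangeMapRight_fst _ _ _),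
    (Category.comp_id _).trans (Category.id_comp _).symm⟩
  map_id _ := StrictPullback.Hom.ext (K.map_id _) (Arrow.hom_ext _ _
    (congrArg CommaMorphism.right
      ((baseChangeFunctor (K ⋙ AWFS.LCoalg.forget S) H).map_id _))
    (have h := congrArg Arrow.Hom.right ((K ⋙ AWFS.LCoalg.forget S).map_id _)
    h))
  map_comp φ ψ := StrictPullback.Hom.ext (K.map_comp _ _) (Arrow.hom_ext _ _
    (congrArg CommaMorphism.right
      ((baseChangeFunctor (K ⋙ AWFS.LCoalg.forget S) H).map_comp φ ψ))
    (have h := congrArg Arrow.Hom.right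
      ((K ⋙ AWFS.LCoalg.forget S).map_comp φ.left ψ.left)
    h))

/-- The base changes of coalgebras as values of the pullback functor. -/
noncomputable abbrev coalgebraPullback : Cospan (K ⋙ AWFS.LCoalg.forget S) H ⥤ Arrow E :=
  coalgebraCospan K H ⋙ StrictPullback.map (AWFS.LCoalg.forget S) (𝟭 (Arrow E))
    Arrow.rightFunc Arrow.rightFunc ⋙ pullbackFunctor E

section

variable (g h : Arrow E) (e : g.right ⟶ h.right)

/-- Comparison of two forms of the base change. -/
noncomputable def toIteratedPullback :
    pullback (g.hom ≫ e) h.hom ⟶ pullback (g.hom ≫ 𝟙 g.right) (pullback.fst e h.hom) :=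
  pullback.lift (pullback.fst _ _) (baseChangeHom g h e) (by
    rw [baseChangeHom_fst]
    exact congrArg (_ ≫ ·) (Category.comp_id _))

/-- Comparison of two forms of the base change. -/
noncomputable def ofIteratedPullback :
    pullback (g.hom ≫ 𝟙 g.right) (pullback.fst e h.hom) ⟶ pullback (g.hom ≫ e) h.hom :=
  pullback.lift (pullback.fst _ _) (pullback.snd _ _ ≫ pullback.snd _ _) (by
    rw [Category.assoc, ← pullback.condition, ← pullback.condition_assoc, Category.assoc,
      Category.id_comp])

lemma toIteratedPullback_fst : toIteratedPullback g h e ≫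
    pullback.fst (g.hom ≫ 𝟙 g.right) (pullback.fst e h.hom) = pullback.fst _ _ :=
  pullback.lift_fst _ _ _

lemma toIteratedPullback_snd : toIteratedPullback g h e ≫
    pullback.snd (g.hom ≫ 𝟙 g.right) (pullback.fst e h.hom) = baseChangeHom g h e :=
  pullback.lift_snd _ _ _

lemma ofIteratedPullback_fst : ofIteratedPullback g h e ≫ pullback.fst (g.hom ≫ e) h.hom =
    pullback.fst _ _ :=
  pullback.lift_fst _ _ _

lemma ofIteratedPullback_snd : ofIteratedPullback g h e ≫ pullback.snd (g.hom ≫ e) h.hom =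
    pullback.snd _ _ ≫ pullback.snd _ _ :=
  pullback.lift_snd _ _ _

lemma toIteratedPullback_ofIteratedPullback :
    toIteratedPullback g h e ≫ ofIteratedPullback g h e = 𝟙 _ := by
  apply pullback.hom_ext
  · rw [Category.assoc, ofIteratedPullback_fst, toIteratedPullback_fst, Category.id_comp]
  · rw [Category.assoc, ofIteratedPullback_snd, reassoc_of% @toIteratedPullback_snd,
      baseChangeHom_snd, Category.id_comp]

lemma ofIteratedPullback_baseChangeHom :
    ofIteratedPullback g h e ≫ baseChangeHom g h e = pullback.snd _ _ := by
  apply pullback.hom_ext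
  · rw [Category.assoc, baseChangeHom_fst, reassoc_of% @ofIteratedPullback_fst,
      ← pullback.condition]
    exact congrArg (_ ≫ ·) (Category.comp_id _).symm
  · rw [Category.assoc, baseChangeHom_snd, ofIteratedPullback_snd]

variable {g h e} {g' h' : Arrow E} {e' : g'.right ⟶ h'.right}
  (α : g ⟶ g') (β : h ⟶ h') (w : α.right ≫ e' = e ≫ β.right)
  {m : pullback (g.hom ≫ 𝟙 g.right) (pullback.fst e h.hom) ⟶
    pullback (g'.hom ≫ 𝟙 g'.right) (pullback.fst e' h'.hom)}

lemma toIteratedPullback_naturality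
    (hm : m ≫ pullback.fst _ _ = pullback.fst _ _ ≫ α.left)
    (hm' : m ≫ pullback.snd _ _ = pullback.snd _ _ ≫ baseChangeMapRight α β w) :
    baseChangeMapLeft α β w ≫ toIteratedPullback g' h' e' = toIteratedPullback g h e ≫ m := by
  apply pullback.hom_ext
  · rw [Category.assoc, Category.assoc, hm, toIteratedPullback_fst,
      reassoc_of% @toIteratedPullback_fst, baseChangeMapLeft_fst]
  · rw [Category.assoc, Category.assoc, hm', toIteratedPullback_snd,
      reassoc_of% @toIteratedPullback_snd, baseChangeMap_w]

lemma ofIteratedPullback_naturality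
    (hm : m ≫ pullback.fst _ _ = pullback.fst _ _ ≫ α.left)
    (hm' : m ≫ pullback.snd _ _ = pullback.snd _ _ ≫ baseChangeMapRight α β w) :
    m ≫ ofIteratedPullback g' h' e' = ofIteratedPullback g h e ≫ baseChangeMapLeft α β w := by
  apply pullback.hom_ext
  · rw [Category.assoc, Category.assoc, ofIteratedPullback_fst, hm, baseChangeMapLeft_fst,
      reassoc_of% @ofIteratedPullback_fst]
  · rw [Category.assoc, Category.assoc, ofIteratedPullback_snd, ← Category.assoc, hm',
      Category.assoc, baseChangeMapRight_snd, baseChangeMapLeft_snd,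
      reassoc_of% @ofIteratedPullback_snd]

end

/-- Base changes of coalgebras are values of the pullback functor. -/
noncomputable def toCoalgebraPullback :
    baseChangeFunctor (K ⋙ AWFS.LCoalg.forget S) H ⟶ coalgebraPullback K H where
  app x := Arrow.homMk'
    (f := baseChangeHom ((K ⋙ AWFS.LCoalg.forget S).obj x.left) (H.obj x.right) x.bottom)
    (g := pullback.snd (((K ⋙ AWFS.LCoalg.forget S).obj x.left).hom ≫ 𝟙 _)
      (pullback.fst x.bottom (H.obj x.right).hom))
    (toIteratedPullback _ _ _) (𝟙 _)
    ((toIteratedPullback_snd _ _ _).trans (Category.comp_id _).symm)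
  naturality _ _ φ := Arrow.hom_ext _ _
    (toIteratedPullback_naturality _ _ (Cospan.bottom_w φ) (pullback.lift_fst _ _ _)
      (pullback.lift_snd _ _ _))
    ((Category.comp_id (baseChangeMapRight _ _ (Cospan.bottom_w φ))).trans
      (Category.id_comp (baseChangeMapRight _ _ (Cospan.bottom_w φ))).symm)

/-- Values of the pullback functor on coalgebras are base changes. -/
noncomputable def ofCoalgebraPullback :
    coalgebraPullback K H ⟶ baseChangeFunctor (K ⋙ AWFS.LCoalg.forget S) H where
  app x := Arrow.homMk'
    (f := pullback.snd (((K ⋙ AWFS.LCoalg.forget S).obj x.left).hom ≫ 𝟙 _)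
      (pullback.fst x.bottom (H.obj x.right).hom))
    (g := baseChangeHom ((K ⋙ AWFS.LCoalg.forget S).obj x.left) (H.obj x.right) x.bottom)
    (ofIteratedPullback _ _ _) (𝟙 _)
    ((ofIteratedPullback_baseChangeHom _ _ _).trans (Category.comp_id _).symm)
  naturality _ _ φ := Arrow.hom_ext _ _
    (ofIteratedPullback_naturality _ _ (Cospan.bottom_w φ) (pullback.lift_fst _ _ _)
      (pullback.lift_snd _ _ _))
    ((Category.comp_id (baseChangeMapRight _ _ (Cospan.bottom_w φ))).trans
      (Category.id_comp (baseChangeMapRight _ _ (Cospan.bottom_w φ))).symm)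

/-- This is the pasting law for pullbacks. A one-sided inverse suffices, since it is used only
through `NatLift.retract`. -/
lemma toCoalgebraPullback_ofCoalgebraPullback :
    toCoalgebraPullback K H ≫ ofCoalgebraPullback K H = 𝟙 _ := by
  ext x
  · exact toIteratedPullback_ofIteratedPullback _ _ _
  · exact Category.id_comp _

/-- If the pullback functor lifts to coalgebras, base changes of coalgebras are coalgebras. -/
lemma nonempty_natLift_baseChange
    (h : HasLift
      (StrictPullback.map (AWFS.LCoalg.forget S) (𝟭 (Arrow E)) Arrow.rightFunc Arrow.rightFunc)
      (AWFS.LCoalg.forget S) (pullbackFunctor E)) :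
    Nonempty (NatLift (baseChangeFunctor (K ⋙ AWFS.LCoalg.forget S) H) S.monad.forget) :=
  let ⟨l⟩ := AWFS.nonempty_natLift_of_hasLift h
  ⟨(l.compLeft (coalgebraCospan K H)).retract (toCoalgebraPullback K H) (ofCoalgebraPullback K H)
    (toCoalgebraPullback_ofCoalgebraPullback K H)⟩

end Coalgebra

/-! ### Base change of strong homotopy equivalences along fibrations -/

namespace FunctorialCylinder

variable {E : Type u} [Category.{v} E]
  (c : FunctorialCylinder E) (k : Fin 2)

section

variable [HasPullbacks E] {g h : Arrow E} (e : g.right ⟶ h.right)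
  (ρr : c.cyl.obj g.right ⟶ g.right) (ψ : c.cyl.obj (pullback e h.hom) ⟶ h.left)

/-- The lift of a homotopy to a base change. -/
noncomputable def liftHomotopy
    (hψ : ψ ≫ h.hom = c.cyl.map (pullback.fst e h.hom) ≫ ρr ≫ e) :
    c.cyl.obj (pullback e h.hom) ⟶ pullback e h.hom :=
  pullback.lift (c.cyl.map (pullback.fst e h.hom) ≫ ρr) ψ (by rw [hψ, Category.assoc])

lemma liftHomotopy_fst (hψ : ψ ≫ h.hom = c.cyl.map (pullback.fst e h.hom) ≫ ρr ≫ e) :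
    c.liftHomotopy e ρr ψ hψ ≫ pullback.fst e h.hom = c.cyl.map (pullback.fst e h.hom) ≫ ρr :=
  pullback.lift_fst _ _ _

lemma liftHomotopy_snd (hψ : ψ ≫ h.hom = c.cyl.map (pullback.fst e h.hom) ≫ ρr ≫ e) :
    c.liftHomotopy e ρr ψ hψ ≫ pullback.snd e h.hom = ψ :=
  pullback.lift_snd _ _ _

variable [HasPushouts E]

/-- The lift of the domain of a strong homotopy equivalence to a base change. -/
noncomputable def liftRetractionLeft {ρl : pushout (c.δ k g.left) g.hom ⟶ g.left}
    (hρ : ρl ≫ g.hom = c.leibnizObj k g ≫ ρr)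
    (hψ : ψ ≫ h.hom = c.cyl.map (pullback.fst e h.hom) ≫ ρr ≫ e) :
    pushout (c.δ k (pullback (g.hom ≫ e) h.hom)) (baseChangeHom g h e) ⟶
      pullback (g.hom ≫ e) h.hom :=
  pullback.lift (c.leibnizLeft k (baseChangeProj g h e) ≫ ρl)
    (c.leibnizObj k (Arrow.mk (baseChangeHom g h e)) ≫ ψ) (by
      rw [Category.assoc, Category.assoc, hψ, ← Category.assoc ρl, hρ, Category.assoc]
      exact ((c.leibniz_w k (baseChangeProj g h e)) =≫ (ρr ≫ e)).trans (Category.assoc _ _ _) |>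
        (Category.assoc _ _ _).symm.trans)

variable {ρl : pushout (c.δ k g.left) g.hom ⟶ g.left}
  (hρ : ρl ≫ g.hom = c.leibnizObj k g ≫ ρr)
  (hψ : ψ ≫ h.hom = c.cyl.map (pullback.fst e h.hom) ≫ ρr ≫ e)

lemma liftRetractionLeft_fst :
    c.liftRetractionLeft k e ρr ψ hρ hψ ≫ pullback.fst (g.hom ≫ e) h.hom =
      c.leibnizLeft k (baseChangeProj g h e) ≫ ρl :=
  pullback.lift_fst _ _ _

lemma liftRetractionLeft_snd :
    c.liftRetractionLeft k e ρr ψ hρ hψ ≫ pullback.snd (g.hom ≫ e) h.hom =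
      c.leibnizObj k (Arrow.mk (baseChangeHom g h e)) ≫ ψ :=
  pullback.lift_snd _ _ _

/-- The component in the domain of `h` is defined by `ψ` alone, on the domain of `g` as well as on
its codomain. No second lift is chosen, so the homotopies upstairs and downstairs are automatically
compatible. -/
lemma liftRetraction_w :
    c.liftRetractionLeft k e ρr ψ hρ hψ ≫ baseChangeHom g h e =
      c.leibnizObj k (Arrow.mk (baseChangeHom g h e)) ≫ c.liftHomotopy e ρr ψ hψ := by
  apply pullback.hom_ext
  · rw [Category.assoc, baseChangeHom_fst, reassoc_of% c.liftRetractionLeft_fst, hρ]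
    refine Eq.trans ?_ (Category.assoc _ _ _).symm
    refine Eq.trans ?_ (congrArg (_ ≫ ·) (c.liftHomotopy_fst e ρr ψ hψ)).symm
    exact ((Category.assoc _ _ _).symm.trans
      ((c.leibniz_w k (baseChangeProj g h e)) =≫ ρr)).trans (Category.assoc _ _ _)
  · rw [Category.assoc, baseChangeHom_snd, liftRetractionLeft_snd]
    refine Eq.trans ?_ (Category.assoc _ _ _).symm
    exact (congrArg (_ ≫ ·) (c.liftHomotopy_snd e ρr ψ hψ)).symm

/-- The base change of a strong homotopy equivalence, given a lift of the homotopy. -/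
noncomputable def liftRetraction :
    (c.leibniz k).obj (Arrow.mk (baseChangeHom g h e)) ⟶ Arrow.mk (baseChangeHom g h e) :=
  Arrow.homMk' (f := c.leibnizObj k (Arrow.mk (baseChangeHom g h e)))
    (c.liftRetractionLeft k e ρr ψ hρ hψ) (c.liftHomotopy e ρr ψ hψ)
    (c.liftRetraction_w k e ρr ψ hρ hψ)

/-- The component towards `g` is inherited from the retraction of `g`, by naturality of the unit
along the projection. The component towards the domain of `h` holds because `ψ` is the second
projection at the endpoint `1 - k`. -/
lemma leibnizUnit_liftRetraction
    (hl : c.δ (1 - k) g.left ≫ pushout.inl (c.δ k g.left) g.hom ≫ ρl = 𝟙 g.left)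
    (hr : c.δ (1 - k) g.right ≫ ρr = 𝟙 g.right)
    (hψ' : c.δ (1 - k) (pullback e h.hom) ≫ ψ = pullback.snd e h.hom) :
    (c.leibnizUnit k).app (Arrow.mk (baseChangeHom g h e)) ≫
      c.liftRetraction k e ρr ψ hρ hψ = 𝟙 _ := by
  apply Arrow.hom_ext
  · apply pullback.hom_ext
    · refine (Category.assoc _ _ _).trans ?_
      refine (congrArg (_ ≫ ·) (c.liftRetractionLeft_fst k e ρr ψ hρ hψ)).trans ?_
      have h₁ := congrArg Arrow.Hom.left ((c.leibnizUnit k).naturality (baseChangeProj g h e))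
      refine (Category.assoc _ _ _).symm.trans ?_
      refine (congrArg (· ≫ ρl) h₁.symm).trans ?_
      refine (Category.assoc _ _ _).trans ?_
      refine (congrArg (_ ≫ ·) ((Category.assoc _ _ _).trans hl)).trans ?_
      exact (Category.comp_id _).trans (Category.id_comp _).symm
    · refine (Category.assoc _ _ _).trans ?_
      refine (congrArg (_ ≫ ·) (c.liftRetractionLeft_snd k e ρr ψ hρ hψ)).trans ?_
      have h₁ := Arrow.w ((c.leibnizUnit k).app (Arrow.mk (baseChangeHom g h e)))
      refine (Category.assoc _ _ _).symm.trans ?_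
      refine (congrArg (· ≫ ψ) h₁).trans ?_
      refine (Category.assoc _ _ _).trans ?_
      refine (congrArg (_ ≫ ·) hψ').trans ?_
      exact (baseChangeHom_snd g h e).trans (Category.id_comp _).symm
  · apply pullback.hom_ext
    · refine (Category.assoc _ _ _).trans ?_
      refine (congrArg (_ ≫ ·) (c.liftHomotopy_fst e ρr ψ hψ)).trans ?_
      refine ((reassoc_of% c.δ_naturality) (1 - k) (pullback.fst e h.hom) ρr).trans ?_
      refine (congrArg (_ ≫ ·) hr).trans ?_
      exact (Category.comp_id _).trans (Category.id_comp _).symm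
    · refine (Category.assoc _ _ _).trans ?_
      refine (congrArg (_ ≫ ·) (c.liftHomotopy_snd e ρr ψ hψ)).trans ?_
      exact hψ'.trans (Category.id_comp _).symm

end

section

variable [HasPullbacks E] {g h g' h' : Arrow E} {e : g.right ⟶ h.right} {e' : g'.right ⟶ h'.right}
  (α : g ⟶ g') (β : h ⟶ h') (w : α.right ≫ e' = e ≫ β.right)
  {ρr : c.cyl.obj g.right ⟶ g.right} {ψ : c.cyl.obj (pullback e h.hom) ⟶ h.left}
  (hψ : ψ ≫ h.hom = c.cyl.map (pullback.fst e h.hom) ≫ ρr ≫ e)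
  {ρr' : c.cyl.obj g'.right ⟶ g'.right} {ψ' : c.cyl.obj (pullback e' h'.hom) ⟶ h'.left}
  (hψ' : ψ' ≫ h'.hom = c.cyl.map (pullback.fst e' h'.hom) ≫ ρr' ≫ e')

lemma liftHomotopy_naturality (hr : c.cyl.map α.right ≫ ρr' = ρr ≫ α.right)
    (hn : c.cyl.map (baseChangeMapRight α β w) ≫ ψ' = ψ ≫ β.left) :
    c.cyl.map (baseChangeMapRight α β w) ≫ c.liftHomotopy e' ρr' ψ' hψ' =
      c.liftHomotopy e ρr ψ hψ ≫ baseChangeMapRight α β w := by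
  apply pullback.hom_ext
  · rw [Category.assoc, Category.assoc, liftHomotopy_fst, baseChangeMapRight_fst,
      reassoc_of% c.liftHomotopy_fst, ← hr, ← c.cyl.map_comp_assoc, baseChangeMapRight_fst,
      c.cyl.map_comp_assoc]
  · rw [Category.assoc, Category.assoc, liftHomotopy_snd, baseChangeMapRight_snd,
      reassoc_of% c.liftHomotopy_snd, hn]

variable [HasPushouts E] {ρl : pushout (c.δ k g.left) g.hom ⟶ g.left}
  (hρ : ρl ≫ g.hom = c.leibnizObj k g ≫ ρr)
  {ρl' : pushout (c.δ k g'.left) g'.hom ⟶ g'.left}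
  (hρ' : ρl' ≫ g'.hom = c.leibnizObj k g' ≫ ρr')

lemma liftRetractionLeft_naturality (hl : c.leibnizLeft k α ≫ ρl' = ρl ≫ α.left)
    (hn : c.cyl.map (baseChangeMapRight α β w) ≫ ψ' = ψ ≫ β.left) :
    c.leibnizLeft k (baseChangeMap α β w) ≫ c.liftRetractionLeft k e' ρr' ψ' hρ' hψ' =
      c.liftRetractionLeft k e ρr ψ hρ hψ ≫ baseChangeMapLeft α β w := by
  apply pullback.hom_ext
  · refine (Category.assoc _ _ _).trans ?_
    refine (congrArg (_ ≫ ·) (c.liftRetractionLeft_fst k e' ρr' ψ' hρ' hψ')).trans ?_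
    rw [Category.assoc, baseChangeMapLeft_fst, reassoc_of% c.liftRetractionLeft_fst, ← hl,
      ← reassoc_of% c.leibnizLeft_comp, ← reassoc_of% c.leibnizLeft_comp, baseChangeMap_proj]
  · refine (Category.assoc _ _ _).trans ?_
    refine (congrArg (_ ≫ ·) (c.liftRetractionLeft_snd k e' ρr' ψ' hρ' hψ')).trans ?_
    rw [Category.assoc, baseChangeMapLeft_snd, reassoc_of% c.liftRetractionLeft_snd, ← hn]
    exact ((Category.assoc _ _ _).symm.trans
      ((c.leibniz_w k (baseChangeMap α β w)) =≫ ψ')).trans (Category.assoc _ _ _)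

end

section

variable [HasPushouts E] {A : Type u₁} [Category.{v₁} A] {B : Type u₂} [Category.{v₂} B]
  {U : A ⥤ Arrow E} {H : B ⥤ Arrow E} {k : Fin 2} (ρ : U ⋙ c.leibniz k ⟶ U)

/-- The domain of a retraction of a Leibniz product. -/
noncomputable def retractionLeft (a : A) :
    pushout (c.δ k (U.obj a).left) (U.obj a).hom ⟶ (U.obj a).left :=
  (ρ.app a).left

/-- The codomain of a retraction of a Leibniz product. -/
noncomputable def retractionRight (a : A) : c.cyl.obj (U.obj a).right ⟶ (U.obj a).right :=
  (ρ.app a).right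

lemma retraction_w (a : A) : c.retractionLeft ρ a ≫ (U.obj a).hom =
    c.leibnizObj k (U.obj a) ≫ c.retractionRight ρ a :=
  Arrow.w (ρ.app a)

lemma retractionLeft_naturality {a a' : A} (φ : a ⟶ a') :
    c.leibnizLeft k (U.map φ) ≫ c.retractionLeft ρ a' =
      c.retractionLeft ρ a ≫ (U.map φ).left :=
  congrArg CommaMorphism.left (ρ.naturality φ)

lemma retractionRight_naturality {a a' : A} (φ : a ⟶ a') :
    c.cyl.map (U.map φ).right ≫ c.retractionRight ρ a' =
      c.retractionRight ρ a ≫ (U.map φ).right :=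
  congrArg CommaMorphism.right (ρ.naturality φ)

variable {ρ}

lemma δ_retractionLeft
    (hρ : ∀ a, (c.leibnizUnit k).app (U.obj a) ≫ ρ.app a = 𝟙 (U.obj a)) (a : A) :
    c.δ (1 - k) (U.obj a).left ≫ pushout.inl (c.δ k (U.obj a).left) (U.obj a).hom ≫
      c.retractionLeft ρ a = 𝟙 (U.obj a).left :=
  (Category.assoc _ _ _).symm.trans (congrArg CommaMorphism.left (hρ a))

lemma δ_retractionRight
    (hρ : ∀ a, (c.leibnizUnit k).app (U.obj a) ≫ ρ.app a = 𝟙 (U.obj a)) (a : A) :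
    c.δ (1 - k) (U.obj a).right ≫ c.retractionRight ρ a = 𝟙 (U.obj a).right :=
  congrArg CommaMorphism.right (hρ a)

variable [HasPullbacks E] (hρ : ∀ a, (c.leibnizUnit k).app (U.obj a) ≫ ρ.app a = 𝟙 (U.obj a))

/-- The homotopy `retractionRight` is the identity at the endpoint `1 - k`; this is why the lift is
taken along `δ¹⁻ᵏ` and not along `δᵏ`. -/
lemma homotopySquare_w
    (hρ : ∀ a, (c.leibnizUnit k).app (U.obj a) ≫ ρ.app a = 𝟙 (U.obj a)) (x : Cospan U H) :
    pullback.snd x.bottom (H.obj x.right).hom ≫ (H.obj x.right).hom =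
      c.δ (1 - k) (pullback x.bottom (H.obj x.right).hom) ≫
        c.cyl.map (pullback.fst x.bottom (H.obj x.right).hom) ≫ c.retractionRight ρ x.left ≫
          x.bottom := by
  rw [reassoc_of% c.δ_naturality, ← Category.assoc (c.δ _ (U.obj x.left).right),
    c.δ_retractionRight hρ, Category.id_comp, pullback.condition]

/-- The square whose filler lifts the homotopy. -/
noncomputable def homotopySquare (x : Cospan U H) :
    (c.endpointArrow (1 - k)).obj (pullback x.bottom (H.obj x.right).hom) ⟶ H.obj x.right :=
  Arrow.homMk (f := Arrow.mk (c.δ (1 - k) (pullback x.bottom (H.obj x.right).hom)))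
    (pullback.snd x.bottom (H.obj x.right).hom)
    (c.cyl.map (pullback.fst x.bottom (H.obj x.right).hom) ≫ c.retractionRight ρ x.left ≫
      x.bottom) (c.homotopySquare_w hρ x)

lemma homotopySquare_naturality {x y : Cospan U H} (φ : x ⟶ y) :
    (c.endpointArrow (1 - k)).map (baseChangeMapRight _ _ (Cospan.bottom_w φ)) ≫
      c.homotopySquare hρ y = c.homotopySquare hρ x ≫ H.map φ.right := by
  apply Arrow.hom_ext
  · exact baseChangeMapRight_snd _ _ (Cospan.bottom_w φ)
  · change c.cyl.map (baseChangeMapRight _ _ (Cospan.bottom_w φ)) ≫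
      c.cyl.map (pullback.fst y.bottom (H.obj y.right).hom) ≫ c.retractionRight ρ y.left ≫
        y.bottom =
      (c.cyl.map (pullback.fst x.bottom (H.obj x.right).hom) ≫ c.retractionRight ρ x.left ≫
        x.bottom) ≫ (H.map φ.right).right
    rw [← c.cyl.map_comp_assoc, baseChangeMapRight_fst, c.cyl.map_comp_assoc, Category.assoc,
      Category.assoc, ← Cospan.bottom_w, ← Category.assoc (c.retractionRight ρ x.left),
      ← retractionRight_naturality, Category.assoc]

variable (l : NatLift (c.endpointArrow (1 - k)) H)

/-- The lift of the homotopy to the total space. -/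
noncomputable def homotopyLift (x : Cospan U H) :
    c.cyl.obj (pullback x.bottom (H.obj x.right).hom) ⟶ (H.obj x.right).left :=
  l.fill (c.homotopySquare hρ x)

lemma δ_homotopyLift (x : Cospan U H) :
    c.δ (1 - k) (pullback x.bottom (H.obj x.right).hom) ≫ c.homotopyLift hρ l x =
      pullback.snd x.bottom (H.obj x.right).hom :=
  l.hom_fill (c.homotopySquare hρ x)

lemma homotopyLift_hom (x : Cospan U H) : c.homotopyLift hρ l x ≫ (H.obj x.right).hom =
    c.cyl.map (pullback.fst x.bottom (H.obj x.right).hom) ≫ c.retractionRight ρ x.left ≫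
      x.bottom :=
  l.fill_hom (c.homotopySquare hρ x)

lemma homotopyLift_naturality {x y : Cospan U H} (φ : x ⟶ y) :
    c.cyl.map (baseChangeMapRight _ _ (Cospan.bottom_w φ)) ≫ c.homotopyLift hρ l y =
      c.homotopyLift hρ l x ≫ (H.map φ.right).left :=
  ((l.natural_left (baseChangeMapRight _ _ (Cospan.bottom_w φ))
      (c.homotopySquare hρ y)).symm.trans
    (congrArg _ (c.homotopySquare_naturality hρ φ))).trans
    (l.natural_right φ.right (c.homotopySquare hρ x))

/-- Base change of strong homotopy equivalences along fibrations. -/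
noncomputable def baseChangeRetraction :
    baseChangeFunctor U H ⋙ c.leibniz k ⟶ baseChangeFunctor U H where
  app x := c.liftRetraction k x.bottom (c.retractionRight ρ x.left) (c.homotopyLift hρ l x)
    (c.retraction_w ρ x.left) (c.homotopyLift_hom hρ l x)
  naturality _ _ φ := Arrow.hom_ext _ _
    (c.liftRetractionLeft_naturality k _ _ (Cospan.bottom_w φ)
      (c.homotopyLift_hom hρ l _) (c.homotopyLift_hom hρ l _)
      (c.retraction_w ρ _)
      (c.retraction_w ρ _) (c.retractionLeft_naturality ρ φ.left)
      (c.homotopyLift_naturality hρ l φ))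
    (c.liftHomotopy_naturality _ _ (Cospan.bottom_w φ)
      (c.homotopyLift_hom hρ l _) (c.homotopyLift_hom hρ l _)
      (c.retractionRight_naturality ρ φ.left)
      (c.homotopyLift_naturality hρ l φ))

/-- Exhibits the base change as a retract of its own Leibniz product with `δᵏ`, naturally in the
cospan. The only property required of the arrows `H.obj b` is lifting against `δ¹⁻ᵏ`. -/
lemma leibnizUnit_baseChangeRetraction :
    Functor.whiskerLeft (baseChangeFunctor U H) (c.leibnizUnit k) ≫
      c.baseChangeRetraction hρ l = 𝟙 (baseChangeFunctor U H) := by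
  ext1
  funext x
  exact c.leibnizUnit_liftRetraction k x.bottom (c.retractionRight ρ x.left)
    (c.homotopyLift hρ l x) (c.retraction_w ρ x.left) (c.homotopyLift_hom hρ l x)
    (c.δ_retractionLeft hρ x.left) (c.δ_retractionRight hρ x.left) (c.δ_homotopyLift hρ l x)

end

end FunctorialCylinder

/-! ### Base changes of the generating uniform trivial cofibrations along fibrations -/

namespace NatLift

variable {E : Type u} [Category.{v} E] [HasPullbacks E] {A : Type u₁} [Category.{v₁} A]
  {B : Type u₂} [Category.{v₂} B] {U U' : A ⥤ Arrow E} {H : B ⥤ Arrow E}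
  {D : Type u₃} [Category.{v₃} D] {V : D ⥤ Arrow E}

/-- Lifting operations for the base changes of two families. -/
def baseChangeSum (l : NatLift (baseChangeFunctor U H) V)
    (l' : NatLift (baseChangeFunctor U' H) V) :
    NatLift (baseChangeFunctor (U.sum' U') H) V where
  fill {x b} := match x with
    | ⟨.inl a, h, e⟩ => fun sq => l.fill (a := ⟨a, h, e⟩) sq
    | ⟨.inr a, h, e⟩ => fun sq => l'.fill (a := ⟨a, h, e⟩) sq
  hom_fill {x b} := match x with
    | ⟨.inl a, h, e⟩ => fun sq => l.hom_fill (a := ⟨a, h, e⟩) sq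
    | ⟨.inr a, h, e⟩ => fun sq => l'.hom_fill (a := ⟨a, h, e⟩) sq
  fill_hom {x b} := match x with
    | ⟨.inl a, h, e⟩ => fun sq => l.fill_hom (a := ⟨a, h, e⟩) sq
    | ⟨.inr a, h, e⟩ => fun sq => l'.fill_hom (a := ⟨a, h, e⟩) sq
  natural_left {x y b} φ sq := by
    obtain ⟨a, h, e⟩ := x
    obtain ⟨a', h', e'⟩ := y
    obtain ⟨φ, ψ, w⟩ := φ
    -- There are no morphisms between different summands, so only the diagonal cases carry content.
    rcases a with a | a <;> rcases a' with a' | a'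
    · exact l.natural_left (a := ⟨_, h, e⟩) (a' := ⟨_, h', e'⟩) ⟨ULift.down φ, ψ, w⟩ sq
    · exact nomatch φ
    · exact nomatch φ
    · exact l'.natural_left (a := ⟨_, h, e⟩) (a' := ⟨_, h', e'⟩) ⟨ULift.down φ, ψ, w⟩ sq
  natural_right {x b b'} ψ := match x with
    | ⟨.inl a, h, e⟩ => fun sq => l.natural_right (a := ⟨a, h, e⟩) ψ sq
    | ⟨.inr a, h, e⟩ => fun sq => l'.natural_right (a := ⟨a, h, e⟩) ψ sq

end NatLift

section Generators

variable {E : Type u} [Category.{v} E] [HasPullbacks E] [HasPushouts E]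
  {c : FunctorialCylinder E} [c.cyl.IsLeftAdjoint] {C : AWFS E}
  {J : Type u₁} [Category.{v₁} J] {j : J ⥤ Arrow E}

/-- Uniform fibrations lift against the Leibniz products of the generators. -/
noncomputable def UniformFibration.natLift (c : FunctorialCylinder E) (j : J ⥤ Arrow E) :
    ∀ k : Fin 2, NatLift (j ⋙ c.leibniz k) (UniformFibration.forget c j)
  -- The restriction of `Functor.sum'` to a summand is used through its isomorphism with the given
  -- functor; lifts are moved along it as along a retract.
  | 0 => ((NatLift.ofRightMap (c.tensorGen j)).compLeft (Sum.inl_ J J)).retract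
      (Functor.inlCompSum' _ _).inv (Functor.inlCompSum' _ _).hom (Iso.inv_hom_id _)
  | 1 => ((NatLift.ofRightMap (c.tensorGen j)).compLeft (Sum.inr_ J J)).retract
      (Functor.inrCompSum' _ _).inv (Functor.inrCompSum' _ _).hom (Iso.inv_hom_id _)

/-- Uniform fibrations lift against the Leibniz products of coalgebras. -/
lemma nonempty_natLift_leibniz (hj : C.IsAlgebraicallyFree j) (k : Fin 2) :
    Nonempty (NatLift (AWFS.LCoalg.forget C ⋙ c.leibniz k) (UniformFibration.forget c j)) :=
  let adj := Adjunction.ofIsLeftAdjoint c.cyl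
  let ⟨l⟩ := AWFS.nonempty_natLift_rightMap hj
  -- Pullback exponentials of uniform fibrations are right `j`-maps. All coalgebras lift against
  -- those, and transposing back gives the claim.
  ⟨NatLift.ofExponential adj k
    (l.compRight (NatLift.toExponential adj k (UniformFibration.natLift c j k)).toRightMap)⟩

variable [HasInitial E] {Ct : AWFS E}

/-- Algebras for the awfs of uniform fibrations lift against the endpoint inclusions. -/
lemma nonempty_natLift_endpointArrow (hC : C.IsSuitable c) (hj : C.IsAlgebraicallyFree j)
    (hCt : Ct.IsAlgebraicallyFree (c.tensorGen j)) (k : Fin 2) :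
    Nonempty (NatLift (c.endpointArrow k) (AWFS.RAlg.forget Ct)) := by
  -- By (S2) `0 ⟶ X` is a coalgebra, so its Leibniz products lift against uniform fibrations, and
  -- then so do their retracts, the endpoint inclusions.
  obtain ⟨F, hF⟩ := hC.bot
  obtain ⟨l⟩ := nonempty_natLift_leibniz (c := c) hj k
  have l' := l.compLeft F
  rw [← Functor.assoc, hF] at l'
  obtain ⟨l''⟩ := AWFS.nonempty_natLift_monad hCt
    (l'.retract (c.endpointToLeibniz k) (c.leibnizToEndpoint k)
      (c.endpointToLeibniz_leibnizToEndpoint k))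
  -- So far the lifts are against monad algebras. Making the endpoint inclusions into coalgebras
  -- extends the lifts to algebras for the mere pointed endofunctor, as the Frobenius condition
  -- demands.
  exact ⟨Ct.natLift.compLeft (AWFS.toLCoalg l'')⟩

/-- Uniform fibrations lift against the base changes along algebras of the Leibniz products of
the generators. -/
lemma nonempty_natLift_baseChange_leibniz (hC : C.IsSuitable c) (hj : C.IsAlgebraicallyFree j)
    (hCt : Ct.IsAlgebraicallyFree (c.tensorGen j)) (k : Fin 2) :
    Nonempty (NatLift (baseChangeFunctor (j ⋙ c.leibniz k) (AWFS.RAlg.forget Ct))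
      (UniformFibration.forget c j)) := by
  -- The generators are coalgebras (`l₁`), their Leibniz products are so by (S4) (`l₂`), and the
  -- base changes of these by (S3) (`l₃`).
  obtain ⟨l₁⟩ := AWFS.nonempty_natLift_monad hj (NatLift.ofRightMap j)
  obtain ⟨l₂⟩ := AWFS.nonempty_natLift_of_hasLift (hC.leibniz k)
  obtain ⟨l₃⟩ := nonempty_natLift_baseChange (AWFS.toLCoalg l₁ ⋙ AWFS.toLCoalg l₂)
    (AWFS.RAlg.forget Ct) hC.pullback
  obtain ⟨l₄⟩ := nonempty_natLift_leibniz (c := c) hj k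
  obtain ⟨l₅⟩ := nonempty_natLift_endpointArrow hC hj hCt (1 - k)
  have l₆ : NatLift (baseChangeFunctor (j ⋙ c.leibniz k) (AWFS.RAlg.forget Ct) ⋙ c.leibniz k)
    (UniformFibration.forget c j) := l₄.compLeft (AWFS.toLCoalg l₃)
  -- The base change lifts because it is a retract of its Leibniz product: the connection gives the
  -- retraction before base change, and `l₅` lifts its homotopy.
  exact ⟨l₆.retract _ _ (c.leibnizUnit_baseChangeRetraction
    (ρ := (Functor.whiskerLeft j (c.connRetraction k) :
      (j ⋙ c.leibniz k) ⋙ c.leibniz k ⟶ j ⋙ c.leibniz k))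
    (fun a => c.leibnizUnit_connRetraction k (j.obj a)) l₅)⟩

/-- Uniform fibrations lift against the base changes along algebras of the generating uniform
trivial cofibrations. -/
lemma nonempty_natLift_baseChange_tensorGen (hC : C.IsSuitable c)
    (hj : C.IsAlgebraicallyFree j) (hCt : Ct.IsAlgebraicallyFree (c.tensorGen j)) :
    Nonempty (NatLift (baseChangeFunctor (c.tensorGen j) (AWFS.RAlg.forget Ct))
      (RightMap.forget (c.tensorGen j))) :=
  let ⟨l⟩ := nonempty_natLift_baseChange_leibniz hC hj hCt 0
  let ⟨l'⟩ := nonempty_natLift_baseChange_leibniz hC hj hCt 1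
  ⟨l.baseChangeSum l'⟩

end Generators

/-! ### Pushforwards -/

section PullbackMap

variable {E : Type u} [Category.{v} E] [HasPullbacks E]

/-- The map of pullbacks along `h` and `h'` induced by a map `s` and a square `β : h ⟶ h'`. -/
noncomputable def pullbackMap {h h' : Arrow E} {Z Z' : E} {z : Z ⟶ h.right} {z' : Z' ⟶ h'.right}
    (s : Z ⟶ Z') (β : h ⟶ h') (w : s ≫ z' = z ≫ β.right) :
    pullback z h.hom ⟶ pullback z' h'.hom :=
  pullback.lift (pullback.fst _ _ ≫ s) (pullback.snd _ _ ≫ β.left) (by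
    rw [Category.assoc, Category.assoc, Arrow.w, w, ← pullback.condition_assoc])

variable {h h' : Arrow E} {Z Z' : E} {z : Z ⟶ h.right} {z' : Z' ⟶ h'.right}
  (s : Z ⟶ Z') (β : h ⟶ h') (w : s ≫ z' = z ≫ β.right)

lemma pullbackMap_fst : pullbackMap s β w ≫ pullback.fst z' h'.hom = pullback.fst z h.hom ≫ s :=
  pullback.lift_fst _ _ _

lemma pullbackMap_snd :
    pullbackMap s β w ≫ pullback.snd z' h'.hom = pullback.snd z h.hom ≫ β.left :=
  pullback.lift_snd _ _ _

lemma pullbackMap_id_snd {z' : Z' ⟶ h.right} (w : s ≫ z' = z ≫ (𝟙 h : h ⟶ h).right) :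
    pullbackMap s (𝟙 h) w ≫ pullback.snd z' h.hom = pullback.snd z h.hom :=
  (pullbackMap_snd s (𝟙 h) w).trans (Category.comp_id _)

/-- Only the domain components of the squares enter a map of pullbacks, so agreement on codomains
need not be assumed. -/
lemma pullbackMap_comp_eq {h₁ h₁' h'' : Arrow E} {Z₁ Z₁' Z'' : E} {z₁ : Z₁ ⟶ h₁.right}
    {z₁' : Z₁' ⟶ h₁'.right} {z'' : Z'' ⟶ h''.right}
    {s : Z₁ ⟶ Z₁'} {β : h₁ ⟶ h₁'} {w : s ≫ z₁' = z₁ ≫ β.right}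
    {s' : Z₁' ⟶ Z''} {β' : h₁' ⟶ h''} {w' : s' ≫ z'' = z₁' ≫ β'.right}
    {Z₂ : E} {h₂ : Arrow E} {z₂ : Z₂ ⟶ h₂.right}
    {t : Z₁ ⟶ Z₂} {γ : h₁ ⟶ h₂} {y : t ≫ z₂ = z₁ ≫ γ.right}
    {t' : Z₂ ⟶ Z''} {γ' : h₂ ⟶ h''} {y' : t' ≫ z'' = z₂ ≫ γ'.right}
    (hs : s ≫ s' = t ≫ t') (hβ : β.left ≫ β'.left = γ.left ≫ γ'.left) :
    pullbackMap s β w ≫ pullbackMap s' β' w' = pullbackMap t γ y ≫ pullbackMap t' γ' y' := by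
  apply pullback.hom_ext
  · rw [Category.assoc, Category.assoc, pullbackMap_fst, pullbackMap_fst,
      reassoc_of% @pullbackMap_fst, reassoc_of% @pullbackMap_fst, hs]
  · rw [Category.assoc, Category.assoc, pullbackMap_snd, pullbackMap_snd,
      reassoc_of% @pullbackMap_snd, reassoc_of% @pullbackMap_snd, hβ]

end PullbackMap

/-- A pushforward along `h` of the base change of `f` along `m`: an object over the codomain of
`h` representing the maps over `m` from pullbacks along `h` to the domain of `f`. -/
structure Pushforward {E : Type u} [Category.{v} E] [HasPullbacks E] (h f : Arrow E)
    (m : h.left ⟶ f.right) where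
  obj : E
  proj : obj ⟶ h.right
  ev : pullback proj h.hom ⟶ f.left
  ev_hom : ev ≫ f.hom = pullback.snd proj h.hom ≫ m
  curry : ∀ {Z : E} (z : Z ⟶ h.right) (t : pullback z h.hom ⟶ f.left)
    (_ : t ≫ f.hom = pullback.snd z h.hom ≫ m), Z ⟶ obj
  curry_proj : ∀ {Z : E} (z : Z ⟶ h.right) (t : pullback z h.hom ⟶ f.left)
    (ht : t ≫ f.hom = pullback.snd z h.hom ≫ m), curry z t ht ≫ proj = z
  pullbackMap_curry : ∀ {Z : E} (z : Z ⟶ h.right) (t : pullback z h.hom ⟶ f.left)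
    (ht : t ≫ f.hom = pullback.snd z h.hom ≫ m)
    (w : curry z t ht ≫ proj = z ≫ (𝟙 h : h ⟶ h).right),
    pullbackMap (curry z t ht) (𝟙 h) w ≫ ev = t
  hom_ext : ∀ {Z : E} (z : Z ⟶ h.right) (p q : Z ⟶ obj)
    (hp : p ≫ proj = z ≫ (𝟙 h : h ⟶ h).right) (hq : q ≫ proj = z ≫ (𝟙 h : h ⟶ h).right),
    pullbackMap p (𝟙 h) hp ≫ ev = pullbackMap q (𝟙 h) hq ≫ ev → p = q

namespace Pushforward

variable {E : Type u} [Category.{v} E] [HasPullbacks E]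

section Existence

variable (h f : Arrow E) (m : h.left ⟶ f.right)

lemma over_pullback_lift {Z : E} {z : Z ⟶ h.right} (t : pullback z h.hom ⟶ f.left)
    (ht : t ≫ f.hom = pullback.snd z h.hom ≫ m) :
    pullback.lift t (pullback.snd z h.hom) ht ≫ pullback.snd f.hom m = pullback.snd z h.hom :=
  pullback.lift_snd _ _ _

/-- Pushforwards exist in a locally cartesian closed category. -/
lemma nonempty [IsLocallyCartesianClosed E] : Nonempty (Pushforward h f m) := by
  have := IsLocallyCartesianClosed.isLeftAdjoint_pullback h.hom
  let adj := Adjunction.ofIsLeftAdjoint (Over.pullback h.hom)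
  -- The right adjoint of pullback along `h` is applied to the base change of `f` along `m`; a map
  -- over `h.left` into that base change is a map to the domain of `f` lying over `m`.
  let Y : Over h.left := Over.mk (pullback.snd f.hom m)
  let P : Over h.right := (Over.pullback h.hom).rightAdjoint.obj Y
  let ε : (Over.pullback h.hom).obj P ⟶ Y := adj.counit.app Y
  -- Transposing a map back amounts to pulling it back along `h` and applying the counit.
  have key : ∀ {Z : E} (z : Z ⟶ h.right) (p : Over.mk z ⟶ P)
      (w : p.left ≫ P.hom = z ≫ (𝟙 h : h ⟶ h).right),
      ((adj.homEquiv (Over.mk z) Y).symm p).left ≫ pullback.fst f.hom m =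
        pullbackMap p.left (𝟙 h) w ≫ ε.left ≫ pullback.fst f.hom m := by
    intro Z z p w
    have hp : ((Over.pullback h.hom).map p).left = pullbackMap p.left (𝟙 h) w := by
      apply pullback.hom_ext
      · exact (pullback.lift_fst _ _ _).trans (pullbackMap_fst _ _ _).symm
      · exact (pullback.lift_snd _ _ _).trans (pullbackMap_id_snd _ _).symm
    rw [adj.homEquiv_counit, Over.comp_left, hp]
    exact Category.assoc _ _ _
  refine ⟨⟨P.left, P.hom, ε.left ≫ pullback.fst f.hom m, ?_,
    fun z t ht => ((adj.homEquiv (Over.mk z) Y) (Over.homMk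
      (pullback.lift t (pullback.snd z h.hom) ht) (over_pullback_lift h f m t ht))).left,
    fun z t ht => Over.w _, ?_, ?_⟩⟩
  · rw [Category.assoc, pullback.condition]
    exact (Category.assoc _ _ _).symm.trans (congrArg (· ≫ m) (Over.w ε))
  · intro Z z t ht w
    rw [← key z _ w, Equiv.symm_apply_apply]
    exact pullback.lift_fst _ _ _
  · intro Z z p q hp hq hpq
    let p' : Over.mk z ⟶ P := Over.homMk p (hp.trans (Category.comp_id _))
    let q' : Over.mk z ⟶ P := Over.homMk q (hq.trans (Category.comp_id _))
    suffices p' = q' from congrArg CommaMorphism.left this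
    refine (adj.homEquiv (Over.mk z) Y).symm.injective (Over.OverMorphism.ext ?_)
    -- The first projections agree by `key`; the second ones are forced, both maps being over
    -- `h.left`.
    apply pullback.hom_ext
    · exact (key z p' hp).trans (hpq.trans (key z q' hq).symm)
    · exact (Over.w ((adj.homEquiv (Over.mk z) Y).symm p')).trans
        (Over.w ((adj.homEquiv (Over.mk z) Y).symm q')).symm

end Existence

variable {h f : Arrow E} {m : h.left ⟶ f.right} (P : Pushforward h f m)

/-- The map corresponding to a map to the pushforward. -/
noncomputable def uncurry {Z : E} (z : Z ⟶ h.right) (p : Z ⟶ P.obj) (hp : p ≫ P.proj = z) :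
    pullback z h.hom ⟶ f.left :=
  pullbackMap p (𝟙 h) (hp.trans (Category.comp_id _).symm) ≫ P.ev

lemma uncurry_curry {Z : E} (z : Z ⟶ h.right) (t : pullback z h.hom ⟶ f.left)
    (ht : t ≫ f.hom = pullback.snd z h.hom ≫ m) :
    P.uncurry z (P.curry z t ht) (P.curry_proj z t ht) = t :=
  P.pullbackMap_curry z t ht _

/-- The working principle below: an identity of maps into a pushforward is checked after uncurrying,
where fillers become fillers for base changes. -/
lemma eq_of_uncurry_eq {Z : E} (z : Z ⟶ h.right) (p q : Z ⟶ P.obj) (hp : p ≫ P.proj = z)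
    (hq : q ≫ P.proj = z) (hpq : P.uncurry z p hp = P.uncurry z q hq) : p = q :=
  P.hom_ext z p q _ _ hpq

lemma uncurry_hom {Z : E} (z : Z ⟶ h.right) (p : Z ⟶ P.obj) (hp : p ≫ P.proj = z) :
    P.uncurry z p hp ≫ f.hom = pullback.snd z h.hom ≫ m := by
  rw [uncurry, Category.assoc, P.ev_hom, ← Category.assoc, pullbackMap_id_snd]

lemma uncurry_comp {Z Z' : E} (z : Z ⟶ h.right) (z' : Z' ⟶ h.right) (s : Z ⟶ Z')
    (p : Z' ⟶ P.obj) (hp : p ≫ P.proj = z') (hs : (s ≫ p) ≫ P.proj = z)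
    (w : s ≫ z' = z ≫ (𝟙 h : h ⟶ h).right) :
    P.uncurry z (s ≫ p) hs = pullbackMap s (𝟙 h) w ≫ P.uncurry z' p hp := by
  rw [uncurry, uncurry, ← Category.assoc]
  congr 1
  apply pullback.hom_ext
  · rw [Category.assoc, pullbackMap_fst, pullbackMap_fst, reassoc_of% @pullbackMap_fst]
  · rw [Category.assoc, pullbackMap_id_snd, pullbackMap_id_snd, pullbackMap_id_snd]

lemma uncurry_congr {Z : E} {z : Z ⟶ h.right} {p q : Z ⟶ P.obj} (hp : p ≫ P.proj = z)
    (hpq : p = q) : P.uncurry z p hp = P.uncurry z q (hpq ▸ hp) := by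
  subst hpq
  rfl

end Pushforward

/-! ### Pushforwards of right maps -/

namespace Pushforward

variable {E : Type u} [Category.{v} E] [HasPullbacks E] {A : Type u₁} [Category.{v₁} A]
  {B : Type u₂} [Category.{v₂} B] {U : A ⥤ Arrow E} {H : B ⥤ Arrow E}
  (l : NatLift (baseChangeFunctor U H) (RightMap.forget U))

section Lift

variable {b : B} {r : RightMap U} {m : (H.obj b).left ⟶ r.arrow.right} {a : A}
  (e : (U.obj a).right ⟶ (H.obj b).right)
  (t : pullback ((U.obj a).hom ≫ e) (H.obj b).hom ⟶ r.arrow.left)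
  (ht : t ≫ r.arrow.hom = pullback.snd ((U.obj a).hom ≫ e) (H.obj b).hom ≫ m)

/-- The square from a base change to a right map. -/
noncomputable def baseChangeSquare :
    (baseChangeFunctor U H).obj ⟨a, b, e⟩ ⟶ (RightMap.forget U).obj r :=
  Arrow.homMk (f := Arrow.mk (baseChangeHom (U.obj a) (H.obj b) e)) (g := r.arrow) t
    (pullback.snd e (H.obj b).hom ≫ m)
    (ht.trans ((congrArg (· ≫ m) (baseChangeHom_snd _ _ _)).symm.trans (Category.assoc _ _ _)))

/-- The filler of a square from a base change to a right map. -/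
noncomputable def baseChangeFill : pullback e (H.obj b).hom ⟶ r.arrow.left :=
  l.fill (baseChangeSquare e t ht)

lemma baseChangeHom_baseChangeFill :
    baseChangeHom (U.obj a) (H.obj b) e ≫ baseChangeFill l e t ht = t :=
  l.hom_fill (baseChangeSquare e t ht)

lemma baseChangeFill_hom :
    baseChangeFill l e t ht ≫ r.arrow.hom = pullback.snd e (H.obj b).hom ≫ m :=
  l.fill_hom (baseChangeSquare e t ht)

/-- Naturality in both variables at once. It is used with `β` an identity, for naturality of fillers
of one pushforward, and with `σ` an identity, to compare pushforwards along different arrows. -/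
lemma baseChangeFill_natural_left {a' : A} {b' : B} (σ : a ⟶ a') (β : b ⟶ b')
    {e' : (U.obj a').right ⟶ (H.obj b').right} {m' : (H.obj b').left ⟶ r.arrow.right}
    (t' : pullback ((U.obj a').hom ≫ e') (H.obj b').hom ⟶ r.arrow.left)
    (ht' : t' ≫ r.arrow.hom = pullback.snd ((U.obj a').hom ≫ e') (H.obj b').hom ≫ m')
    (w : (U.map σ).right ≫ e' = e ≫ (H.map β).right)
    (w' : (U.map σ).left ≫ (U.obj a').hom ≫ e' = ((U.obj a).hom ≫ e) ≫ (H.map β).right)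
    (hm : (H.map β).left ≫ m' = m)
    (htt' : t = pullbackMap (U.map σ).left (H.map β) w' ≫ t') :
    baseChangeFill l e t ht =
      pullbackMap (U.map σ).right (H.map β) w ≫ baseChangeFill l e' t' ht' := by
  let φ : (⟨a, b, e⟩ : Cospan U H) ⟶ ⟨a', b', e'⟩ := ⟨σ, β, w⟩
  refine Eq.trans ?_ (l.natural_left φ (baseChangeSquare e' t' ht'))
  unfold baseChangeFill
  congr 1
  apply Arrow.hom_ext
  · exact htt'
  · change pullback.snd e (H.obj b).hom ≫ m =
      pullbackMap (U.map σ).right (H.map β) w ≫ pullback.snd e' (H.obj b').hom ≫ m'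
    rw [← Category.assoc, pullbackMap_snd, Category.assoc, hm]

lemma baseChangeFill_natural_right {r' : RightMap U} (ψ : r ⟶ r')
    {m' : (H.obj b).left ⟶ r'.arrow.right}
    (t' : pullback ((U.obj a).hom ≫ e) (H.obj b).hom ⟶ r'.arrow.left)
    (ht' : t' ≫ r'.arrow.hom = pullback.snd ((U.obj a).hom ≫ e) (H.obj b).hom ≫ m')
    (hm : m ≫ ψ.hom.right = m') (htt' : t' = t ≫ ψ.hom.left) :
    baseChangeFill l e t' ht' = baseChangeFill l e t ht ≫ ψ.hom.left := by
  subst hm htt'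
  refine Eq.trans ?_ (l.natural_right ψ (baseChangeSquare e t ht))
  unfold baseChangeFill
  congr 1
  exact Arrow.hom_ext _ _ rfl (Category.assoc _ _ _).symm

end Lift

section RightMap

variable {b : B} {r : RightMap U} {m : (H.obj b).left ⟶ r.arrow.right}
  (P : Pushforward (H.obj b) r.arrow m)

/-- The filler of a square to a pushforward. -/
noncomputable def fill {a : A} (e : (U.obj a).right ⟶ (H.obj b).right)
    (t : (U.obj a).left ⟶ P.obj) (ht : t ≫ P.proj = (U.obj a).hom ≫ e) :
    (U.obj a).right ⟶ P.obj :=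
  P.curry e (baseChangeFill l e (P.uncurry _ t ht) (P.uncurry_hom _ t ht))
    (baseChangeFill_hom l _ _ _)

lemma fill_proj {a : A} (e : (U.obj a).right ⟶ (H.obj b).right)
    (t : (U.obj a).left ⟶ P.obj) (ht : t ≫ P.proj = (U.obj a).hom ≫ e) :
    P.fill l e t ht ≫ P.proj = e :=
  P.curry_proj _ _ _

lemma uncurry_fill {a : A} (e : (U.obj a).right ⟶ (H.obj b).right)
    (t : (U.obj a).left ⟶ P.obj) (ht : t ≫ P.proj = (U.obj a).hom ≫ e) :
    P.uncurry e (P.fill l e t ht) (P.fill_proj l e t ht) =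
      baseChangeFill l e (P.uncurry _ t ht) (P.uncurry_hom _ t ht) :=
  P.uncurry_curry _ _ _

lemma pullbackMap_eq_baseChangeHom (g h : Arrow E) (e : g.right ⟶ h.right)
    (w : g.hom ≫ e = (g.hom ≫ e) ≫ (𝟙 h : h ⟶ h).right) :
    pullbackMap g.hom (𝟙 h) w = baseChangeHom g h e := by
  apply pullback.hom_ext
  · rw [pullbackMap_fst, baseChangeHom_fst]
  · rw [pullbackMap_id_snd, baseChangeHom_snd]

/-- After uncurrying, precomposition with `(U.obj a).hom` becomes precomposition with its base
change, so the upper triangle is that of `baseChangeFill`. -/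
lemma hom_fill {a : A} (e : (U.obj a).right ⟶ (H.obj b).right)
    (t : (U.obj a).left ⟶ P.obj) (ht : t ≫ P.proj = (U.obj a).hom ≫ e) :
    (U.obj a).hom ≫ P.fill l e t ht = t := by
  refine P.eq_of_uncurry_eq ((U.obj a).hom ≫ e) _ _
    (by rw [Category.assoc, fill_proj]) ht ?_
  rw [P.uncurry_comp _ e _ _ (P.fill_proj l e t ht) _ (Category.comp_id _).symm, uncurry_fill]
  exact (congrArg (· ≫ _) (pullbackMap_eq_baseChangeHom _ _ e _)).trans
    (baseChangeHom_baseChangeFill _ _ _ _)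

lemma fill_natural {a a' : A} (σ : a ⟶ a') (e : (U.obj a').right ⟶ (H.obj b).right)
    (t : (U.obj a').left ⟶ P.obj) (ht : t ≫ P.proj = (U.obj a').hom ≫ e)
    (ht' : ((U.map σ).left ≫ t) ≫ P.proj = (U.obj a).hom ≫ (U.map σ).right ≫ e) :
    P.fill l ((U.map σ).right ≫ e) ((U.map σ).left ≫ t) ht' =
      (U.map σ).right ≫ P.fill l e t ht := by
  -- `H` preserves identities only propositionally, so each use of the naturality lemma at `𝟙 b` is
  -- corrected by this equation.
  have hid : H.map (𝟙 b) = 𝟙 _ := H.map_id b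
  refine P.eq_of_uncurry_eq ((U.map σ).right ≫ e) _ _ (fill_proj _ _ _ _ _)
    (by rw [Category.assoc, fill_proj]) ?_
  rw [P.uncurry_comp _ e _ _ (P.fill_proj l e t ht) _ (Category.comp_id _).symm, uncurry_fill,
    uncurry_fill, baseChangeFill_natural_left l _ _ _ σ (𝟙 b) _ (P.uncurry_hom _ t ht)
      (by rw [hid]; exact (Category.comp_id _).symm)
      (by rw [hid, ← Arrow.w_assoc]; exact (Category.comp_id _).symm)
      (by rw [hid]; exact Category.id_comp _)]
  · congr 1
    congr 1
  · rw [P.uncurry_comp _ ((U.obj a').hom ≫ e) _ _ ht _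
      (by rw [← Arrow.w_assoc]; exact (Category.comp_id _).symm)]
    congr 1
    congr 1
    exact hid.symm

/-- A pushforward of a right map is a right map. -/
noncomputable def rightMap : RightMap U where
  arrow := Arrow.mk P.proj
  fill _ sq := P.fill l sq.right sq.left (Arrow.w sq)
  hom_fill _ sq := P.hom_fill l sq.right sq.left (Arrow.w sq)
  fill_hom _ sq := P.fill_proj l sq.right sq.left (Arrow.w sq)
  fill_natural σ sq := P.fill_natural l σ sq.right sq.left (Arrow.w sq)
    (Arrow.w (U.map σ ≫ sq))

end RightMap

end Pushforward

/-! ### Functoriality of pushforwards in the right map -/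

namespace Pushforward

variable {E : Type u} [Category.{v} E] [HasPullbacks E] {A : Type u₁} [Category.{v₁} A]
  {B : Type u₂} [Category.{v₂} B] {U : A ⥤ Arrow E} {H : B ⥤ Arrow E}
  (l : NatLift (baseChangeFunctor U H) (RightMap.forget U))

section Maps

/-- Changing the right map being pushed forward. -/
noncomputable def mapRight {b : B} {r r' : RightMap U} (ψ : r ⟶ r')
    {m : (H.obj b).left ⟶ r.arrow.right} {m' : (H.obj b).left ⟶ r'.arrow.right}
    (hm : m ≫ ψ.hom.right = m') (P : Pushforward (H.obj b) r.arrow m)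
    (P' : Pushforward (H.obj b) r'.arrow m') : P.obj ⟶ P'.obj :=
  P'.curry P.proj (P.ev ≫ ψ.hom.left) (by
    rw [Category.assoc, Arrow.w, ← Category.assoc, P.ev_hom, Category.assoc, hm])

section

variable {b : B} {r r' : RightMap U} (ψ : r ⟶ r')
  {m : (H.obj b).left ⟶ r.arrow.right} {m' : (H.obj b).left ⟶ r'.arrow.right}
  (hm : m ≫ ψ.hom.right = m') (P : Pushforward (H.obj b) r.arrow m)
  (P' : Pushforward (H.obj b) r'.arrow m')

lemma mapRight_proj : mapRight ψ hm P P' ≫ P'.proj = P.proj :=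
  P'.curry_proj _ _ _

lemma uncurry_mapRight {Z : E} (z : Z ⟶ (H.obj b).right) (p : Z ⟶ P.obj)
    (hp : p ≫ P.proj = z) :
    P'.uncurry z (p ≫ mapRight ψ hm P P') (by rw [Category.assoc, mapRight_proj, hp]) =
      P.uncurry z p hp ≫ ψ.hom.left := by
  rw [P'.uncurry_comp z P.proj p (mapRight ψ hm P P') (mapRight_proj ψ hm P P') _
    (hp.trans (Category.comp_id _).symm)]
  refine (congrArg (_ ≫ ·) (P'.uncurry_curry _ _ _)).trans ?_
  exact (Category.assoc _ _ _).symm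

/-- Uncurrying turns `mapRight` into composition with `ψ`, so this is naturality of `l` on the
right. The bottom maps `e` and `e'` are kept apart because composing a square with `rightMapMap`
adds an identity to its bottom. -/
lemma fill_mapRight {a : A} (e e' : (U.obj a).right ⟶ (H.obj b).right) (he : e = e')
    (t : (U.obj a).left ⟶ P.obj) (ht : t ≫ P.proj = (U.obj a).hom ≫ e)
    (ht' : (t ≫ mapRight ψ hm P P') ≫ P'.proj = (U.obj a).hom ≫ e') :
    P.fill l e t ht ≫ mapRight ψ hm P P' = P'.fill l e' (t ≫ mapRight ψ hm P P') ht' := by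
  subst he
  refine P'.eq_of_uncurry_eq e _ _
    (by rw [Category.assoc, mapRight_proj, fill_proj]) (fill_proj _ _ _ _ _) ?_
  rw [uncurry_mapRight ψ hm P P' e _ (P.fill_proj l e t ht), uncurry_fill, uncurry_fill]
  exact (baseChangeFill_natural_right l e _ _ ψ _ _ hm
    (uncurry_mapRight ψ hm P P' _ t ht)).symm

/-- The morphism of pushforwards induced by a morphism of right maps. -/
noncomputable def rightMapMap : P.rightMap l ⟶ P'.rightMap l :=
  { hom := Arrow.homMk (f := Arrow.mk P.proj) (g := Arrow.mk P'.proj) (mapRight ψ hm P P') (𝟙 _)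
      ((mapRight_proj ψ hm P P').trans (Category.comp_id _).symm)
    fill_comp := fun _ sq => fill_mapRight l ψ hm P P' sq.right _ (Category.comp_id _).symm
      sq.left (Arrow.w sq) _ }

end

end Maps

/-! ### Fillers for base changes, transposed from fillers against pushforwards -/

section Transfer

variable {G : Type u₃} [Category.{v₃} G] {T : G ⥤ Arrow E} (W : NatLift T (RightMap.forget U))

section

variable {b : B} {r : RightMap U} {m : (H.obj b).left ⟶ r.arrow.right}
  (P : Pushforward (H.obj b) r.arrow m) {γ : G} (e : (T.obj γ).right ⟶ (H.obj b).right)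
  (t : pullback ((T.obj γ).hom ≫ e) (H.obj b).hom ⟶ r.arrow.left)
  (ht : t ≫ r.arrow.hom = pullback.snd ((T.obj γ).hom ≫ e) (H.obj b).hom ≫ m)

/-- The square to a pushforward corresponding to a square from a base change. -/
noncomputable def curriedSquare : T.obj γ ⟶ (P.rightMap l).arrow :=
  Arrow.homMk (g := Arrow.mk P.proj) (P.curry ((T.obj γ).hom ≫ e) t ht) e (P.curry_proj _ _ _)

/-- The filler of the square to a pushforward corresponding to a square from a base change. -/
noncomputable def transposedFill : (T.obj γ).right ⟶ P.obj :=
  W.fill (b := P.rightMap l) (curriedSquare l P e t ht)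

lemma hom_transposedFill : (T.obj γ).hom ≫ transposedFill l W P e t ht =
    P.curry ((T.obj γ).hom ≫ e) t ht :=
  W.hom_fill (b := P.rightMap l) (curriedSquare l P e t ht)

lemma transposedFill_proj : transposedFill l W P e t ht ≫ P.proj = e :=
  W.fill_hom (b := P.rightMap l) (curriedSquare l P e t ht)

/-- The filler of a square from a base change obtained by transposition. -/
noncomputable def transferFill : pullback e (H.obj b).hom ⟶ r.arrow.left :=
  P.uncurry e (transposedFill l W P e t ht) (transposedFill_proj l W P e t ht)

lemma baseChangeHom_transferFill :
    baseChangeHom (T.obj γ) (H.obj b) e ≫ transferFill l W P e t ht = t := by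
  have h := P.uncurry_comp ((T.obj γ).hom ≫ e) e (T.obj γ).hom _
    (transposedFill_proj l W P e t ht) (by rw [Category.assoc, transposedFill_proj])
    (Category.comp_id _).symm
  refine Eq.trans (congrArg (· ≫ _) (pullbackMap_eq_baseChangeHom (T.obj γ) (H.obj b) e
    (Category.comp_id _).symm)).symm (h.symm.trans (Eq.trans ?_
      (P.uncurry_curry ((T.obj γ).hom ≫ e) t ht)))
  congr 1
  exact hom_transposedFill l W P e t ht

lemma transferFill_hom : transferFill l W P e t ht ≫ r.arrow.hom =
    pullback.snd e (H.obj b).hom ≫ m :=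
  P.uncurry_hom _ _ _

lemma transposedFill_natural_left {γ' : G} (α : γ ⟶ γ') (e' : (T.obj γ').right ⟶ (H.obj b).right)
    (t' : pullback ((T.obj γ').hom ≫ e') (H.obj b).hom ⟶ r.arrow.left)
    (ht' : t' ≫ r.arrow.hom = pullback.snd ((T.obj γ').hom ≫ e') (H.obj b).hom ≫ m)
    (w : (T.map α).right ≫ e' = e)
    (w' : (T.map α).left ≫ (T.obj γ').hom ≫ e' =
      ((T.obj γ).hom ≫ e) ≫ (𝟙 (H.obj b) : H.obj b ⟶ H.obj b).right)
    (htt' : t = pullbackMap (T.map α).left (𝟙 _) w' ≫ t') :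
    transposedFill l W P e t ht = (T.map α).right ≫ transposedFill l W P e' t' ht' := by
  refine Eq.trans ?_ (W.natural_left (b := P.rightMap l) α (curriedSquare l P e' t' ht'))
  unfold transposedFill
  congr 1
  subst w
  refine Arrow.hom_ext _ _ ?_ rfl
  have hp : ((T.map α).left ≫ P.curry ((T.obj γ').hom ≫ e') t' ht') ≫ P.proj =
      (T.obj γ).hom ≫ (T.map α).right ≫ e' := by
    rw [Category.assoc, P.curry_proj, Arrow.w_assoc]
  refine P.eq_of_uncurry_eq ((T.obj γ).hom ≫ (T.map α).right ≫ e') _ _ (P.curry_proj _ _ _) hp ?_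
  refine (P.uncurry_curry _ _ _).trans (htt'.trans ?_)
  refine Eq.trans ?_ (P.uncurry_comp _ _ _ _ (P.curry_proj _ t' ht') hp w').symm
  rw [P.uncurry_curry]

lemma transferFill_natural_left {γ' : G} (α : γ ⟶ γ') (e' : (T.obj γ').right ⟶ (H.obj b).right)
    (t' : pullback ((T.obj γ').hom ≫ e') (H.obj b).hom ⟶ r.arrow.left)
    (ht' : t' ≫ r.arrow.hom = pullback.snd ((T.obj γ').hom ≫ e') (H.obj b).hom ≫ m)
    (w : (T.map α).right ≫ e' = e ≫ (𝟙 (H.obj b) : H.obj b ⟶ H.obj b).right)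
    (w' : (T.map α).left ≫ (T.obj γ').hom ≫ e' =
      ((T.obj γ).hom ≫ e) ≫ (𝟙 (H.obj b) : H.obj b ⟶ H.obj b).right)
    (htt' : t = pullbackMap (T.map α).left (𝟙 _) w' ≫ t') :
    transferFill l W P e t ht =
      pullbackMap (T.map α).right (𝟙 _) w ≫ transferFill l W P e' t' ht' := by
  have h := transposedFill_natural_left l W P e t ht α e' t' ht' (w.trans (Category.comp_id _))
    w' htt'
  refine Eq.trans ?_ (P.uncurry_comp e e' (T.map α).right _ (transposedFill_proj l W P e' t' ht')
    (by rw [← h, transposedFill_proj]) w)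
  unfold transferFill
  congr 1

/-- `mapRight` is a morphism of right maps, so `W` is natural along it; this does not depend on
which pushforwards were chosen. -/
lemma transferFill_natural_right {r' : RightMap U} (ψ : r ⟶ r')
    {m' : (H.obj b).left ⟶ r'.arrow.right} (hm : m ≫ ψ.hom.right = m')
    (P' : Pushforward (H.obj b) r'.arrow m')
    (t' : pullback ((T.obj γ).hom ≫ e) (H.obj b).hom ⟶ r'.arrow.left)
    (ht' : t' ≫ r'.arrow.hom = pullback.snd ((T.obj γ).hom ≫ e) (H.obj b).hom ≫ m')
    (htt' : t' = t ≫ ψ.hom.left) :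
    transferFill l W P' e t' ht' = transferFill l W P e t ht ≫ ψ.hom.left := by
  have h : transposedFill l W P' e t' ht' = transposedFill l W P e t ht ≫ mapRight ψ hm P P' := by
    refine Eq.trans ?_ (W.natural_right (rightMapMap l ψ hm P P') (curriedSquare l P e t ht))
    unfold transposedFill
    congr 1
    refine Arrow.hom_ext _ _ ?_ (Category.comp_id _).symm
    refine P'.eq_of_uncurry_eq ((T.obj γ).hom ≫ e) _ _ (P'.curry_proj _ _ _)
      (by exact (Category.assoc _ _ _).trans ((congrArg _ (mapRight_proj ψ hm P P')).trans
        (P.curry_proj _ t ht))) ?_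
    refine (P'.uncurry_curry _ t' ht').trans (htt'.trans ?_)
    refine Eq.trans ?_ (uncurry_mapRight ψ hm P P' _ _ (P.curry_proj _ t ht)).symm
    rw [P.uncurry_curry]
  refine Eq.trans ?_ (uncurry_mapRight ψ hm P P' e _ (transposedFill_proj l W P e t ht))
  unfold transferFill
  congr 1

end

end Transfer

end Pushforward

/-! ### Pullbacks of right maps -/

namespace RightMap

variable {E : Type u} [Category.{v} E] [HasPullbacks E] {A : Type u₁} [Category.{v₁} A]
  {U : A ⥤ Arrow E} (r : RightMap U) {X : E} (g : X ⟶ r.arrow.right)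

/-- The square from the pullback of an arrow. -/
noncomputable def pullbackSquare : Arrow.mk (pullback.snd r.arrow.hom g) ⟶ r.arrow :=
  Arrow.homMk (f := Arrow.mk (pullback.snd r.arrow.hom g)) (pullback.fst r.arrow.hom g) g
    pullback.condition

lemma pullback_fill_w {a : A} (sq : U.obj a ⟶ Arrow.mk (pullback.snd r.arrow.hom g)) :
    r.fill a (sq ≫ pullbackSquare r g) ≫ r.arrow.hom = sq.right ≫ g :=
  r.fill_hom a _

/-- Right maps are stable under pullback. -/
noncomputable def pullback : RightMap U where
  arrow := Arrow.mk (pullback.snd r.arrow.hom g)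
  -- With fillers induced from those of `r`, the projection to `r` is a morphism of right maps.
  fill a sq := pullback.lift (r.fill a (sq ≫ pullbackSquare r g)) sq.right (pullback_fill_w r g sq)
  hom_fill a sq := by
    apply pullback.hom_ext
    · exact (Category.assoc _ _ _).trans ((congrArg _ (pullback.lift_fst _ _ _)).trans
        (r.hom_fill a _))
    · exact (Category.assoc _ _ _).trans ((congrArg _ (pullback.lift_snd _ _ _)).trans
        (Arrow.w sq).symm)
  fill_hom _ _ := pullback.lift_snd _ _ _
  fill_natural σ sq := by
    apply pullback.hom_ext
    · refine (pullback.lift_fst _ _ _).trans (Eq.trans ?_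
        ((Category.assoc _ _ _).trans (congrArg _ (pullback.lift_fst _ _ _))).symm)
      rw [Category.assoc]
      exact r.fill_natural σ _
    · exact (pullback.lift_snd _ _ _).trans
        ((Category.assoc _ _ _).trans (congrArg _ (pullback.lift_snd _ _ _))).symm

/-- The projection from the pullback of a right map. -/
noncomputable def pullbackProj : r.pullback g ⟶ r :=
  { hom := pullbackSquare r g
    fill_comp := fun _ _ => pullback.lift_fst _ _ _ }

end RightMap

/-! ### Comparison of pushforwards along different arrows -/

namespace Pushforward

variable {E : Type u} [Category.{v} E] [HasPullbacks E] {A : Type u₁} [Category.{v₁} A]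
  {B : Type u₂} [Category.{v₂} B] {U : A ⥤ Arrow E} {H : B ⥤ Arrow E}
  (l : NatLift (baseChangeFunctor U H) (RightMap.forget U))

section Comparison

variable {h h' f : Arrow E} {m : h.left ⟶ f.right} {m' : h'.left ⟶ f.right} (β : h ⟶ h')
  (P : Pushforward h f m) (P' : Pushforward h' f m')

lemma pullbackMap_id_uncurry_hom (hm : β.left ≫ m' = m) {Z : E} (z : Z ⟶ h.right) (q : Z ⟶ P'.obj)
    (hq : q ≫ P'.proj = z ≫ β.right) (w : 𝟙 Z ≫ z ≫ β.right = z ≫ β.right) :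
    (pullbackMap (𝟙 Z) β w ≫ P'.uncurry (z ≫ β.right) q hq) ≫ f.hom =
      pullback.snd z h.hom ≫ m := by
  rw [Category.assoc, uncurry_hom, ← Category.assoc, pullbackMap_snd, Category.assoc, hm]

variable (hm : β.left ≫ m' = m)

/-- The comparison from a pullback of a pushforward. -/
noncomputable def comparison : Limits.pullback P'.proj β.right ⟶ P.obj :=
  P.curry (pullback.snd P'.proj β.right)
    (pullbackMap (𝟙 _) β (Category.id_comp _) ≫
      P'.uncurry _ (pullback.fst P'.proj β.right) pullback.condition)
    (pullbackMap_id_uncurry_hom β P' hm _ _ _ _)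

lemma comparison_proj : comparison β P P' hm ≫ P.proj = pullback.snd P'.proj β.right :=
  P.curry_proj _ _ _

/-- Characterizes the comparison by what it does upstairs: restrict along the square `β`. It need
not be invertible, since `β` need not be a pullback square. -/
lemma uncurry_comparison {Z : E} (z : Z ⟶ h.right) {z' : Z ⟶ h'.right}
    (hz : z' = z ≫ β.right) (p : Z ⟶ Limits.pullback P'.proj β.right)
    (hp : p ≫ pullback.snd P'.proj β.right = z)
    (hq : (p ≫ pullback.fst P'.proj β.right) ≫ P'.proj = z')
    (hχ : (p ≫ comparison β P P' hm) ≫ P.proj = z) (w : 𝟙 Z ≫ z' = z ≫ β.right) :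
    P.uncurry z (p ≫ comparison β P P' hm) hχ =
      pullbackMap (𝟙 Z) β w ≫ P'.uncurry z' (p ≫ pullback.fst P'.proj β.right) hq := by
  subst hz
  rw [P.uncurry_comp z _ p _ (comparison_proj β P P' hm) hχ (hp.trans (Category.comp_id _).symm),
    P'.uncurry_comp (z ≫ β.right) (pullback.snd P'.proj β.right ≫ β.right) p _ pullback.condition _
      (by rw [← Category.assoc, hp]; exact (Category.comp_id _).symm)]
  refine (congrArg _ (P.uncurry_curry _ _ _)).trans ?_
  rw [← Category.assoc, ← Category.assoc]
  congr 1
  apply pullbackMap_comp_eq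
  · rw [Category.comp_id, Category.id_comp]
  · exact (Category.id_comp _).trans (Category.comp_id _).symm

end Comparison

section

variable {b b' : B} (β : b ⟶ b') {r : RightMap U} {m : (H.obj b).left ⟶ r.arrow.right}
  {m' : (H.obj b').left ⟶ r.arrow.right} (hm : (H.map β).left ≫ m' = m)
  (P : Pushforward (H.obj b) r.arrow m) (P' : Pushforward (H.obj b') r.arrow m')

/-- The comparison preserves fillers because `l` is natural in `b`: after uncurrying, both sides are
fillers for base changes related by `β`. -/
lemma lift_fill_comparison {a : A} (e e₁ : (U.obj a).right ⟶ (H.obj b).right) (he : e = e₁)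
    (p : (U.obj a).left ⟶ Limits.pullback P'.proj (H.map β).right)
    (hp : p ≫ pullback.snd P'.proj (H.map β).right = (U.obj a).hom ≫ e)
    (hq : (p ≫ pullback.fst P'.proj (H.map β).right) ≫ P'.proj =
      (U.obj a).hom ≫ e ≫ (H.map β).right)
    (hχ : (p ≫ comparison (H.map β) P P' hm) ≫ P.proj = (U.obj a).hom ≫ e₁) :
    pullback.lift (P'.fill l (e ≫ (H.map β).right) (p ≫ pullback.fst P'.proj (H.map β).right) hq)
        e (fill_proj _ _ _ _ _) ≫ comparison (H.map β) P P' hm =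
      P.fill l e₁ (p ≫ comparison (H.map β) P P' hm) hχ := by
  subst he
  refine P.eq_of_uncurry_eq e _ _
    (by rw [Category.assoc, comparison_proj, pullback.lift_snd]) (fill_proj _ _ _ _ _) ?_
  rw [uncurry_comparison (H.map β) P P' hm e rfl _ (pullback.lift_snd _ _ _)
    (by rw [pullback.lift_fst, fill_proj]) _ (Category.id_comp _), uncurry_fill]
  have hid : U.map (𝟙 a) = 𝟙 _ := U.map_id a
  rw [baseChangeFill_natural_left l e _ _ (𝟙 a) β
    (P'.uncurry _ (p ≫ pullback.fst P'.proj (H.map β).right) hq) (P'.uncurry_hom _ _ _)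
    (by rw [hid]; exact Category.id_comp _)
    (by rw [hid]; exact (Category.id_comp _).trans (Category.assoc _ _ _).symm) hm]
  · have hfill : P'.uncurry _ (pullback.lift (P'.fill l (e ≫ (H.map β).right) _ hq) e
        (fill_proj _ _ _ _ _) ≫ pullback.fst P'.proj (H.map β).right)
        (by rw [pullback.lift_fst, fill_proj]) = baseChangeFill l (e ≫ (H.map β).right) _ _ :=
      (P'.uncurry_congr _ (pullback.lift_fst _ _ _)).trans (P'.uncurry_fill l _ _ hq)
    rw [hfill]
    congr 1
    congr 1
    exact (congrArg Arrow.Hom.right hid).symm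
  · rw [uncurry_comparison (H.map β) P P' hm _ (Category.assoc _ _ _).symm p hp hq _
      ((Category.id_comp _).trans (Category.assoc _ _ _).symm)]
    congr 1
    congr 1
    exact (congrArg Arrow.Hom.left hid).symm

/-- The comparison from a pullback of a pushforward, as a morphism of right maps. -/
noncomputable def comparisonMap :
    (P'.rightMap l).pullback (X := (H.obj b).right) (H.map β).right ⟶ P.rightMap l :=
  { hom := Arrow.homMk (f := Arrow.mk (pullback.snd P'.proj (H.map β).right))
      (g := Arrow.mk P.proj) (comparison (H.map β) P P' hm) (𝟙 _)
      ((comparison_proj (H.map β) P P' hm).trans (Category.comp_id _).symm)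
    fill_comp := fun _ sq => lift_fill_comparison l β hm P P' sq.right _ (Category.comp_id _).symm
      sq.left (Arrow.w sq) _ _ }

end

section Transfer

variable {G : Type u₃} [Category.{v₃} G] {T : G ⥤ Arrow E} (W : NatLift T (RightMap.forget U))
  {b b' : B} (β : b ⟶ b') {r : RightMap U} {m : (H.obj b).left ⟶ r.arrow.right}
  {m' : (H.obj b').left ⟶ r.arrow.right} (hm : (H.map β).left ≫ m' = m)
  (P : Pushforward (H.obj b) r.arrow m) (P' : Pushforward (H.obj b') r.arrow m') {γ : G}
  (e : (T.obj γ).right ⟶ (H.obj b).right) {e' : (T.obj γ).right ⟶ (H.obj b').right}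
  (he : e' = e ≫ (H.map β).right)
  (t : pullback ((T.obj γ).hom ≫ e) (H.obj b).hom ⟶ r.arrow.left)
  (ht : t ≫ r.arrow.hom = pullback.snd ((T.obj γ).hom ≫ e) (H.obj b).hom ≫ m)
  (t' : pullback ((T.obj γ).hom ≫ e') (H.obj b').hom ⟶ r.arrow.left)
  (ht' : t' ≫ r.arrow.hom = pullback.snd ((T.obj γ).hom ≫ e') (H.obj b').hom ≫ m')

/-- The square to the pullback of a pushforward corresponding to a square from a base change. -/
noncomputable def curriedPullbackSquare : T.obj γ ⟶
    ((P'.rightMap l).pullback (X := (H.obj b).right) (H.map β).right).arrow :=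
  Arrow.homMk (g := Arrow.mk (pullback.snd P'.proj (H.map β).right))
    (pullback.lift (P'.curry ((T.obj γ).hom ≫ e') t' ht') ((T.obj γ).hom ≫ e)
      (by rw [P'.curry_proj, he, Category.assoc])) e (pullback.lift_snd _ _ _)

/-- The filler of the square to the pullback of a pushforward. -/
noncomputable def pullbackFill : (T.obj γ).right ⟶ Limits.pullback P'.proj (H.map β).right :=
  W.fill (b := (P'.rightMap l).pullback (X := (H.obj b).right) (H.map β).right)
    (curriedPullbackSquare l β P' e he t' ht')

lemma pullbackFill_fst : pullbackFill l W β P' e he t' ht' ≫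
    pullback.fst P'.proj (H.map β).right = transposedFill l W P' e' t' ht' := by
  refine Eq.trans (W.natural_right ((P'.rightMap l).pullbackProj (X := (H.obj b).right)
    (H.map β).right) (curriedPullbackSquare l β P' e he t' ht')).symm ?_
  unfold transposedFill
  congr 1
  exact Arrow.hom_ext _ _ (pullback.lift_fst _ _ _) he.symm

lemma pullbackFill_snd : pullbackFill l W β P' e he t' ht' ≫
    pullback.snd P'.proj (H.map β).right = e :=
  W.fill_hom (b := (P'.rightMap l).pullback (X := (H.obj b).right) (H.map β).right)
    (curriedPullbackSquare l β P' e he t' ht')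

lemma pullbackFill_comparison
    (w : 𝟙 _ ≫ (T.obj γ).hom ≫ e' = ((T.obj γ).hom ≫ e) ≫ (H.map β).right)
    (htt' : t = pullbackMap (𝟙 _) (H.map β) w ≫ t') : pullbackFill l W β P' e he t' ht' ≫
    comparison (H.map β) P P' hm = transposedFill l W P e t ht := by
  refine Eq.trans (W.natural_right (comparisonMap l β hm P P')
    (curriedPullbackSquare l β P' e he t' ht')).symm ?_
  unfold transposedFill
  congr 1
  refine Arrow.hom_ext _ _ ?_ (Category.comp_id _)
  have hp : pullback.lift (P'.curry ((T.obj γ).hom ≫ e') t' ht') ((T.obj γ).hom ≫ e)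
      (by rw [P'.curry_proj, he, Category.assoc]) ≫ pullback.snd P'.proj (H.map β).right =
      (T.obj γ).hom ≫ e := pullback.lift_snd _ _ _
  have hc : (pullback.lift (P'.curry ((T.obj γ).hom ≫ e') t' ht') ((T.obj γ).hom ≫ e)
      (by rw [P'.curry_proj, he, Category.assoc]) ≫ comparison (H.map β) P P' hm) ≫ P.proj =
      (T.obj γ).hom ≫ e := by rw [Category.assoc, comparison_proj, hp]
  refine P.eq_of_uncurry_eq ((T.obj γ).hom ≫ e) _ _ hc (P.curry_proj _ _ _) ?_
  refine (uncurry_comparison (H.map β) P P' hm _ (by rw [he, Category.assoc]) _ hp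
    (by rw [pullback.lift_fst, P'.curry_proj]) hc w).trans ?_
  refine Eq.trans (htt'.trans ?_).symm (P.uncurry_curry _ _ _).symm
  refine congrArg _ (Eq.symm ?_)
  exact (P'.uncurry_congr _ (pullback.lift_fst _ _ _)).trans (P'.uncurry_curry _ _ _)

/-- The filler against the pullback of `P'` mediates: its projection to `P'` is the filler for `b'`,
and its image under the comparison is the filler for `b`. Both facts are naturality of `W` along
morphisms of right maps. -/
lemma transferFill_natural_base (hm : (H.map β).left ≫ m' = m)
    (he : e' = e ≫ (H.map β).right)
    (w : 𝟙 _ ≫ (T.obj γ).hom ≫ e' = ((T.obj γ).hom ≫ e) ≫ (H.map β).right)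
    (htt' : t = pullbackMap (𝟙 _) (H.map β) w ≫ t') (w' : 𝟙 _ ≫ e' = e ≫ (H.map β).right) :
    transferFill l W P e t ht =
      pullbackMap (𝟙 _) (H.map β) w' ≫ transferFill l W P' e' t' ht' := by
  have h := pullbackFill_comparison l W β hm P P' e he t ht t' ht' w htt'
  have h' := pullbackFill_fst l W β P' e he t' ht'
  refine ((P.uncurry_congr _ h).symm.trans (uncurry_comparison (H.map β) P P' hm e he _
    (pullbackFill_snd l W β P' e he t' ht') (by rw [h', transposedFill_proj])
    (by rw [h, transposedFill_proj]) w')).trans ?_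
  exact congrArg _ (P'.uncurry_congr _ h')

end Transfer

end Pushforward

/-! ### The Frobenius condition -/

section Frobenius

variable {E : Type u} [Category.{v} E] [HasPullbacks E] [IsLocallyCartesianClosed E]
  {A : Type u₁} [Category.{v₁} A] {B : Type u₂} [Category.{v₂} B] {U : A ⥤ Arrow E}
  {H : B ⥤ Arrow E} {G : Type u₃} [Category.{v₃} G] {T : G ⥤ Arrow E}
  (l : NatLift (baseChangeFunctor U H) (RightMap.forget U)) (W : NatLift T (RightMap.forget U))

/-- A choice of pushforward. -/
noncomputable def pushforward (h f : Arrow E) (m : h.left ⟶ f.right) : Pushforward h f m :=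
  Classical.choice (Pushforward.nonempty h f m)

/-- The filler of a square from a pullback to a right map. -/
noncomputable def frobeniusFill {γ : G} {b : B} (e : (T.obj γ).right ⟶ (H.obj b).right) [IsIso e]
    {r : RightMap U}
    (sq : Arrow.mk (pullback.snd ((T.obj γ).hom ≫ e) (H.obj b).hom) ⟶ r.arrow) :
    (H.obj b).left ⟶ r.arrow.left :=
  -- Fillers for base changes start at the pullback of `h` along `e`. In a cospan of
  -- `StrictPullback` the map `e` is an `eqToHom`, so this pullback is identified with the domain of
  -- `h`.
  inv (pullback.snd e (H.obj b).hom) ≫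
    (pushforward (H.obj b) r.arrow sq.right).transferFill l W e sq.left (Arrow.w sq)

section

variable {γ : G} {b : B} (e : (T.obj γ).right ⟶ (H.obj b).right) [IsIso e]
    {r : RightMap U}
    (sq : Arrow.mk (pullback.snd ((T.obj γ).hom ≫ e) (H.obj b).hom) ⟶ r.arrow)

lemma hom_frobeniusFill : pullback.snd ((T.obj γ).hom ≫ e) (H.obj b).hom ≫
    frobeniusFill l W e sq = sq.left := by
  have h : pullback.snd ((T.obj γ).hom ≫ e) (H.obj b).hom ≫ inv (pullback.snd e (H.obj b).hom) =
      baseChangeHom (T.obj γ) (H.obj b) e := by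
    rw [IsIso.comp_inv_eq, baseChangeHom_snd]
  rw [frobeniusFill, ← Category.assoc, h]
  exact Pushforward.baseChangeHom_transferFill _ _ _ _ _ _

lemma frobeniusFill_hom : frobeniusFill l W e sq ≫ r.arrow.hom = sq.right := by
  rw [frobeniusFill, Category.assoc]
  refine (congrArg _ (Pushforward.transferFill_hom l W _ e sq.left (Arrow.w sq))).trans ?_
  rw [IsIso.inv_hom_id_assoc]

lemma frobeniusFill_natural_right {r' : RightMap U} (ψ : r ⟶ r') :
    frobeniusFill l W e (sq ≫ ψ.hom) = frobeniusFill l W e sq ≫ ψ.hom.left := by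
  refine Eq.trans ?_ (Category.assoc _ _ _).symm
  refine congrArg (inv (pullback.snd e (H.obj b).hom) ≫ ·) ?_
  exact Pushforward.transferFill_natural_right l W _ e sq.left (Arrow.w sq) ψ rfl _ _ _ rfl

end

/-- A morphism of cospans is split in two: first `h` changes along `β` with the coalgebra fixed,
then the coalgebra changes along `α` over the new `h`. The intermediate map `e ≫ (H.map β).right`
need not be invertible, which is why `transferFill` allows an arbitrary `e`. -/
lemma frobeniusFill_natural_left {γ γ' : G} {b b' : B} (e : (T.obj γ).right ⟶ (H.obj b).right)
    [IsIso e] (e' : (T.obj γ').right ⟶ (H.obj b').right) [IsIso e'] (α : γ ⟶ γ') (β : b ⟶ b')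
    (w : (T.map α).right ≫ e' = e ≫ (H.map β).right) {r : RightMap U}
    (sq : Arrow.mk (pullback.snd ((T.obj γ).hom ≫ e) (H.obj b).hom) ⟶ r.arrow)
    (sq' : Arrow.mk (pullback.snd ((T.obj γ').hom ≫ e') (H.obj b').hom) ⟶ r.arrow)
    (w' : (T.map α).left ≫ (T.obj γ').hom ≫ e' = ((T.obj γ).hom ≫ e) ≫ (H.map β).right)
    (hl : sq.left = pullbackMap (T.map α).left (H.map β) w' ≫ sq'.left)
    (hr : (H.map β).left ≫ sq'.right = sq.right) :
    frobeniusFill l W e sq = (H.map β).left ≫ frobeniusFill l W e' sq' := by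
  have hw : (T.map α).left ≫ (T.obj γ').hom ≫ e' =
      ((T.obj γ).hom ≫ e ≫ (H.map β).right) ≫ (𝟙 (H.obj b') : H.obj b' ⟶ H.obj b').right :=
    w'.trans ((Category.assoc _ _ _).trans (Category.comp_id _).symm)
  have hsq : (pullbackMap (T.map α).left (𝟙 _) hw ≫ sq'.left) ≫ r.arrow.hom =
      pullback.snd ((T.obj γ).hom ≫ e ≫ (H.map β).right) (H.obj b').hom ≫ sq'.right :=
    (Category.assoc _ _ _).trans ((congrArg _ (Arrow.w sq')).trans
      ((Category.assoc _ _ _).symm.trans (congrArg (· ≫ sq'.right) (pullbackMap_id_snd _ hw))))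
  have hv : 𝟙 _ ≫ (T.obj γ).hom ≫ e ≫ (H.map β).right =
      ((T.obj γ).hom ≫ e) ≫ (H.map β).right :=
    (Category.id_comp _).trans (Category.assoc _ _ _).symm
  have h₁ := Pushforward.transferFill_natural_base l W β (pushforward (H.obj b) r.arrow sq.right)
    (pushforward (H.obj b') r.arrow sq'.right) e sq.left (Arrow.w sq) _ hsq hr rfl hv
    (by
      rw [hl, ← Category.assoc]
      congr 1
      apply pullback.hom_ext
      · rw [pullbackMap_fst, Category.assoc, pullbackMap_fst, reassoc_of% @pullbackMap_fst,
          Category.id_comp]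
      · rw [pullbackMap_snd, Category.assoc, pullbackMap_id_snd, pullbackMap_snd])
    (Category.id_comp _)
  have h₂ := Pushforward.transferFill_natural_left l W (pushforward (H.obj b') r.arrow sq'.right)
    (e ≫ (H.map β).right) _ hsq α e' sq'.left (Arrow.w sq') (w.trans (Category.comp_id _).symm)
    hw rfl
  unfold frobeniusFill
  rw [h₁, h₂, IsIso.inv_comp_eq, ← Category.assoc, ← Category.assoc, ← Category.assoc]
  congr 1
  rw [IsIso.eq_comp_inv, Category.assoc, pullbackMap_id_snd, pullbackMap_snd]

/-- The isomorphism of codomains underlying a cospan. -/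
def StrictPullback.rightHom
    (x : StrictPullback (T ⋙ (Arrow.rightFunc : Arrow E ⥤ E)) (H ⋙ Arrow.rightFunc)) :
    (T.obj x.fst).right ⟶ (H.obj x.snd).right :=
  eqToHom x.eq

instance (x : StrictPullback (T ⋙ (Arrow.rightFunc : Arrow E ⥤ E)) (H ⋙ Arrow.rightFunc)) :
    IsIso x.rightHom :=
  inferInstanceAs (IsIso (eqToHom x.eq))

/-- Base changes of arrows lifting against right maps lift against right maps. -/
noncomputable def frobeniusNatLift :
    NatLift (StrictPullback.map T H Arrow.rightFunc Arrow.rightFunc ⋙ pullbackFunctor E)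
      (RightMap.forget U) where
  fill {x r} sq := frobeniusFill l W (r := r) x.rightHom sq
  hom_fill {x r} sq := hom_frobeniusFill l W (r := r) x.rightHom sq
  fill_hom {x r} sq := frobeniusFill_hom l W (r := r) x.rightHom sq
  natural_left {x y r} φ sq := frobeniusFill_natural_left l W (r := r) x.rightHom
    y.rightHom φ.fst φ.snd φ.w _ sq
    ((Arrow.w_assoc _ _).trans ((congrArg _ φ.w).trans (Category.assoc _ _ _).symm)) rfl rfl
  natural_right {x r _} ψ sq := frobeniusFill_natural_right l W (r := r) x.rightHom sq ψ

end Frobenius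

end UniformFib

theorem mainTheorem3 (E : Type u) [Category.{v} E] [HasPullbacks E]
    [IsLocallyPresentable.{v} E] [UniformFib.IsLocallyCartesianClosed E]
    (c : UniformFib.FunctorialCylinder E) [c.cyl.IsLeftAdjoint]
    (C : UniformFib.AWFS E) (hC : C.IsSuitable c)
    (J : Type v) [SmallCategory J] (j : J ⥤ Arrow E) (hj : C.IsAlgebraicallyFree j)
    (Ct : UniformFib.AWFS E)
    (hCt : UniformFib.IsoOver Ct.monad.forget (UniformFib.UniformFibration.forget c j)) :
    Ct.FunctorialFrobenius := by
  obtain ⟨l⟩ := UniformFib.nonempty_natLift_baseChange_tensorGen hC hj hCt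
  obtain ⟨W⟩ := UniformFib.AWFS.nonempty_natLift_rightMap (S := Ct) (j := c.tensorGen j) hCt
  -- `l` makes pushforwards of uniform fibrations along algebras uniform fibrations, and `W`
  -- supplies fillers of all coalgebras against these.
  exact UniformFib.AWFS.hasLift_of_natLift hCt (UniformFib.frobeniusNatLift l W)
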